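/- All graphs are finite and simple. For a graph $G$, $N[v]$ denotes the closed neighbourhood of a vertex $v$, and a set $D\subseteq V(G)$ is dominating if $N[v]\cap D\neq\emptyset$ for every $v\in V(G)$. Let $\mathcal{D}(G)$ be the collection of dominating sets of $G$. The fractional domatic number $\mathrm{FDOM}(G)$ is the maximum of $\sum_{D\in\mathcal{D}(G)}x_D$ over all families $(x_D)_{D\in\mathcal{D}(G)}$ of nonnegative reals such that $\sum_{D\in\mathcal{D}(G),\,v\in D}x_D\le 1$ for every $v\in V(G)$. For $f\colon V(G)\to[0,1]$ and $0<r\le 1$, an $f$-dominating $r$-colouring of $G$ is a random subset $\mathbf{D}\subseteq V(G)$ such that $\mathbb{P}(N[v]\cap\mathbf{D}\neq\emptyset)\ge f(v)$ and $\mathbb{P}(v\in\mathbf{D})=r$ for every $v\in V(G)$. Let $\mathcal{B}$ be the family of the following eight graphs (up to isomorphism), where $C_7$ is the cycle on the vertices $0,1,\dots,6$ in this order: (1) the cycle $C_4$; (2) the complete bipartite graph $K_{2,3}$; (3) the cycle $C_7$; (4) two cycles $C_4$ with exactly one common vertex (and no further edges); (5) $C_7$ with the additional edge $\{2,5\}$;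 (6) $C_7$ with the additional edges $\{0,3\},\{0,4\}$; (7) $C_7$ with the additional edges $\{1,5\},\{2,6\}$; (8) $C_7$ with the additional edges $\{1,5\},\{2,6\},\{2,5\}$. Theorem. Let $G$ be a connected graph that is not isomorphic to a member of $\mathcal{B}$. (a) If $G$ has minimum degree at least $2$, then $\mathrm{FDOM}(G)\ge \tfrac52$. (b) If $G$ has at least $2$ vertices, then $G$ has an $f_G$-dominating $\tfrac25$-colouring, where $f_G(v)=\tfrac45$ if $\deg(v)=1$ and $f_G(v)=1$ otherwise. -/

import Mathlib

/-- `D` is a dominating set of `G`: every vertex has an element of `D` in its closed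
neighbourhood. -/
def SimpleGraph.IsDominatingSet {V : Type*} (G : SimpleGraph V) (D : Finset V) : Prop :=
  ∀ v, ∃ u ∈ D, u = v ∨ G.Adj v u

open scoped Classical in
/-- The collection `𝒟(G)` of all dominating sets of a finite graph `G`. -/
noncomputable def SimpleGraph.dominatingSets {V : Type*} [Fintype V] (G : SimpleGraph V) :
    Finset (Finset V) :=
  Finset.univ.filter fun D => G.IsDominatingSet D

open scoped Classical in
/-- Feasible points of the linear program that defines the fractional domatic number:
nonnegative weights on the dominating sets such that the dominating sets containing any given
vertex have total weight at most `1`. (Weights of other sets are irrelevant.) -/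
def SimpleGraph.IsFractionalDomaticWeight {V : Type*} [Fintype V] (G : SimpleGraph V)
    (x : Finset V → ℝ) : Prop :=
  (∀ D ∈ G.dominatingSets, 0 ≤ x D) ∧
    ∀ v, ∑ D ∈ G.dominatingSets.filter (fun D => v ∈ D), x D ≤ 1

/-- The values of the objective function at the feasible points of the linear program. -/
def SimpleGraph.fractionalDomaticValues {V : Type*} [Fintype V] (G : SimpleGraph V) : Set ℝ :=
  {t | ∃ x, G.IsFractionalDomaticWeight x ∧ t = ∑ D ∈ G.dominatingSets, x D}

/-- The fractional domatic number: the optimum of the linear program. -/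
noncomputable def SimpleGraph.fractionalDomaticNumber {V : Type*} [Fintype V]
    (G : SimpleGraph V) : ℝ :=
  sSup G.fractionalDomaticValues

theorem SimpleGraph.fractionalDomaticValues_nonempty {V : Type*} [Fintype V]
    (G : SimpleGraph V) : G.fractionalDomaticValues.Nonempty :=
  ⟨0, fun _ => 0, ⟨fun _ _ => le_rfl, fun v => by simp⟩, by simp⟩

/-- On a nonempty graph the linear program is bounded, so the supremum above is a genuine one. -/
theorem SimpleGraph.bddAbove_fractionalDomaticValues {V : Type*} [Fintype V] [Nonempty V]
    (G : SimpleGraph V) : BddAbove G.fractionalDomaticValues := by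
  classical
  refine ⟨Fintype.card V, ?_⟩
  rintro t ⟨x, ⟨hx, hv⟩, rfl⟩
  calc ∑ D ∈ G.dominatingSets, x D
      ≤ ∑ D ∈ G.dominatingSets, ∑ v : V, (if v ∈ D then x D else 0) := by
        refine Finset.sum_le_sum fun D hD => ?_
        have hdom : G.IsDominatingSet D := by
          simpa [SimpleGraph.dominatingSets] using hD
        obtain ⟨u, hu, -⟩ := hdom (Classical.arbitrary V)
        have h := Finset.single_le_sum (f := fun v : V => if v ∈ D then x D else 0)
          (fun v _ => by
            show 0 ≤ if v ∈ D then x D else 0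
            split_ifs
            · exact hx D hD
            · exact le_rfl) (Finset.mem_univ u)
        simpa [hu] using h
    _ = ∑ v : V, ∑ D ∈ G.dominatingSets, (if v ∈ D then x D else 0) := Finset.sum_comm
    _ ≤ ∑ _v : V, (1 : ℝ) := by
        refine Finset.sum_le_sum fun v _ => ?_
        rw [← Finset.sum_filter]
        convert hv v
    _ = Fintype.card V := by simp

open scoped Classical in
/-- The probability of the event `E` when a random subset of `V` is drawn with law `μ`, where
`μ D` is the probability of drawing `D`. -/
noncomputable def randomSubsetProb {V : Type*} [Fintype V] (μ : Finset V → ℝ)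
    (E : Finset V → Prop) : ℝ :=
  ∑ D ∈ Finset.univ.filter E, μ D

/-- `μ` is (the law of) an `f`-dominating `r`-colouring of `G`: a random subset `D` of `V` with
`P(N[v] ∩ D ≠ ∅) ≥ f v` and `P(v ∈ D) = r` for every vertex `v`. Since `V` is finite, the laws of
random subsets of `V` are the points of the standard simplex on `Finset V`. -/
def SimpleGraph.IsFDominatingColouring {V : Type*} [Fintype V] (G : SimpleGraph V)
    (f : V → ℝ) (r : ℝ) (μ : Finset V → ℝ) : Prop :=
  μ ∈ stdSimplex ℝ (Finset V) ∧
    ∀ v, f v ≤ randomSubsetProb μ (fun D => ∃ u ∈ D, u = v ∨ G.Adj v u) ∧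
      randomSubsetProb μ (fun D => v ∈ D) = r

/-- The demand function with value `4/5` at vertices of degree `1` and `1` at all others. -/
noncomputable def SimpleGraph.leafDemand {V : Type*} [Fintype V] (G : SimpleGraph V)
    [DecidableRel G.Adj] (v : V) : ℝ :=
  if G.degree v = 1 then 4 / 5 else 1

/-- Two 4-cycles `0123` and `0456` with a common vertex `0`. -/
def twoFourCycles : SimpleGraph (Fin 7) :=
  SimpleGraph.fromEdgeSet
    {s(0, 1), s(1, 2), s(2, 3), s(3, 0), s(0, 4), s(4, 5), s(5, 6), s(6, 0)}

/-- The 7-cycle `0123456` together with extra edges (chords). -/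
def sevenCycleWith (chords : Set (Sym2 (Fin 7))) : SimpleGraph (Fin 7) :=
  SimpleGraph.cycleGraph 7 ⊔ SimpleGraph.fromEdgeSet chords

/-- `G` is isomorphic to one of the eight exceptional graphs of the family `ℬ`. -/
def SimpleGraph.IsExceptional {V : Type*} (G : SimpleGraph V) : Prop :=
  Nonempty (G ≃g SimpleGraph.cycleGraph 4) ∨
  Nonempty (G ≃g completeBipartiteGraph (Fin 2) (Fin 3)) ∨
  Nonempty (G ≃g SimpleGraph.cycleGraph 7) ∨
  Nonempty (G ≃g twoFourCycles) ∨
  Nonempty (G ≃g sevenCycleWith {s(2, 5)}) ∨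
  Nonempty (G ≃g sevenCycleWith {s(0, 3), s(0, 4)}) ∨
  Nonempty (G ≃g sevenCycleWith {s(1, 5), s(2, 6)}) ∨
  Nonempty (G ≃g sevenCycleWith {s(1, 5), s(2, 6), s(2, 5)})

/-! A law of random sets that contains each vertex with probability 2/5 and dominates almost surely
gives, after scaling by 5/2, a feasible point of value 5/2. So (a) is the leafless case of (b).

For (b), consider a counterexample with the fewest vertices and, on that vertex set, with a minimal
edge set. Each reduction simplifies a piece of the graph, takes a law for the smaller graph and
extends it by a random choice that depends only on whether the attaching vertices belong to the set
or are undominated. The attaching vertex may have become a leaf, or the smaller graph may be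
exceptional. Induction therefore supplies only `Weak` laws, which may miss that vertex with
probability 1/5 or 2/5, and the extension has to dominate it. The finitely many exceptional
situations left over are settled by explicit lists of sets. As a result, a minimal counterexample
has no leaves, no adjacent vertices of degree at least three, no three consecutive vertices of
degree two, and no two vertices of degree two with the same pair of branch neighbours. It is a
`Skeleton`: independent branch vertices joined by paths with one inner vertex (short) or two (long).

A skeleton is coloured directly. Every branch vertex is switched on with probability 2/5, and the
vertices that are on belong to the set. The inner vertex of a short path from s to t is chosen when
both ends are off. This has probability 1/5 + P(s, t on), which is allowed if P(s, t on) ≤ 1/5 and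
then leaves slack 1/5 - P(s, t on). On a long path the inner vertex next to s is chosen if s is off
and the other end u is on; if both ends are off, a fair coin chooses one inner vertex. This has
probability 1/2 - P(s, u on)/2, so P(s, u on) ≥ 1/5 is needed. The correlated law built from `Kinds`
gives exactly 1/5 at the ends of long paths and at most 1/5 for every pair.

It remains to dominate branch vertices that are off. If at least two long paths end there, a
balanced orientation (`exists_balanced_colouring`) always points one of them at the vertex.
Otherwise a random neighbour on a short path is added in the bad states (`exists_repair`), and its
cost is at most half of the slack of that path, so both ends can be served. -/

namespace FracDom

universe u

/-! ### Finite laws -/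

/-- The indicator of a proposition. -/
noncomputable def ind (p : Prop) : ℝ := open Classical in if p then 1 else 0

theorem ind_true {p : Prop} (h : p) : ind p = 1 := by simp [ind, h]

theorem ind_false {p : Prop} (h : ¬ p) : ind p = 0 := by simp [ind, h]

theorem ind_nonneg (p : Prop) : 0 ≤ ind p := by
  by_cases h : p
  · rw [ind_true h]; exact zero_le_one
  · rw [ind_false h]

theorem ind_le_one (p : Prop) : ind p ≤ 1 := by
  by_cases h : p
  · rw [ind_true h]
  · rw [ind_false h]; exact zero_le_one

theorem ind_mono {p q : Prop} (h : p → q) : ind p ≤ ind q := by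
  by_cases hp : p
  · rw [ind_true hp, ind_true (h hp)]
  · rw [ind_false hp]; exact ind_nonneg q

theorem ind_and (p q : Prop) : ind (p ∧ q) = ind p * ind q := by
  by_cases hp : p <;> by_cases hq : q <;> simp [ind, hp, hq]

theorem ind_not (p : Prop) : ind (¬ p) = 1 - ind p := by
  by_cases hp : p <;> simp [ind, hp]

theorem ind_or_le (p q : Prop) : ind (p ∨ q) ≤ ind p + ind q := by
  by_cases hp : p <;> by_cases hq : q <;> simp [ind, hp, hq]

/-- A finite probability law. -/
structure IsLaw {ι : Type*} [Fintype ι] (w : ι → ℝ) : Prop where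
  nonneg : ∀ i, 0 ≤ w i
  sum_eq : ∑ i, w i = 1

/-- The probability of the event `E` under the weights `w`. -/
noncomputable def pr {ι : Type*} [Fintype ι] (w : ι → ℝ) (E : ι → Prop) : ℝ :=
  ∑ i, w i * ind (E i)

section pr

variable {ι : Type*} [Fintype ι] {w : ι → ℝ} {E F : ι → Prop}

theorem pr_nonneg (hw : IsLaw w) (E : ι → Prop) : 0 ≤ pr w E :=
  Finset.sum_nonneg fun i _ => mul_nonneg (hw.nonneg i) (ind_nonneg _)

theorem pr_mono (hw : IsLaw w) (h : ∀ i, 0 < w i → E i → F i) : pr w E ≤ pr w F := by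
  refine Finset.sum_le_sum fun i _ => ?_
  rcases (hw.nonneg i).eq_or_lt with h0 | h0
  · simp [← h0]
  · exact mul_le_mul_of_nonneg_left (ind_mono (h i h0)) (hw.nonneg i)

theorem pr_congr (h : ∀ i, E i ↔ F i) : pr w E = pr w F := by
  have : E = F := funext fun i => propext (h i)
  rw [this]

theorem pr_eq_one (hw : IsLaw w) (h : ∀ i, 0 < w i → E i) : pr w E = 1 := by
  rw [← hw.sum_eq]
  refine Finset.sum_congr rfl fun i _ => ?_
  rcases (hw.nonneg i).eq_or_lt with h0 | h0
  · simp [← h0]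
  · rw [ind_true (h i h0), mul_one]

theorem pr_le_one (hw : IsLaw w) (E : ι → Prop) : pr w E ≤ 1 := by
  rw [← pr_eq_one hw (E := fun _ => True) fun _ _ => trivial]
  exact pr_mono hw fun _ _ _ => trivial

theorem pr_not (hw : IsLaw w) (E : ι → Prop) : pr w (fun i => ¬ E i) = 1 - pr w E := by
  rw [← hw.sum_eq, pr, pr, ← Finset.sum_sub_distrib]
  refine Finset.sum_congr rfl fun i _ => ?_
  rw [ind_not]; ring

theorem pr_eq_zero (h : ∀ i, ¬ E i) : pr w E = 0 :=
  Finset.sum_eq_zero fun i _ => by rw [ind_false (h i), mul_zero]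

/-- On a finite space an almost sure event holds at every atom of positive weight. This turns demand
1 into a deterministic statement. -/
theorem of_one_le_pr (hw : IsLaw w) (h : 1 ≤ pr w E) {i : ι} (hi : 0 < w i) : E i := by
  by_contra hE
  have h1 : pr w E < ∑ i, w i := by
    refine Finset.sum_lt_sum (fun j _ => ?_) ⟨i, Finset.mem_univ i, ?_⟩
    · exact mul_le_of_le_one_right (hw.nonneg j) (ind_le_one _)
    · rw [ind_false hE, mul_zero]; exact hi
  rw [hw.sum_eq] at h1
  exact absurd h (not_le.mpr h1)

theorem pr_or_le (hw : IsLaw w) (E F : ι → Prop) :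
    pr w (fun i => E i ∨ F i) ≤ pr w E + pr w F := by
  rw [pr, pr, pr, ← Finset.sum_add_distrib]
  refine Finset.sum_le_sum fun i _ => ?_
  rw [← mul_add]
  exact mul_le_mul_of_nonneg_left (ind_or_le _ _) (hw.nonneg i)

end pr

theorem isLaw_kernel {ι C : Type*} [Fintype ι] [Fintype C] {w : ι → ℝ} (hw : IsLaw w)
    {κ : ι → C → ℝ} (hκ : ∀ i, IsLaw (κ i)) : IsLaw fun p : ι × C => w p.1 * κ p.1 p.2 where
  nonneg p := mul_nonneg (hw.nonneg _) ((hκ _).nonneg _)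
  sum_eq := by
    rw [Fintype.sum_prod_type, ← hw.sum_eq]
    refine Finset.sum_congr rfl fun i _ => ?_
    dsimp only
    rw [← Finset.mul_sum, (hκ i).sum_eq, mul_one]

theorem pr_kernel {ι C : Type*} [Fintype ι] [Fintype C] (w : ι → ℝ) (κ : ι → C → ℝ)
    (E : ι × C → Prop) :
    pr (fun p : ι × C => w p.1 * κ p.1 p.2) E = ∑ i, w i * pr (κ i) fun c => E (i, c) := by
  rw [pr, Fintype.sum_prod_type]
  refine Finset.sum_congr rfl fun i _ => ?_
  rw [pr, Finset.mul_sum]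
  exact Finset.sum_congr rfl fun c _ => by ring

theorem pr_kernel_fst {ι C : Type*} [Fintype ι] [Fintype C] (w : ι → ℝ)
    {κ : ι → C → ℝ} (hκ : ∀ i, IsLaw (κ i)) (E : ι → Prop) :
    pr (fun p : ι × C => w p.1 * κ p.1 p.2) (fun p => E p.1) = pr w E := by
  rw [pr_kernel]
  refine Finset.sum_congr rfl fun i _ => ?_
  congr 1
  have := (hκ i).sum_eq
  rw [pr]
  dsimp only
  rw [← Finset.sum_mul, this, one_mul]

/-- The law of a function of a random element. -/
noncomputable def mapLaw {ι κ : Type*} [Fintype ι] (w : ι → ℝ) (X : ι → κ) (k : κ) : ℝ :=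
  ∑ i, w i * ind (X i = k)

theorem sum_ind_eq_mul {κ : Type*} [Fintype κ] (a : κ) (g : κ → ℝ) :
    ∑ k, ind (a = k) * g k = g a := by
  rw [Finset.sum_eq_single a]
  · rw [ind_true rfl, one_mul]
  · intro b _ hb; rw [ind_false (Ne.symm hb), zero_mul]
  · simp

theorem pr_mapLaw {ι κ : Type*} [Fintype ι] [Fintype κ] (w : ι → ℝ) (X : ι → κ)
    (E : κ → Prop) : pr (mapLaw w X) E = pr w fun i => E (X i) := by
  simp only [pr, mapLaw, Finset.sum_mul]
  rw [Finset.sum_comm]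
  refine Finset.sum_congr rfl fun i _ => ?_
  rw [← sum_ind_eq_mul (X i) fun k => ind (E k), Finset.mul_sum]
  exact Finset.sum_congr rfl fun k _ => by ring

theorem isLaw_mapLaw {ι κ : Type*} [Fintype ι] [Fintype κ] {w : ι → ℝ} (hw : IsLaw w)
    (X : ι → κ) : IsLaw (mapLaw w X) where
  nonneg k := Finset.sum_nonneg fun i _ => mul_nonneg (hw.nonneg i) (ind_nonneg _)
  sum_eq := by
    have h := pr_mapLaw w X fun _ => True
    rw [pr_eq_one hw fun _ _ => trivial, pr] at h
    simpa [ind] using h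

/-! ### Random sets dominating a graph -/

/-- The vertex `v` has an element of `D` in its closed neighbourhood. -/
def Dom {V : Type*} (G : SimpleGraph V) (D : Set V) (v : V) : Prop :=
  ∃ u ∈ D, u = v ∨ G.Adj v u

theorem Dom.mono {V : Type*} {G H : SimpleGraph V} {D D' : Set V} {v : V} (h : Dom G D v)
    (hD : D ⊆ D') (hG : ∀ w, G.Adj v w → H.Adj v w) : Dom H D' v := by
  obtain ⟨u, hu, h⟩ := h
  exact ⟨u, hD hu, h.imp_right (hG u)⟩

/-- A random set dominates each vertex `v` with probability at least `f v` and contains it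
with probability `2 / 5`. -/
def Colourable {V : Type*} [Fintype V] (G : SimpleGraph V) (f : V → ℝ) : Prop :=
  open Classical in
  ∃ w : Set V → ℝ, IsLaw w ∧ ∀ v, f v ≤ pr w (fun D => Dom G D v) ∧ pr w (fun D => v ∈ D) = 2 / 5

-- Enlarging a set never destroys domination, so a membership probability below 2/5 can be raised to
-- 2/5 by independent insertions, one vertex at a time. Later constructions need only upper bounds.
open Classical in
theorem colourable_of_law {V ι : Type*} [Fintype V] [Fintype ι] {G : SimpleGraph V} {f : V → ℝ}
    {w : ι → ℝ} (hw : IsLaw w) (D : ι → Set V)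
    (hdom : ∀ v, f v ≤ pr w fun i => Dom G (D i) v) (hmem : ∀ v, pr w (fun i => v ∈ D i) ≤ 2 / 5) :
    Colourable G f := by
  suffices h : ∀ A : Finset V, ∃ w : Set V → ℝ, IsLaw w ∧
      (∀ v, f v ≤ pr w (fun D => Dom G D v) ∧ pr w (fun D => v ∈ D) ≤ 2 / 5) ∧
      ∀ v ∈ A, pr w (fun D => v ∈ D) = 2 / 5 by
    obtain ⟨w, hw, h1, h2⟩ := h Finset.univ
    exact ⟨w, hw, fun v => ⟨(h1 v).1, h2 v (Finset.mem_univ v)⟩⟩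
  intro A
  induction A using Finset.induction_on with
  | empty =>
    refine ⟨mapLaw w D, isLaw_mapLaw hw D, fun v => ?_, by simp⟩
    rw [pr_mapLaw, pr_mapLaw]
    exact ⟨hdom v, hmem v⟩
  | insert a A _ ih =>
    obtain ⟨w, hw, h1, h2⟩ := ih
    set q := pr w (fun D => a ∈ D) with hq
    have hq0 : 0 ≤ q := pr_nonneg hw _
    have hq1 : q ≤ 2 / 5 := (h1 a).2
    -- The insertion probability solves q + (1 - q) t = 2/5.
    set t : ℝ := (2 / 5 - q) / (1 - q) with ht
    have ht0 : 0 ≤ t := div_nonneg (by linarith) (by linarith)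
    have ht1 : t ≤ 1 := (div_le_one (by linarith)).mpr (by linarith)
    have htq : t * (1 - q) = 2 / 5 - q := div_mul_cancel₀ _ (by linarith)
    set κ : Set V → Bool → ℝ := fun _ b => if b then t else 1 - t with hκdef
    have hκ : ∀ i, IsLaw (κ i) := fun i =>
      ⟨fun b => by cases b <;> simp [hκdef, ht0, ht1], by simp [hκdef]⟩
    set X : Set V × Bool → Set V := fun p => if p.2 then insert a p.1 else p.1 with hX
    have hlaw := isLaw_kernel hw hκ
    have hsub : ∀ p, p.1 ⊆ X p := by
      rintro ⟨D, b⟩; cases b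
      · simp [hX]
      · simp [hX]
    have hne : ∀ v, v ≠ a → pr (mapLaw (fun p : Set V × Bool => w p.1 * κ p.1 p.2) X)
        (fun D => v ∈ D) = pr w (fun D => v ∈ D) := by
      intro v hv
      rw [pr_mapLaw _ X, ← pr_kernel_fst w hκ]
      refine pr_congr ?_
      rintro ⟨D, b⟩; cases b <;> simp [hX, hv]
    have ha : pr (mapLaw (fun p : Set V × Bool => w p.1 * κ p.1 p.2) X)
        (fun D => a ∈ D) = 2 / 5 := by
      rw [pr_mapLaw, pr_kernel]
      have : ∀ D : Set V, w D * pr (κ D) (fun c => a ∈ X (D, c)) =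
          t * w D + (1 - t) * (w D * ind (a ∈ D)) := by
        intro D
        simp only [pr, Fintype.sum_bool, hX, hκdef]
        simp only [if_true, Bool.false_eq_true, if_false, Set.mem_insert_iff, true_or]
        rw [ind_true trivial]; ring
      rw [Finset.sum_congr rfl fun D _ => this D, Finset.sum_add_distrib, ← Finset.mul_sum,
        ← Finset.mul_sum, hw.sum_eq]
      change t * 1 + (1 - t) * q = 2 / 5
      linarith
    refine ⟨_, isLaw_mapLaw hlaw X, fun v => ⟨?_, ?_⟩, fun v hv => ?_⟩
    · rw [pr_mapLaw]
      refine (h1 v).1.trans ?_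
      rw [← pr_kernel_fst w hκ]
      exact pr_mono hlaw fun p _ h => h.mono (hsub p) fun _ => id
    · by_cases hv : v = a
      · rw [hv, ha]
      · rw [hne v hv]; exact (h1 v).2
    · by_cases hva : v = a
      · rw [hva, ha]
      · rw [hne v hva]
        exact h2 v ((Finset.mem_insert.mp hv).resolve_left hva)

theorem Colourable.mono {V : Type*} [Fintype V] {G H : SimpleGraph V} {f g : V → ℝ}
    (h : Colourable G f) (hf : ∀ v, g v ≤ f v) (hGH : G ≤ H) : Colourable H g := by
  classical
  obtain ⟨w, hw, h⟩ := h
  refine ⟨w, hw, fun v => ⟨((hf v).trans (h v).1).trans ?_, (h v).2⟩⟩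
  exact pr_mono hw fun D _ hD => hD.mono subset_rfl fun u hu => hGH hu

/-- Transport of a colouring along a surjection `r : V → V'` that maps closed neighbourhoods
onto closed neighbourhoods. -/
theorem Colourable.pullback {V V' : Type*} [Fintype V] [Fintype V'] {G : SimpleGraph V}
    {G' : SimpleGraph V'} {f : V → ℝ} {f' : V' → ℝ} (h : Colourable G' f') (r : V → V')
    (hf : ∀ v, f v ≤ f' (r v))
    (hr : ∀ v w', (w' = r v ∨ G'.Adj (r v) w') → ∃ w, r w = w' ∧ (w = v ∨ G.Adj v w)) :
    Colourable G f := by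
  classical
  obtain ⟨w, hw, h⟩ := h
  refine colourable_of_law hw (fun D => r ⁻¹' D) (fun v => ?_) fun v => (h (r v)).2.le
  refine ((hf v).trans (h (r v)).1).trans (pr_mono hw fun D _ => ?_)
  rintro ⟨u, hu, huv⟩
  obtain ⟨x, rfl, hx⟩ := hr v u huv
  exact ⟨x, hu, hx⟩

open Classical in
/-- Extension of a random set by a random choice of new vertices that depends on two events. -/
theorem colourable_of_extension {V V' ι C : Type*} [Fintype V] [Fintype ι] [Fintype C]
    {G : SimpleGraph V} {f : V → ℝ} {e : V' → V} (he : Function.Injective e) {w : ι → ℝ}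
    (hw : IsLaw w) (D : ι → Set V') (hD : ∀ v, pr w (fun i => v ∈ D i) = 2 / 5)
    (A B : ι → Prop) (M : Prop → Prop → C → ℝ) (hM : ∀ a b, IsLaw (M a b)) (N : C → Set V)
    (hN : ∀ c v, e v ∉ N c)
    (hnew : ∀ v, (∀ v', e v' ≠ v) →
      pr w (fun i => A i ∧ B i) * pr (M True True) (fun c => v ∈ N c) +
      (pr w A - pr w (fun i => A i ∧ B i)) * pr (M True False) (fun c => v ∈ N c) +
      (pr w B - pr w (fun i => A i ∧ B i)) * pr (M False True) (fun c => v ∈ N c) +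
      (1 - pr w A - pr w B + pr w (fun i => A i ∧ B i)) * pr (M False False) (fun c => v ∈ N c)
        ≤ 2 / 5)
    (hdom : ∀ v, f v ≤ pr (fun p : ι × C => w p.1 * M (A p.1) (B p.1) p.2)
      fun p => Dom G (e '' D p.1 ∪ N p.2) v) :
    Colourable G f := by
  have hκ : ∀ i, IsLaw (M (A i) (B i)) := fun i => hM _ _
  refine colourable_of_law (isLaw_kernel hw hκ) (fun p => e '' D p.1 ∪ N p.2) hdom fun v => ?_
  by_cases hv : ∃ v', e v' = v
  · obtain ⟨v', rfl⟩ := hv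
    have : ∀ p : ι × C, e v' ∈ e '' D p.1 ∪ N p.2 ↔ v' ∈ D p.1 := by
      intro p
      constructor
      · rintro (⟨x, hx, hxe⟩ | h)
        · rwa [← he hxe]
        · exact absurd h (hN _ _)
      · exact fun h => Or.inl ⟨v', h, rfl⟩
    rw [pr_congr this, pr_kernel_fst w hκ fun i => v' ∈ D i, hD]
  · push Not at hv
    have : ∀ p : ι × C, v ∈ e '' D p.1 ∪ N p.2 ↔ v ∈ N p.2 := by
      intro p
      constructor
      · rintro (⟨x, hx, hxe⟩ | h)
        · exact absurd hxe (hv x)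
        · exact h
      · exact Or.inr
    rw [pr_congr this, pr_kernel w fun i => M (A i) (B i)]
    refine le_trans (le_of_eq ?_) (hnew v hv)
    -- Splitting by the truth values of A and B expresses the four weights through the probabilities
    -- of A, B and their conjunction.
    have h1 : ∑ i, w i = 1 := hw.sum_eq
    rw [← h1]
    simp only [pr, Finset.sum_mul, ← Finset.sum_sub_distrib, ← Finset.sum_add_distrib]
    refine Finset.sum_congr rfl fun i _ => ?_
    by_cases ha : A i <;> by_cases hb : B i <;>
      simp [ind, ha, hb, Finset.mul_sum]

theorem le_pr_kernel {ι C : Type*} [Fintype ι] [Fintype C] {w : ι → ℝ} (hw : IsLaw w)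
    {κ : ι → C → ℝ} (hκ : ∀ i, IsLaw (κ i)) {E : ι × C → Prop} {F : ι → Prop} {x : ℝ}
    (hx : x ≤ pr w F) (h : ∀ i c, 0 < w i → 0 < κ i c → F i → E (i, c)) :
    x ≤ pr (fun p : ι × C => w p.1 * κ p.1 p.2) E := by
  refine hx.trans ?_
  rw [← pr_kernel_fst w hκ F]
  refine pr_mono (isLaw_kernel hw hκ) ?_
  rintro ⟨i, c⟩ hp
  have h1 : 0 < w i := (hw.nonneg i).lt_of_ne fun h0 => by simp [← h0] at hp
  have h2 : 0 < κ i c := ((hκ i).nonneg c).lt_of_ne fun h0 => by simp [← h0] at hp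
  exact h i c h1 h2

/-! ### Vertex types and demands -/

def IsLeaf {V : Type*} (G : SimpleGraph V) (v : V) : Prop := ∃ u, ∀ w, G.Adj v w ↔ w = u

/-- The neighbours of `v` are exactly the distinct vertices `a` and `b`. -/
def Two {V : Type*} (G : SimpleGraph V) (v a b : V) : Prop :=
  a ≠ b ∧ ∀ w, G.Adj v w ↔ w = a ∨ w = b

/-- The vertex `v` has at least three neighbours. -/
def Big {V : Type*} (G : SimpleGraph V) (v : V) : Prop :=
  ∃ a b c, a ≠ b ∧ a ≠ c ∧ b ≠ c ∧ G.Adj v a ∧ G.Adj v b ∧ G.Adj v c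

open Classical in
noncomputable def demand {V : Type*} (G : SimpleGraph V) (v : V) : ℝ :=
  if IsLeaf G v then 4 / 5 else 1

def Good {V : Type*} [Fintype V] (G : SimpleGraph V) : Prop := Colourable G (demand G)

open Classical in
/-- A colouring that may leave `v` undominated with probability at most `ε`. -/
def Weak {V : Type*} [Fintype V] (G : SimpleGraph V) (v : V) (ε : ℝ) : Prop :=
  Colourable G fun u => if u = v then 1 - ε else demand G u

section kinds

variable {V : Type*} {G : SimpleGraph V} {v a b : V}

theorem Two.symm (h : Two G v a b) : Two G v b a :=
  ⟨h.1.symm, fun w => (h.2 w).trans or_comm⟩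

theorem Two.adj_left (h : Two G v a b) : G.Adj v a := (h.2 a).mpr (Or.inl rfl)

theorem Two.adj_right (h : Two G v a b) : G.Adj v b := (h.2 b).mpr (Or.inr rfl)

theorem Two.not_big (h : Two G v a b) : ¬ Big G v := by
  rintro ⟨x, y, z, hxy, hxz, hyz, hx, hy, hz⟩
  rw [h.2] at hx hy hz
  grind

theorem Big.exists_ne {V : Type*} {G : SimpleGraph V} {x : V} (h : Big G x) (w : V) :
    ∃ y z, y ≠ z ∧ y ≠ w ∧ z ≠ w ∧ G.Adj x y ∧ G.Adj x z := by
  obtain ⟨a, b, c, hab, hac, hbc, ha, hb, hc⟩ := h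
  by_cases h1 : a = w
  · exact ⟨b, c, hbc, h1 ▸ hab.symm, h1 ▸ hac.symm, hb, hc⟩
  by_cases h2 : b = w
  · exact ⟨a, c, hac, h1, h2 ▸ hbc.symm, ha, hc⟩
  · exact ⟨a, b, hab, h1, h2, ha, hb⟩

theorem not_isLeaf_of_adj (h : a ≠ b) (ha : G.Adj v a) (hb : G.Adj v b) : ¬ IsLeaf G v := by
  rintro ⟨u, hu⟩
  exact h (((hu a).mp ha).trans ((hu b).mp hb).symm)

theorem leaf_or_two_or_big (h : G.Adj v a) : IsLeaf G v ∨ (∃ b c, Two G v b c) ∨ Big G v := by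
  by_cases h1 : ∀ w, G.Adj v w → w = a
  · exact Or.inl ⟨a, fun w => ⟨h1 w, fun hw => hw ▸ h⟩⟩
  push Not at h1
  obtain ⟨b, hb, hba⟩ := h1
  by_cases h2 : ∀ w, G.Adj v w → w = a ∨ w = b
  · exact Or.inr (Or.inl ⟨a, b, hba.symm, fun w => ⟨h2 w, by rintro (rfl | rfl) <;> assumption⟩⟩)
  push Not at h2
  obtain ⟨c, hc, hca, hcb⟩ := h2
  exact Or.inr (Or.inr ⟨a, b, c, hba.symm, hca.symm, hcb.symm, h, hb, hc⟩)

theorem demand_le_one (G : SimpleGraph V) (v : V) : demand G v ≤ 1 := by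
  unfold demand; split_ifs <;> norm_num

theorem demand_ge (G : SimpleGraph V) (v : V) : 4 / 5 ≤ demand G v := by
  unfold demand; split_ifs <;> norm_num

theorem demand_eq_one (h : ¬ IsLeaf G v) : demand G v = 1 := if_neg h

theorem demand_of_leaf (h : IsLeaf G v) : demand G v = 4 / 5 := if_pos h

end kinds

/-- No demand is below 4/5, so this applies even if v has become a leaf of the smaller graph. -/
theorem Good.weak {V : Type*} [Fintype V] {G : SimpleGraph V} (h : Good G) (v : V) {ε : ℝ}
    (hε : 1 / 5 ≤ ε) : Weak G v ε := by
  refine Colourable.mono h (fun u => ?_) le_rfl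
  split_ifs with hu
  · have := demand_ge G u
    linarith
  · exact le_rfl

theorem Weak.mono {V : Type*} [Fintype V] {G H : SimpleGraph V} {v : V} {ε δ : ℝ}
    (h : Weak G v ε) (hε : ε ≤ δ) (hGH : G ≤ H)
    (hl : ∀ u, u ≠ v → IsLeaf G u → IsLeaf H u) : Weak H v δ := by
  refine Colourable.mono h (fun u => ?_) hGH
  split_ifs with hu
  · linarith
  · by_cases hG : IsLeaf G u
    · rw [demand_of_leaf hG, demand_of_leaf (hl u hu hG)]
    · rw [demand_eq_one hG]; exact demand_le_one H u

theorem good_of_colourable_one {V : Type*} [Fintype V] {G : SimpleGraph V}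
    (h : Colourable G fun _ => 1) : Good G :=
  Colourable.mono h (demand_le_one G) le_rfl

theorem Good.colourable_one {V : Type*} [Fintype V] {G : SimpleGraph V}
    (h : Good G) (hG : ∀ v, ¬ IsLeaf G v) : Colourable G fun _ => 1 :=
  Colourable.mono h (fun v => (demand_eq_one (hG v)).ge) le_rfl

open Classical in
theorem Weak.exists_law {V : Type*} [Fintype V] {G : SimpleGraph V} {v : V} {ε : ℝ}
    (h : Weak G v ε) : ∃ w : Set V → ℝ, IsLaw w ∧
      (∀ u, u ≠ v → demand G u ≤ pr w fun D => Dom G D u) ∧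
      pr w (fun D => ¬ Dom G D v) ≤ ε ∧ ∀ u, pr w (fun D => u ∈ D) = 2 / 5 := by
  obtain ⟨w, hw, h⟩ := h
  refine ⟨w, hw, fun u hu => ?_, ?_, fun u => (h u).2⟩
  · have := (h u).1
    simpa only [if_neg hu] using this
  · have := (h v).1
    simp only [if_true] at this
    rw [pr_not hw]
    linarith

section twoEvents

variable {ι C : Type*} [Fintype ι] [Fintype C] {w : ι → ℝ}

theorem sum_two (hw : IsLaw w) (A B : ι → Prop) (h : Prop → Prop → ℝ) :
    ∑ i, w i * h (A i) (B i) =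
      pr w (fun i => A i ∧ B i) * h True True +
      (pr w A - pr w (fun i => A i ∧ B i)) * h True False +
      (pr w B - pr w (fun i => A i ∧ B i)) * h False True +
      (1 - pr w A - pr w B + pr w (fun i => A i ∧ B i)) * h False False := by
  have h1 : ∑ i, w i = 1 := hw.sum_eq
  rw [← h1]
  simp only [pr, Finset.sum_mul, ← Finset.sum_sub_distrib, ← Finset.sum_add_distrib]
  refine Finset.sum_congr rfl fun i _ => ?_
  by_cases ha : A i <;> by_cases hb : B i <;> simp [ind, ha, hb]

end twoEvents

theorem Dom.image {V V' : Type*} {G : SimpleGraph V} {G' : SimpleGraph V'} {e : V' → V}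
    (hadj : ∀ x y, G'.Adj x y → G.Adj (e x) (e y)) {D : Set V'} {N : Set V} {v : V'}
    (h : Dom G' D v) : Dom G (e '' D ∪ N) (e v) := by
  obtain ⟨u, hu, h⟩ := h
  refine ⟨e u, Or.inl ⟨u, hu, rfl⟩, ?_⟩
  exact h.imp (congrArg e) (hadj v u)

/-! ### Reductions -/

-- The leaf u is omitted when v is chosen and added when v is undominated. Hence the events that u
-- and v are chosen are disjoint, each of probability 2/5, and u is dominated with probability
-- exactly 4/5. Adding u whenever v is missed is affordable as long as that has probability at most
-- 2/5.
open Classical in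
theorem good_of_leaf {V V' : Type*} [Fintype V] [Fintype V'] {G : SimpleGraph V}
    {G' : SimpleGraph V'} {e : V' → V} (he : Function.Injective e)
    (hadj : ∀ x y, G'.Adj x y ↔ G.Adj (e x) (e y)) {u : V} {v : V'}
    (hV : ∀ x, x = u ∨ ∃ y, e y = x) (heu : ∀ y, e y ≠ u) (hu : ∀ x, G.Adj u x ↔ x = e v)
    (h : Weak G' v (2 / 5)) : Good G := by
  obtain ⟨w, hw, h1, h2, h3⟩ := h.exists_law
  set U := pr w (fun D => ¬ Dom G' D v) with hU
  have hU0 : 0 ≤ U := pr_nonneg hw _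
  -- In the remaining states, of probability 3/5 - U, the leaf is added with probability t, which
  -- makes its total U + (3/5 - U) t = 2/5.
  set t : ℝ := (2 / 5 - U) / (3 / 5 - U) with ht
  have ht0 : 0 ≤ t := div_nonneg (by linarith) (by linarith)
  have ht1 : t ≤ 1 := (div_le_one (by linarith)).mpr (by linarith)
  have htU : (3 / 5 - U) * t = 2 / 5 - U := mul_div_cancel₀ _ (by linarith)
  have hand : pr w (fun D => v ∈ D ∧ ¬ Dom G' D v) = 0 :=
    pr_eq_zero fun D hD => hD.2 ⟨v, hD.1, Or.inl rfl⟩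
  let M : Prop → Prop → Bool → ℝ := fun a b c =>
    if a then (if c then 0 else 1) else if b then (if c then 1 else 0)
      else if c then t else 1 - t
  have hM : ∀ a b, IsLaw (M a b) := by
    intro a b
    constructor
    · intro c
      by_cases ha : a <;> by_cases hb : b <;> cases c <;> simp [M, ha, hb, ht0, ht1]
    · by_cases ha : a <;> by_cases hb : b <;> simp [M, ha, hb]
  have hlaw := isLaw_kernel hw fun D => hM (v ∈ D) (¬ Dom G' D v)
  have hMcalc : ∀ c : Bool, c = true → M True True c = 0 ∧ M True False c = 0 ∧
      M False True c = 1 ∧ M False False c = t := by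
    rintro c rfl; simp [M]
  have heud : ∀ x : V', ∀ z, G.Adj (e x) z → (∃ y, e y = z) ∨ (z = u ∧ x = v) := by
    intro x z hz
    rcases hV z with rfl | h
    · exact Or.inr ⟨rfl, he ((hu _).mp hz.symm)⟩
    · exact Or.inl h
  refine colourable_of_extension he hw (fun D => D) h3 (fun D => v ∈ D)
    (fun D => ¬ Dom G' D v) M hM (fun c => if c then {u} else ∅) ?_ ?_ ?_
  · intro c y
    cases c <;> simp [heu y]
  · intro x hx
    obtain rfl : x = u := (hV x).resolve_right fun ⟨y, hy⟩ => hx y hy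
    simp only [h3, hand, ← hU]
    simp only [pr, Fintype.sum_bool, M, ind]
    simp
    linarith
  · intro x
    rcases hV x with rfl | ⟨y, rfl⟩
    · have hleaf : IsLeaf G x := ⟨e v, hu⟩
      rw [demand_of_leaf hleaf]
      have hev : ∀ p : Set V' × Bool, (v ∈ p.1 ∨ p.2 = true) →
          Dom G (e '' p.1 ∪ if p.2 = true then {x} else ∅) x := by
        rintro ⟨D, c⟩ (h | h)
        · exact ⟨e v, Or.inl ⟨v, h, rfl⟩, Or.inr ((hu _).mpr rfl)⟩
        · refine ⟨x, Or.inr ?_, Or.inl rfl⟩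
          simp only at h
          simp [h]
      refine le_trans (le_of_eq ?_) (pr_mono hlaw fun p _ => hev p)
      rw [pr_kernel w fun D => M (v ∈ D) (¬ Dom G' D v)]
      have := sum_two hw (fun D => v ∈ D) (fun D => ¬ Dom G' D v)
        (fun a b => pr (M a b) fun c => a ∨ c = true)
      refine Eq.trans ?_ this.symm
      simp only [h3, hand, ← hU]
      simp only [pr, Fintype.sum_bool, M, ind]
      simp
      linarith
    · by_cases hy : y = v
      · subst hy
        refine (demand_le_one _ _).trans (ge_of_eq (pr_eq_one hlaw ?_))
        rintro ⟨D, c⟩ hp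
        by_cases hD : Dom G' D y
        · exact hD.image fun a b => (hadj a b).mp
        · have hyD : y ∉ D := fun h => hD ⟨y, h, Or.inl rfl⟩
          refine ⟨u, Or.inr ?_, Or.inr ((hu _).mpr rfl).symm⟩
          cases c
          · simp [M, hD, hyD] at hp
          · simp
      · refine le_pr_kernel hw (fun D => hM (v ∈ D) (¬ Dom G' D v)) (F := fun D => Dom G' D y) ?_
          fun D c _ _ h => h.image fun a b => (hadj a b).mp
        refine le_trans ?_ (h1 y hy)
        by_cases hl : IsLeaf G' y
        · rw [demand_of_leaf hl, demand_of_leaf]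
          obtain ⟨z, hz⟩ := hl
          refine ⟨e z, fun x => ⟨fun hx => ?_, ?_⟩⟩
          · rcases heud y x hx with ⟨y', rfl⟩ | ⟨-, h⟩
            · rw [(hz y').mp ((hadj _ _).mpr hx)]
            · exact absurd h hy
          · rintro rfl
            exact (hadj _ _).mp ((hz z).mpr rfl)
        · rw [demand_eq_one hl]; exact demand_le_one _ _

/-- A law as in `Weak` for a graph without leaves apart from the special vertex. -/
theorem Weak.exists_sure_law {V : Type*} [Fintype V] {G : SimpleGraph V} {v : V} {ε : ℝ}
    (h : Weak G v ε) (hG : ∀ u, u ≠ v → ¬ IsLeaf G u) :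
    open Classical in ∃ w : Set V → ℝ, IsLaw w ∧
      (∀ D, 0 < w D → ∀ u, u ≠ v → Dom G D u) ∧
      pr w (fun D => ¬ Dom G D v) ≤ ε ∧ (∀ u, pr w (fun D => u ∈ D) = 2 / 5) ∧
      pr w (fun D => v ∈ D ∧ ¬ Dom G D v) = 0 := by
  classical
  obtain ⟨w, hw, h1, h2, h3⟩ := h.exists_law
  refine ⟨w, hw, fun D hD u hu => ?_, h2, h3, pr_eq_zero fun D hD => hD.2 ⟨v, hD.1, Or.inl rfl⟩⟩
  have := h1 u hu
  rw [demand_eq_one (hG u hu)] at this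
  exact of_one_le_pr hw this hD

/-- Attaching a path with both ends joined to `v`: from a law for the rest and a kernel. -/
theorem colourable_of_attach {V V' C : Type*} [Fintype V] [Fintype V'] [Fintype C]
    {G : SimpleGraph V} {G' : SimpleGraph V'} {e : V' → V} (he : Function.Injective e)
    (hadj : ∀ x y, G'.Adj x y → G.Adj (e x) (e y)) {v : V'} {ε : ℝ} (h : Weak G' v ε)
    (hG : ∀ u, u ≠ v → ¬ IsLeaf G' u) (M : ℝ → Prop → Prop → C → ℝ)
    (N : C → Set V)
    (hM : ∀ U, 0 ≤ U → U ≤ ε → ∀ a b, IsLaw (M U a b)) (hN : ∀ c y, e y ∉ N c)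
    (hnew : ∀ U, 0 ≤ U → U ≤ ε → ∀ x, (∀ y, e y ≠ x) →
      2 / 5 * pr (M U True False) (fun c => x ∈ N c) + U * pr (M U False True) (fun c => x ∈ N c) +
      (3 / 5 - U) * pr (M U False False) (fun c => x ∈ N c) ≤ 2 / 5)
    (hv : ∀ U c, 0 < M U False True c → ∃ x ∈ N c, G.Adj (e v) x)
    (hx : ∀ U a b c x, 0 < M U a b c → (∀ y, e y ≠ x) →
      (∃ y ∈ N c, y = x ∨ G.Adj x y) ∨ (a ∧ G.Adj x (e v))) :
    Colourable G fun _ => 1 := by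
  classical
  obtain ⟨w, hw, h1, h2, h3, h4⟩ := h.exists_sure_law hG
  set U := pr w (fun D => ¬ Dom G' D v) with hU
  have hU0 : 0 ≤ U := pr_nonneg hw _
  refine colourable_of_extension he hw (fun D => D) h3 (fun D => v ∈ D)
    (fun D => ¬ Dom G' D v) (M U) (hM U hU0 h2) N hN ?_ ?_
  · intro x hx
    refine le_trans (le_of_eq ?_) (hnew U hU0 h2 x hx)
    simp only [h3, h4, ← hU]
    ring
  · intro x
    refine le_pr_kernel hw (fun D => hM U hU0 h2 (v ∈ D) (¬ Dom G' D v)) (F := fun _ => True)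
      (pr_eq_one hw fun _ _ => trivial).ge ?_
    intro D c hD hc _
    by_cases hxe : ∃ y, e y = x
    · obtain ⟨y, rfl⟩ := hxe
      by_cases hy : Dom G' D y
      · exact hy.image hadj
      · obtain rfl : y = v := by
          by_contra hne
          exact hy (h1 D hD y hne)
        have hyD : y ∉ D := fun h => hy ⟨y, h, Or.inl rfl⟩
        rw [eq_false hyD, eq_true hy] at hc
        obtain ⟨z, hz, hzy⟩ := hv U c hc
        exact ⟨z, Or.inr hz, Or.inr hzy⟩
    · push Not at hxe
      rcases hx U _ _ c x hc hxe with ⟨y, hy, hyx⟩ | ⟨ha, hxv⟩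
      · exact ⟨y, Or.inr hy, hyx⟩
      · exact ⟨e v, Or.inl ⟨v, ha, rfl⟩, Or.inr hxv⟩

/-! ### Pendant cycles and subdivided edges -/

section attach

variable {V V' : Type*} [Fintype V] [Fintype V'] {G : SimpleGraph V} {G' : SimpleGraph V'}
  {e : V' → V} {v : V'}

/-- If v is chosen, nothing is added; otherwise one of a, b is added at random, which dominates the
whole triangle. Each costs 3/10. -/
theorem colourable_of_triangle_loop (he : Function.Injective e)
    (hadj : ∀ x y, G'.Adj x y → G.Adj (e x) (e y)) (h : Weak G' v (2 / 5))
    (hG : ∀ u, u ≠ v → ¬ IsLeaf G' u) {a b : V} (hab : a ≠ b)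
    (hV : ∀ x, x = a ∨ x = b ∨ ∃ y, e y = x) (ha : ∀ y, e y ≠ a) (hb : ∀ y, e y ≠ b)
    (h1 : G.Adj (e v) a) (h2 : G.Adj a b) (h3 : G.Adj b (e v)) : Colourable G fun _ => 1 := by
  classical
  refine colourable_of_attach (C := Fin 3) he hadj h hG
    (fun _ p _ => if p then ![0, 0, 1] else ![1 / 2, 1 / 2, 0]) ![{a}, {b}, ∅] ?_ ?_ ?_ ?_ ?_
  · intro U _ _ p q
    by_cases hp : p
    · constructor
      · intro i; fin_cases i <;> simp [hp]
      · simp [hp, Fin.sum_univ_three]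
    · constructor
      · intro i; fin_cases i <;> simp [hp]
      · simp [hp, Fin.sum_univ_three]; norm_num
  · intro c y
    fin_cases c <;> simp [ha y, hb y]
  · intro U h0 h1 x hx
    rcases hV x with rfl | rfl | ⟨y, rfl⟩
    · simp [pr, Fin.sum_univ_three, ind, hab]; linarith
    · simp [pr, Fin.sum_univ_three, ind, hab.symm]; linarith
    · exact absurd rfl (hx y)
  · intro U c
    fin_cases c
    · intro; exact ⟨a, by simp, h1⟩
    · intro; exact ⟨b, by simp, h3.symm⟩
    · simp
  · intro U p q c x hc hx
    by_cases hp : p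
    · right
      refine ⟨hp, ?_⟩
      rcases hV x with rfl | rfl | ⟨y, rfl⟩
      · exact h1.symm
      · exact h3
      · exact absurd rfl (hx y)
    · left
      rcases hV x with rfl | rfl | ⟨y, rfl⟩
      · fin_cases c
        · simp
        · simp [h2]
        · simp [hp] at hc
      · fin_cases c
        · simp [h2.symm]
        · simp
        · simp [hp] at hc
      · exact absurd rfl (hx y)

/-- If v is chosen, a or c is added at random to dominate b. If v is undominated, both a and c are
added. In the other states b alone suffices, and it is used with total probability 2/5, the pair a,
c being the alternative. All three vertices then have probability 2/5. For b to have enough room, v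
must be missed with probability at most 1/5. -/
theorem colourable_of_square_loop (he : Function.Injective e)
    (hadj : ∀ x y, G'.Adj x y → G.Adj (e x) (e y)) (h : Weak G' v (1 / 5))
    (hG : ∀ u, u ≠ v → ¬ IsLeaf G' u) {a b c : V} (hab : a ≠ b) (hac : a ≠ c) (hbc : b ≠ c)
    (hV : ∀ x, x = a ∨ x = b ∨ x = c ∨ ∃ y, e y = x) (ha : ∀ y, e y ≠ a) (hb : ∀ y, e y ≠ b)
    (hc : ∀ y, e y ≠ c) (h1 : G.Adj (e v) a) (h2 : G.Adj a b) (h3 : G.Adj b c)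
    (h4 : G.Adj c (e v)) : Colourable G fun _ => 1 := by
  classical
  refine colourable_of_attach (C := Fin 4) he hadj h hG
    (fun U p q => if p then ![1 / 2, 0, 1 / 2, 0] else if q then ![0, 0, 0, 1]
      else ![0, 2 / 5 / (3 / 5 - U), 0, 1 - 2 / 5 / (3 / 5 - U)])
    ![{a}, {b}, {c}, {a, c}] ?_ ?_ ?_ ?_ ?_
  · intro U _ hU p q
    have hp0 : 0 ≤ 2 / 5 / (3 / 5 - U) := div_nonneg (by norm_num) (by linarith)
    have hp1 : 2 / 5 / (3 / 5 - U) ≤ 1 := (div_le_one (by linarith)).mpr (by linarith)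
    by_cases hp : p
    · constructor
      · intro i; fin_cases i <;> simp [hp]
      · simp [hp, Fin.sum_univ_four]; norm_num
    by_cases hq : q
    · constructor
      · intro i; fin_cases i <;> simp [hp, hq]
      · simp [hp, hq, Fin.sum_univ_four]
    · constructor
      · intro i; fin_cases i <;> simp only [hp, hq] <;> simp <;> linarith
      · simp [hp, hq, Fin.sum_univ_four]
  · intro i y
    fin_cases i <;> simp [ha y, hb y, hc y]
  · intro U h0 h1 x hx
    have hU : (3 / 5 - U) * (2 / 5 / (3 / 5 - U)) = 2 / 5 := mul_div_cancel₀ _ (by linarith)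
    rcases hV x with rfl | rfl | rfl | ⟨y, rfl⟩
    · simp [pr, Fin.sum_univ_four, ind, hab, hac]; linarith
    · simp [pr, Fin.sum_univ_four, ind, hab.symm, hbc]; linarith
    · simp [pr, Fin.sum_univ_four, ind, hac.symm, hbc.symm]; linarith
    · exact absurd rfl (hx y)
  · intro U i
    fin_cases i
    · simp
    · simp
    · simp
    · intro; exact ⟨a, by simp, h1⟩
  · intro U p q i x hi hx
    by_cases hp : p
    · rcases hV x with rfl | rfl | rfl | ⟨y, rfl⟩
      · exact Or.inr ⟨hp, h1.symm⟩
      · left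
        fin_cases i
        · simp [h2.symm]
        · simp
        · simp [h3]
        · simp [hp] at hi
      · exact Or.inr ⟨hp, h4⟩
      · exact absurd rfl (hx y)
    · left
      have hi' : i = 1 ∨ i = 3 := by
        by_cases hq : q <;> fin_cases i <;> simp [hp, hq] at hi ⊢
      rcases hV x with rfl | rfl | rfl | ⟨y, rfl⟩
      · rcases hi' with rfl | rfl <;> simp [h2]
      · rcases hi' with rfl | rfl <;> simp [h3, h2.symm]
      · rcases hi' with rfl | rfl <;> simp [h3.symm]
      · exact absurd rfl (hx y)

/-- If v is chosen, b or c is added at random. Otherwise one of the three pairs ac, bd, ad is added;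
each contains a neighbour of v, so an undominated v causes no extra cost. Every new vertex has total
probability 2/5. -/
theorem colourable_of_pentagon_loop (he : Function.Injective e)
    (hadj : ∀ x y, G'.Adj x y → G.Adj (e x) (e y)) (h : Weak G' v (2 / 5))
    (hG : ∀ u, u ≠ v → ¬ IsLeaf G' u) {a b c d : V} (hab : a ≠ b) (hac : a ≠ c) (had : a ≠ d)
    (hbc : b ≠ c) (hbd : b ≠ d) (hcd : c ≠ d)
    (hV : ∀ x, x = a ∨ x = b ∨ x = c ∨ x = d ∨ ∃ y, e y = x) (ha : ∀ y, e y ≠ a)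
    (hb : ∀ y, e y ≠ b) (hc : ∀ y, e y ≠ c) (hd : ∀ y, e y ≠ d)
    (h1 : G.Adj (e v) a) (h2 : G.Adj a b) (h3 : G.Adj b c)
    (h4 : G.Adj c d) (h5 : G.Adj d (e v)) : Colourable G fun _ => 1 := by
  classical
  refine colourable_of_attach (C := Fin 5) he hadj h hG
    (fun U p _ => if p then ![1 / 2, 1 / 2, 0, 0, 0] else ![0, 0, 1 / 3, 1 / 3, 1 / 3])
    ![{b}, {c}, {a, c}, {b, d}, {a, d}] ?_ ?_ ?_ ?_ ?_
  · intro U _ hU p q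
    by_cases hp : p
    · constructor
      · intro i; fin_cases i <;> simp [hp]
      · simp [hp, Fin.sum_univ_five]; norm_num
    · constructor
      · intro i; fin_cases i <;> simp [hp]
      · simp [hp, Fin.sum_univ_five]; norm_num
  · intro i y
    fin_cases i <;> simp [ha y, hb y, hc y, hd y]
  · intro U h0 h1 x hx
    rcases hV x with rfl | rfl | rfl | rfl | ⟨y, rfl⟩
    · simp [pr, Fin.sum_univ_five, ind, hab, hac, had]; linarith
    · simp [pr, Fin.sum_univ_five, ind, hab.symm, hbc, hbd]; linarith
    · simp [pr, Fin.sum_univ_five, ind, hac.symm, hbc.symm, hcd]; linarith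
    · simp [pr, Fin.sum_univ_five, ind, had.symm, hbd.symm, hcd.symm]; linarith
    · exact absurd rfl (hx y)
  · intro U i
    fin_cases i
    · simp
    · simp
    · intro; exact ⟨a, by simp, h1⟩
    · intro; exact ⟨d, by simp, h5.symm⟩
    · intro; exact ⟨a, by simp, h1⟩
  · intro U p q i x hi hx
    by_cases hp : p
    · have hi' : i = 0 ∨ i = 1 := by
        fin_cases i <;> simp [hp] at hi ⊢
      rcases hV x with rfl | rfl | rfl | rfl | ⟨y, rfl⟩
      · exact Or.inr ⟨hp, h1.symm⟩
      · left; rcases hi' with rfl | rfl <;> simp [h3]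
      · left; rcases hi' with rfl | rfl <;> simp [h3.symm]
      · exact Or.inr ⟨hp, h5⟩
      · exact absurd rfl (hx y)
    · left
      have hi' : i = 2 ∨ i = 3 ∨ i = 4 := by
        fin_cases i <;> simp [hp] at hi ⊢
      rcases hV x with rfl | rfl | rfl | rfl | ⟨y, rfl⟩
      · rcases hi' with rfl | rfl | rfl <;> simp [h2]
      · rcases hi' with rfl | rfl | rfl <;> simp [h3, h2.symm]
      · rcases hi' with rfl | rfl | rfl <;> simp [h3.symm, h4]
      · rcases hi' with rfl | rfl | rfl <;> simp [h4.symm]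
      · exact absurd rfl (hx y)

/-- Replacing an edge `x d` by a path `x a b c d`. -/
theorem colourable_of_subdivision (he : Function.Injective e) {x d : V'}
    (hadj : ∀ y z, G'.Adj y z → G.Adj (e y) (e z) ∨ (y = x ∧ z = d) ∨ (y = d ∧ z = x))
    (h : Colourable G' fun _ => 1) {a b c : V} (hab : a ≠ b) (hac : a ≠ c) (hbc : b ≠ c)
    (hV : ∀ x, x = a ∨ x = b ∨ x = c ∨ ∃ y, e y = x) (ha : ∀ y, e y ≠ a) (hb : ∀ y, e y ≠ b)
    (hc : ∀ y, e y ≠ c) (h1 : G.Adj (e x) a) (h2 : G.Adj a b) (h3 : G.Adj b c)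
    (h4 : G.Adj c (e d)) : Colourable G fun _ => 1 := by
  classical
  obtain ⟨w, hw, h⟩ := h
  have hdom : ∀ D, 0 < w D → ∀ v, Dom G' D v := fun D hD v => of_one_le_pr hw (h v).1 hD
  set p := pr w (fun D => x ∈ D ∧ d ∈ D) with hp
  have hp0 : 0 ≤ p := pr_nonneg hw _
  have hp1 : p ≤ 2 / 5 := by
    rw [← (h x).2]; exact pr_mono hw fun _ _ => And.left
  -- If neither end is chosen, which has probability 1/5 + p, the vertex b is used with probability
  -- t and the pair a, c otherwise. This value of t gives a and c probability 2/5, while b has 1/5 +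
  -- p/2.
  set t : ℝ := (1 / 5 + p / 2) / (1 / 5 + p) with ht
  have ht0 : 0 ≤ t := div_nonneg (by linarith) (by linarith)
  have ht1 : t ≤ 1 := (div_le_one (by linarith)).mpr (by linarith)
  have htp : (1 / 5 + p) * t = 1 / 5 + p / 2 := mul_div_cancel₀ _ (by linarith)
  -- If exactly one end is chosen, the new neighbour of the other end is added. It replaces the
  -- domination that the deleted edge may have provided.
  let M : Prop → Prop → Fin 4 → ℝ := fun i j =>
    if i then (if j then ![1 / 2, 0, 1 / 2, 0] else ![0, 0, 1, 0])
    else if j then ![1, 0, 0, 0] else ![0, t, 0, 1 - t]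
  have hM : ∀ i j, IsLaw (M i j) := by
    intro i j
    by_cases hi : i <;> by_cases hj : j <;>
    · constructor
      · intro k; fin_cases k <;> simp [M, hi, hj, ht0, ht1]
      · simp [M, hi, hj, Fin.sum_univ_four] <;> norm_num
  refine colourable_of_extension he hw (fun D => D) (fun v => (h v).2) (fun D => x ∈ D)
    (fun D => d ∈ D) M hM ![{a}, {b}, {c}, {a, c}] ?_ ?_ ?_
  · intro i y
    fin_cases i <;> simp [ha y, hb y, hc y]
  · intro z hz
    simp only [(h _).2, ← hp]
    rcases hV z with rfl | rfl | rfl | ⟨y, rfl⟩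
    · simp [pr, Fin.sum_univ_four, ind, M, hab, hac]; linarith
    · simp [pr, Fin.sum_univ_four, ind, M, hab.symm, hbc]; linarith
    · simp [pr, Fin.sum_univ_four, ind, M, hac.symm, hbc.symm]; linarith
    · exact absurd rfl (hz y)
  · intro z
    refine le_pr_kernel hw (fun D => hM (x ∈ D) (d ∈ D)) (F := fun _ => True)
      (pr_eq_one hw fun _ _ => trivial).ge ?_
    intro D i hD hi _
    have key : (x ∈ D → d ∈ D → i = 0 ∨ i = 2) ∧ (x ∈ D → d ∉ D → i = 2) ∧
        (x ∉ D → d ∈ D → i = 0) ∧ (x ∉ D → d ∉ D → i = 1 ∨ i = 3) := by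
      by_cases hx : x ∈ D <;> by_cases hd : d ∈ D <;> fin_cases i <;>
        simp [M, hx, hd] at hi ⊢
    have hxin : x ∈ D → e x ∈ e '' D ∪ (![{a}, {b}, {c}, {a, c}] : Fin 4 → Set V) i :=
      fun h => Or.inl ⟨x, h, rfl⟩
    have hdin : d ∈ D → e d ∈ e '' D ∪ (![{a}, {b}, {c}, {a, c}] : Fin 4 → Set V) i :=
      fun h => Or.inl ⟨d, h, rfl⟩
    rcases hV z with rfl | rfl | rfl | ⟨y, rfl⟩
    · by_cases hx : x ∈ D
      · exact ⟨_, hxin hx, Or.inr h1.symm⟩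
      · have : i = 0 ∨ i = 1 ∨ i = 3 := by
          by_cases hd : d ∈ D
          · exact Or.inl (key.2.2.1 hx hd)
          · exact Or.inr (key.2.2.2 hx hd)
        rcases this with rfl | rfl | rfl
        · exact ⟨z, by simp, Or.inl rfl⟩
        · exact ⟨b, by simp, Or.inr h2⟩
        · exact ⟨z, by simp, Or.inl rfl⟩
    · fin_cases i
      · exact ⟨a, by simp, Or.inr h2.symm⟩
      · exact ⟨z, by simp, Or.inl rfl⟩
      · exact ⟨c, by simp, Or.inr h3⟩
      · exact ⟨a, by simp, Or.inr h2.symm⟩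
    · by_cases hd : d ∈ D
      · exact ⟨_, hdin hd, Or.inr h4⟩
      · have : i = 2 ∨ i = 1 ∨ i = 3 := by
          by_cases hx : x ∈ D
          · exact Or.inl (key.2.1 hx hd)
          · exact Or.inr (key.2.2.2 hx hd)
        rcases this with rfl | rfl | rfl
        · exact ⟨z, by simp, Or.inl rfl⟩
        · exact ⟨b, by simp, Or.inr h3.symm⟩
        · exact ⟨z, by simp, Or.inl rfl⟩
    · obtain ⟨u, hu, huy⟩ := hdom D hD y
      rcases huy with rfl | huy
      · exact ⟨e u, Or.inl ⟨u, hu, rfl⟩, Or.inl rfl⟩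
      rcases hadj y u huy with h | ⟨rfl, rfl⟩ | ⟨rfl, rfl⟩
      · exact ⟨e u, Or.inl ⟨u, hu, rfl⟩, Or.inr h⟩
      · by_cases hy : y ∈ D
        · exact ⟨e y, Or.inl ⟨y, hy, rfl⟩, Or.inl rfl⟩
        · obtain rfl := key.2.2.1 hy hu
          exact ⟨a, by simp, Or.inr h1⟩
      · by_cases hy : y ∈ D
        · exact ⟨e y, Or.inl ⟨y, hy, rfl⟩, Or.inl rfl⟩
        · obtain rfl := key.2.1 hu hy
          exact ⟨c, by simp, Or.inr h4.symm⟩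

end attach

/-- Joining two graphs by an edge. -/
theorem colourable_of_bridge {V V₁ V₂ : Type*} [Fintype V] [Fintype V₁] [Fintype V₂]
    {G : SimpleGraph V} {G₁ : SimpleGraph V₁} {G₂ : SimpleGraph V₂} {e₁ : V₁ → V} {e₂ : V₂ → V}
    (he₁ : Function.Injective e₁) (he₂ : Function.Injective e₂)
    (hadj₁ : ∀ x y, G₁.Adj x y → G.Adj (e₁ x) (e₁ y))
    (hadj₂ : ∀ x y, G₂.Adj x y → G.Adj (e₂ x) (e₂ y))
    (hV : ∀ x, (∃ y, e₁ y = x) ∨ ∃ y, e₂ y = x) (hdisj : ∀ x y, e₁ x ≠ e₂ y)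
    {u : V₁} {v : V₂} (huv : G.Adj (e₁ u) (e₂ v))
    (h₁ : Weak G₁ u (2 / 5)) (h₂ : Weak G₂ v (2 / 5))
    (hl₁ : ∀ x, ¬ IsLeaf G₁ x) (hl₂ : ∀ x, ¬ IsLeaf G₂ x) : Colourable G fun _ => 1 := by
  classical
  obtain ⟨w₁, hw₁, hd₁, hu₁, hm₁, hz₁⟩ := h₁.exists_sure_law fun x _ => hl₁ x
  obtain ⟨w₂, hw₂, hd₂, hu₂, hm₂, hz₂⟩ := h₂.exists_sure_law fun x _ => hl₂ x
  set a₁ := pr w₁ (fun D => ¬ Dom G₁ D u) with ha₁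
  set a₂ := pr w₂ (fun D => ¬ Dom G₂ D v) with ha₂
  have h10 : 0 ≤ a₁ := pr_nonneg hw₁ _
  have h20 : 0 ≤ a₂ := pr_nonneg hw₂ _
  set s : ℝ := 1 - a₁ - a₂ with hs
  have hs0 : 0 < s := by linarith
  -- Density of a coupling with respect to the product law. States missing u are matched with states
  -- containing v, and vice versa; the remaining mass s = 1 - a₁ - a₂ is coupled independently.
  -- There is room because a₁ and a₂ are at most 2/5, the probability of containing the other
  -- endpoint.
  let g : Prop → Prop → Prop → Prop → ℝ := fun p q p' q' =>
    if p then (if p' then (2 / 5 - a₂) * (2 / 5 - a₁) / s * (25 / 4) else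
      if q' then 5 / 2 else (2 / 5 - a₂) / s * (5 / 2))
    else if q then (if p' then 5 / 2 else 0)
    else (if p' then (2 / 5 - a₁) / s * (5 / 2) else if q' then 0 else 1 / s)
  have hg0 : ∀ p q p' q', 0 ≤ g p q p' q' := by
    intro p q p' q'
    have e1 : 0 ≤ 2 / 5 - a₁ := by linarith
    have e2 : 0 ≤ 2 / 5 - a₂ := by linarith
    simp only [g]
    split_ifs <;> positivity
  have hrow : ∀ p q, ∑ D, w₂ D * g p q (v ∈ D) (¬ Dom G₂ D v) = 1 := by
    intro p q
    rw [sum_two hw₂ (fun D => v ∈ D) (fun D => ¬ Dom G₂ D v) (g p q), hz₂, hm₂, ← ha₂]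
    by_cases hp : p <;> by_cases hq : q <;> simp [g, hp, hq] <;> field_simp <;> rw [hs] <;> ring
  -- The second marginal is preserved too. A state that contains v and leaves v undominated does not
  -- occur.
  have hcol : ∀ p q, ∑ D, w₁ D * g (u ∈ D) (¬ Dom G₁ D u) p q = 1 ∨ (p ∧ q) := by
    intro p q
    by_cases hpq : p ∧ q
    · exact Or.inr hpq
    left
    rw [sum_two hw₁ (fun D => u ∈ D) (fun D => ¬ Dom G₁ D u) (fun x y => g x y p q), hz₁, hm₁,
      ← ha₁]
    by_cases hp : p <;> by_cases hq : q
    · exact absurd ⟨hp, hq⟩ hpq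
    all_goals simp [g, hp, hq]
    all_goals try field_simp
    all_goals try rw [hs]
    all_goals try ring
  set κ : Set V₁ → Set V₂ → ℝ := fun D₁ D₂ =>
    w₂ D₂ * g (u ∈ D₁) (¬ Dom G₁ D₁ u) (v ∈ D₂) (¬ Dom G₂ D₂ v) with hκdef
  have hκ : ∀ D, IsLaw (κ D) := fun D =>
    ⟨fun D' => mul_nonneg (hw₂.nonneg _) (hg0 _ _ _ _), hrow _ _⟩
  have hlaw := isLaw_kernel hw₁ hκ
  have hpos : ∀ D₁ D₂, 0 < w₁ D₁ * κ D₁ D₂ → 0 < w₁ D₁ ∧ 0 < w₂ D₂ ∧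
      0 < g (u ∈ D₁) (¬ Dom G₁ D₁ u) (v ∈ D₂) (¬ Dom G₂ D₂ v) := by
    intro D₁ D₂ h
    refine ⟨(hw₁.nonneg _).lt_of_ne fun h0 => ?_, (hw₂.nonneg _).lt_of_ne fun h0 => ?_,
      (hg0 _ _ _ _).lt_of_ne fun h0 => ?_⟩
    · simp [← h0] at h
    · simp [hκdef, ← h0] at h
    · simp only [hκdef] at h
      rw [← h0] at h
      simp at h
  refine colourable_of_law hlaw (fun p => e₁ '' p.1 ∪ e₂ '' p.2) ?_ ?_
  · intro x
    refine (pr_eq_one hlaw ?_).ge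
    rintro ⟨D₁, D₂⟩ hp
    obtain ⟨hp1, hp2, hp3⟩ := hpos D₁ D₂ hp
    rcases hV x with ⟨y, rfl⟩ | ⟨y, rfl⟩
    · by_cases hy : Dom G₁ D₁ y
      · exact hy.image hadj₁
      · obtain rfl : y = u := by
          by_contra hne
          exact hy (hd₁ D₁ hp1 y hne)
        have hyD : y ∉ D₁ := fun h => hy ⟨y, h, Or.inl rfl⟩
        by_cases hv : v ∈ D₂
        · exact ⟨e₂ v, Or.inr ⟨v, hv, rfl⟩, Or.inr huv⟩
        · simp [g, hy, hyD, hv] at hp3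
    · by_cases hy : Dom G₂ D₂ y
      · exact (hy.image hadj₂ (N := e₁ '' D₁)).mono (Set.union_comm _ _).subset fun _ => id
      · obtain rfl : y = v := by
          by_contra hne
          exact hy (hd₂ D₂ hp2 y hne)
        have hyD : y ∉ D₂ := fun h => hy ⟨y, h, Or.inl rfl⟩
        by_cases hv : u ∈ D₁
        · exact ⟨e₁ u, Or.inl ⟨u, hv, rfl⟩, Or.inr huv.symm⟩
        · simp [g, hy, hyD, hv] at hp3
  · intro x
    rcases hV x with ⟨y, rfl⟩ | ⟨y, rfl⟩
    · have : ∀ p : Set V₁ × Set V₂, e₁ y ∈ e₁ '' p.1 ∪ e₂ '' p.2 ↔ y ∈ p.1 := by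
        rintro ⟨D₁, D₂⟩
        constructor
        · rintro (⟨x, hx, hxe⟩ | ⟨x, hx, hxe⟩)
          · rwa [← he₁ hxe]
          · exact absurd hxe.symm (hdisj _ _)
        · exact fun h => Or.inl ⟨y, h, rfl⟩
      rw [pr_congr this, pr_kernel_fst w₁ hκ fun D => y ∈ D, hm₁]
    · have : ∀ p : Set V₁ × Set V₂, e₂ y ∈ e₁ '' p.1 ∪ e₂ '' p.2 ↔ y ∈ p.2 := by
        rintro ⟨D₁, D₂⟩
        constructor
        · rintro (⟨x, hx, hxe⟩ | ⟨x, hx, hxe⟩)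
          · exact absurd hxe (hdisj _ _)
          · rwa [← he₂ hxe]
        · exact fun h => Or.inr ⟨y, h, rfl⟩
      rw [pr_congr this, ← hm₂ y, pr, pr, Fintype.sum_prod_type, Finset.sum_comm]
      refine (Finset.sum_congr rfl fun D _ => ?_).le
      have hD : ¬ (v ∈ D ∧ ¬ Dom G₂ D v) := fun h => h.2 ⟨v, h.1, Or.inl rfl⟩
      have := (hcol (v ∈ D) (¬ Dom G₂ D v)).resolve_right hD
      calc ∑ D₁, w₁ D₁ * κ D₁ D * ind (y ∈ D)
          = w₂ D * ind (y ∈ D) *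
            ∑ D₁, w₁ D₁ * g (u ∈ D₁) (¬ Dom G₁ D₁ u) (v ∈ D) (¬ Dom G₂ D v) := by
            rw [Finset.mul_sum]
            exact Finset.sum_congr rfl fun D₁ _ => by simp only [hκdef]; ring
        _ = w₂ D * ind (y ∈ D) := by rw [this, mul_one]

/-! ### A correlated random set of branch vertices -/

/-- Each vertex is a core vertex, a root, or a leaf hanging on a vertex of the other types. -/
structure Kinds (V : Type*) where
  core : V → Prop
  par : V → Option V
  par_par : ∀ s u, par s = some u → par u = none
  not_core : ∀ s u, par s = some u → ¬ core s

/-- The common coin switches off all core vertices with probability 1/5. Thirty faces allow the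
thresholds 10, 12 and 15 for the probabilities 1/3, 2/5 and 1/2. -/
abbrev Coins (V : Type*) := Fin 5 × (V → Fin 30)

/-- The mean of a function of the coins. -/
noncomputable def mean {V : Type*} [Fintype V] [DecidableEq V] (f : Coins V → ℝ) : ℝ :=
  (∑ ω, f ω) / Fintype.card (Coins V)

section mean

variable {V : Type*} [Fintype V] [DecidableEq V]

theorem card_coins_pos : (0 : ℝ) < Fintype.card (Coins V) :=
  Nat.cast_pos.mpr Fintype.card_pos

theorem mean_add (f g : Coins V → ℝ) : mean (f + g) = mean f + mean g := by
  simp only [mean, Pi.add_apply, Finset.sum_add_distrib, add_div]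

theorem mean_sub (f g : Coins V → ℝ) : mean (f - g) = mean f - mean g := by
  simp only [mean, Pi.sub_apply, Finset.sum_sub_distrib, sub_div]

theorem mean_mono {f g : Coins V → ℝ} (h : ∀ ω, f ω ≤ g ω) : mean f ≤ mean g :=
  div_le_div_of_nonneg_right (Finset.sum_le_sum fun ω _ => h ω) card_coins_pos.le

theorem mean_nonneg {f : Coins V → ℝ} (h : ∀ ω, 0 ≤ f ω) : 0 ≤ mean f :=
  div_nonneg (Finset.sum_nonneg fun ω _ => h ω) card_coins_pos.le

theorem mean_one : mean (1 : Coins V → ℝ) = 1 := by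
  simp only [mean, Pi.one_apply, Finset.sum_const, Finset.card_univ, nsmul_eq_mul, mul_one]
  exact div_self card_coins_pos.ne'

/-- The function `f` does not depend on the coin of `s`. -/
def Free (f : Coins V → ℝ) (s : V) : Prop :=
  ∀ (ω : Coins V) k, f (ω.1, Function.update ω.2 s k) = f ω

omit [Fintype V] in
theorem Free.mul {f g : Coins V → ℝ} {s : V} (hf : Free f s) (hg : Free g s) :
    Free (f * g) s := fun ω k => by simp only [Pi.mul_apply, hf ω k, hg ω k]

omit [Fintype V] in
theorem Free.one_sub {f : Coins V → ℝ} {s : V} (hf : Free f s) : Free (1 - f) s :=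
  fun ω k => by simp only [Pi.sub_apply, Pi.one_apply, hf ω k]

omit [Fintype V] in
theorem Free.one {s : V} : Free (1 : Coins V → ℝ) s := fun _ _ => rfl

/-- Independence of the coin of s from everything that ignores it: the sum factorises after
splitting off that coordinate. -/
theorem sum_mul_of_free (f : (V → Fin 30) → ℝ) (s : V)
    (hf : ∀ c k, f (Function.update c s k) = f c) (g : Fin 30 → ℝ) :
    ∑ c, f c * g (c s) = (∑ c, f c) * ((∑ k, g k) / 30) := by
  have key : ∀ g : Fin 30 → ℝ, ∑ c, f c * g (c s) =
      (∑ r, f ((Equiv.funSplitAt s (Fin 30)).symm (0, r))) * ∑ k, g k := by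
    intro g
    rw [← (Equiv.funSplitAt s (Fin 30)).symm.sum_comp, Fintype.sum_prod_type, Finset.sum_comm,
      Finset.sum_mul]
    refine Finset.sum_congr rfl fun r _ => ?_
    rw [Finset.mul_sum]
    refine Finset.sum_congr rfl fun k _ => ?_
    have h : (Equiv.funSplitAt s (Fin 30)).symm (k, r) =
        Function.update ((Equiv.funSplitAt s (Fin 30)).symm (0, r)) s k := by
      ext t
      by_cases ht : t = s
      · subst ht; simp [Equiv.funSplitAt, Equiv.piSplitAt]
      · simp [Equiv.funSplitAt, Equiv.piSplitAt, ht]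
    rw [h, hf, Function.update_self]
  have h1 := key fun _ => 1
  simp only [mul_one, Finset.sum_const, Finset.card_univ, Fintype.card_fin, nsmul_eq_mul] at h1
  rw [key g, h1]
  push_cast
  ring

theorem mean_mul_of_free {f : Coins V → ℝ} {s : V} (hf : Free f s) (g : Fin 30 → ℝ) :
    mean (fun ω => f ω * g (ω.2 s)) = mean f * ((∑ k, g k) / 30) := by
  simp only [mean, Fintype.sum_prod_type]
  rw [div_mul_eq_mul_div, Finset.sum_mul]
  congr 1
  refine Finset.sum_congr rfl fun i _ => ?_
  exact sum_mul_of_free (fun c => f (i, c)) s (fun c k => hf (i, c) k) g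

end mean

/-! ### Joint probabilities of the states of branch vertices -/

namespace Kinds

variable {V : Type*} (K : Kinds V)

/-- The state of a vertex that is not a leaf. -/
def baseOn (ω : Coins V) (v : V) : Prop :=
  (K.core v ∧ ω.1 ≠ 0 ∧ ω.2 v < 15) ∨ (¬ K.core v ∧ ω.2 v < 12)

/-- The state of a vertex. -/
def On (ω : Coins V) (v : V) : Prop :=
  (K.par v = none ∧ K.baseOn ω v) ∨
    ∃ u, K.par v = some u ∧ (ω.2 v < 10 ∨ (ω.2 v < 15 ∧ K.baseOn ω u))

noncomputable def x (v : V) (ω : Coins V) : ℝ := ind (K.On ω v)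

/-- The indicator that the core vertices are not all switched off. -/
noncomputable def phase (ω : Coins V) : ℝ := ind (ω.1 ≠ 0)

variable {K}

theorem x_nonneg (v : V) (ω : Coins V) : 0 ≤ K.x v ω := ind_nonneg _

theorem x_le_one (v : V) (ω : Coins V) : K.x v ω ≤ 1 := ind_le_one _

theorem x_mul_self (v : V) : K.x v * K.x v = K.x v := by
  ext ω; by_cases h : K.On ω v <;> simp [x, ind, h]

theorem on_base {v : V} (h : K.par v = none) (ω : Coins V) : K.On ω v ↔ K.baseOn ω v := by
  simp [On, h]

variable [Fintype V] [DecidableEq V]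

omit [Fintype V] in
theorem free_x {s t : V} (hst : t ≠ s) (hp : K.par t ≠ some s) : Free (K.x t) s := by
  intro ω k
  have h1 : ∀ u, u ≠ s → (K.baseOn (ω.1, Function.update ω.2 s k) u ↔ K.baseOn ω u) := by
    intro u hu; simp [baseOn, Function.update_of_ne hu]
  unfold x On
  congr 1
  apply propext
  simp only [Function.update_of_ne hst, h1 t hst]
  refine or_congr Iff.rfl (exists_congr fun u => and_congr_right fun hu => ?_)
  rw [h1 u (by rintro rfl; exact hp hu)]

omit [Fintype V] in
theorem free_phase (s : V) : Free (phase (V := V)) s := fun _ _ => rfl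

theorem mean_phase : mean (phase (V := V)) = 4 / 5 := by
  have hc : (Fintype.card (V → Fin 30) : ℝ) ≠ 0 := Nat.cast_ne_zero.mpr Fintype.card_ne_zero
  simp only [mean, phase, Fintype.sum_prod_type, Fintype.card_prod, Fintype.card_fin,
    Fin.sum_univ_five, ind]
  simp
  field_simp
  norm_num

theorem sum_ind_lt (n : ℕ) (hn : n ≤ 30) : ∑ k : Fin 30, ind ((k : ℕ) < n) = n := by
  rw [Fin.sum_univ_eq_sum_range (fun k => ind (k < n)) 30]
  obtain ⟨m, hm⟩ := Nat.exists_eq_add_of_le hn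
  rw [hm, Finset.sum_range_add, Finset.sum_congr rfl fun k hk => ind_true (Finset.mem_range.mp hk),
    Finset.sum_eq_zero fun k _ => ind_false (by omega)]
  simp

/-- Given all other coins, a leaf is on with probability 1/2 if its parent is on and 1/3 if it is
off. -/
theorem mean_mul_leaf {f : Coins V → ℝ} {s u : V} (hs : K.par s = some u) (hf : Free f s) :
    mean (f * K.x s) = 1 / 3 * mean f + 1 / 6 * mean (f * K.x u) := by
  have hu := K.par_par s u hs
  have hus : u ≠ s := by rintro rfl; rw [hs] at hu; cases hu
  have hfu : Free (f * K.x u) s := hf.mul (free_x hus (by rw [hu]; simp))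
  have e : f * K.x s = (fun ω => f ω * ind (((ω.2 s : Fin 30) : ℕ) < 10)) +
      fun ω => (f * K.x u) ω *
        (ind (((ω.2 s : Fin 30) : ℕ) < 15) - ind (((ω.2 s : Fin 30) : ℕ) < 10)) := by
    ext ω
    have h1 : K.On ω s ↔ ((ω.2 s : Fin 30) : ℕ) < 10 ∨
        (((ω.2 s : Fin 30) : ℕ) < 15 ∧ K.On ω u) := by
      simp only [On, hs, hu]
      simp [Fin.lt_def]
    simp only [Pi.add_apply, Pi.mul_apply, x]
    by_cases h2 : ((ω.2 s : Fin 30) : ℕ) < 10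
    · have h3 : ((ω.2 s : Fin 30) : ℕ) < 15 := by omega
      rw [ind_true (h1.mpr (Or.inl h2)), ind_true h2, ind_true h3]; ring
    · by_cases h3 : ((ω.2 s : Fin 30) : ℕ) < 15 <;> by_cases h4 : K.On ω u
      all_goals simp only [ind, h1, h2, h3, h4]
      all_goals simp
  rw [e, mean_add, mean_mul_of_free hf fun k => ind ((k : ℕ) < 10),
    mean_mul_of_free hfu fun k => ind ((k : ℕ) < 15) - ind ((k : ℕ) < 10),
    Finset.sum_sub_distrib, sum_ind_lt 10 (by norm_num), sum_ind_lt 15 (by norm_num)]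
  push_cast
  ring

theorem mean_mul_root {f : Coins V → ℝ} {s : V} (hs : K.par s = none) (hc : ¬ K.core s)
    (hf : Free f s) : mean (f * K.x s) = 2 / 5 * mean f := by
  have e : f * K.x s = fun ω => f ω * ind (((ω.2 s : Fin 30) : ℕ) < 12) := by
    ext ω
    simp only [Pi.mul_apply, x]
    congr 2
    rw [on_base hs]
    simp [baseOn, hc, Fin.lt_def]
  rw [e, mean_mul_of_free hf fun k => ind ((k : ℕ) < 12), sum_ind_lt 12 (by norm_num)]
  push_cast
  ring

/-- Given the common coin, core vertices are on independently with probability 1/2, or are all off.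
-/
theorem mean_mul_core {f : Coins V → ℝ} {s : V} (hs : K.par s = none) (hc : K.core s)
    (hf : Free f s) : mean (f * K.x s) = 1 / 2 * mean (f * phase) := by
  have e : f * K.x s = fun ω => (f * phase : Coins V → ℝ) ω * ind (((ω.2 s : Fin 30) : ℕ) < 15) := by
    ext ω
    simp only [Pi.mul_apply, x, phase, mul_assoc, ← ind_and]
    congr 2
    rw [on_base hs]
    simp [baseOn, hc, Fin.lt_def]
  rw [e, mean_mul_of_free (hf.mul (free_phase s)) fun k => ind ((k : ℕ) < 15),
    sum_ind_lt 15 (by norm_num)]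
  push_cast
  ring

omit [Fintype V] [DecidableEq V] in
theorem x_mul_phase {s : V} (hs : K.par s = none) (hc : K.core s) :
    K.x s * phase = K.x s := by
  ext ω
  simp only [Pi.mul_apply, x, phase, ← ind_and]
  congr 1
  rw [on_base hs]
  apply propext
  simp only [baseOn, hc]
  tauto

theorem mean_x_base {s : V} (hs : K.par s = none) : mean (K.x s) = 2 / 5 := by
  have h := Free.one (s := s)
  rw [← one_mul (K.x s)]
  by_cases hc : K.core s
  · rw [mean_mul_core hs hc h, one_mul, mean_phase]; norm_num
  · rw [mean_mul_root hs hc h, mean_one]; norm_num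

theorem mean_x (s : V) : mean (K.x s) = 2 / 5 := by
  rcases hs : K.par s with _ | u
  · exact mean_x_base hs
  · rw [← one_mul (K.x s), mean_mul_leaf hs Free.one, one_mul, mean_one,
      mean_x_base (K.par_par s u hs)]
    norm_num

theorem mean_mul_x_le {f : Coins V → ℝ} (hf : ∀ ω, 0 ≤ f ω) (t : V) :
    mean (f * K.x t) ≤ mean f :=
  mean_mono fun ω => mul_le_of_le_one_right (hf ω) (x_le_one t ω)

theorem mean_mul_phase_le {f : Coins V → ℝ} (hf : ∀ ω, 0 ≤ f ω) :
    mean (f * phase) ≤ mean f :=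
  mean_mono fun ω => mul_le_of_le_one_right (hf ω) (ind_le_one _)

/-- Switching on a further vertex costs a factor `1 / 2`. -/
theorem mean_mul_x_le_half {f : Coins V → ℝ} (hf : ∀ ω, 0 ≤ f ω) {t : V} (ht : Free f t) :
    mean (f * K.x t) ≤ 1 / 2 * mean f := by
  have h0 := mean_nonneg hf
  rcases hs : K.par t with _ | u
  · by_cases hc : K.core t
    · rw [mean_mul_core hs hc ht]
      have := mean_mul_phase_le hf
      linarith
    · rw [mean_mul_root hs hc ht]; linarith
  · rw [mean_mul_leaf hs ht]
    have := mean_mul_x_le (K := K) hf u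
    linarith

/-- The parent is on with probability 2/5, and the leaf then follows with probability 1/2. -/
theorem mean_leaf_mul {s u : V} (hs : K.par s = some u) : mean (K.x s * K.x u) = 1 / 5 := by
  have hu := K.par_par s u hs
  have hus : u ≠ s := by rintro rfl; rw [hs] at hu; cases hu
  rw [mul_comm, mean_mul_leaf hs (free_x hus (by rw [hu]; simp)), x_mul_self, mean_x]
  norm_num

/-- This is 4/5 times 1/4: the common coin supplies the correlation. -/
theorem mean_core_mul {s t : V} (hst : s ≠ t) (hs : K.par s = none) (ht : K.par t = none)
    (hcs : K.core s) (hct : K.core t) : mean (K.x s * K.x t) = 1 / 5 := by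
  rw [mean_mul_core ht hct (free_x hst (by rw [hs]; simp)), x_mul_phase hs hcs, mean_x]
  norm_num

theorem mean_root_mul {s t : V} (hst : s ≠ t) (hs : K.par s ≠ some t) (ht : K.par t = none)
    (hct : ¬ K.core t) : mean (K.x s * K.x t) = 4 / 25 := by
  rw [mean_mul_root ht hct (free_x hst hs), mean_x]
  norm_num

theorem mean_pair_le {s t : V} (hst : s ≠ t) : mean (K.x s * K.x t) ≤ 1 / 5 := by
  have h := mean_x (K := K) s
  have h' := mean_x (K := K) t
  by_cases hs : K.par s = some t
  · exact (mean_leaf_mul hs).le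
  · have := mean_mul_x_le_half (K := K) (x_nonneg s) (free_x hst hs)
    linarith

/-- Vertices that are not leaves are independent, which gives 4/25, unless both are core, which
gives 1/5. -/
theorem mean_pair_base_ge {s t : V} (hst : s ≠ t) (hs : K.par s = none) (ht : K.par t = none) :
    4 / 25 ≤ mean (K.x s * K.x t) := by
  by_cases hct : K.core t
  · by_cases hcs : K.core s
    · rw [mean_core_mul hst hs ht hcs hct]; norm_num
    · rw [mul_comm, mean_root_mul hst.symm (by rw [ht]; simp) hs hcs]
  · rw [mean_root_mul hst (by rw [hs]; simp) ht hct]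

theorem mean_off_mul (f : Coins V → ℝ) (u : V) :
    mean ((1 - K.x u) * f) = mean f - mean (f * K.x u) := by
  rw [sub_mul, one_mul, mean_sub, mul_comm (K.x u)]

theorem mean_off_off (s t : V) :
    mean ((1 - K.x s) * (1 - K.x t)) = 1 / 5 + mean (K.x s * K.x t) := by
  have e : (1 - K.x s) * (1 - K.x t) = 1 - K.x s - (K.x t - K.x s * K.x t) := by ring
  rw [e, mean_sub, mean_sub, mean_sub, mean_one, mean_x, mean_x]
  ring

/-- A leaf is never a parent, so among three vertices one is the parent of neither of the others.
Revealed last, it costs a factor 1/2 on top of the pair bound 1/5. -/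
theorem mean_triple_le {s t r : V} (hst : s ≠ t) (hsr : s ≠ r) (htr : t ≠ r) :
    mean (K.x s * K.x t * K.x r) ≤ 1 / 10 := by
  have key : ∀ a b c : V, a ≠ b → a ≠ c → b ≠ c → K.par a ≠ some c → K.par b ≠ some c →
      mean (K.x a * K.x b * K.x c) ≤ 1 / 10 := by
    intro a b c hab hac hbc h1 h2
    have := mean_mul_x_le_half (K := K) (fun ω => mul_nonneg (x_nonneg a ω) (x_nonneg b ω))
      ((free_x hac h1).mul (free_x hbc h2))
    have h := mean_pair_le (K := K) hab
    have e : (fun ω => K.x a ω * K.x b ω) = K.x a * K.x b := rfl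
    rw [e] at this
    linarith
  have hl : ∀ a b c : V, K.par a = some b → K.par c ≠ some a := by
    intro a b c h1 h2
    have := K.par_par c a h2
    rw [h1] at this; cases this
  by_cases h1 : K.par s = some r
  · have e : K.x s * K.x t * K.x r = K.x t * K.x r * K.x s := by ring
    rw [e]
    exact key t r s htr hst.symm hsr.symm (hl s r t h1) (hl s r r h1)
  · by_cases h2 : K.par t = some r
    · have e : K.x s * K.x t * K.x r = K.x s * K.x r * K.x t := by ring
      rw [e]
      exact key s r t hsr hst htr.symm (hl t r s h2) (hl t r r h2)
    · exact key s t r hst hsr htr h1 h2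

/-- Only the case that t is a leaf of t' needs care. With a = P(u off, t' on), it amounts to a ≤
6/25, which is the lower bound 4/25 for two vertices that are not leaves. -/
theorem mean_off_half {u t t' : V} (hu : K.par u = none) (hut : u ≠ t) (hut' : u ≠ t')
    (htt' : t ≠ t') :
    mean ((1 - K.x u) * (K.x t * K.x t')) ≤ 1 / 2 * mean ((1 - K.x u) * K.x t) := by
  have hoff : ∀ ω, 0 ≤ (1 - K.x u) ω := fun ω => by
    have := x_le_one (K := K) u ω
    simp only [Pi.sub_apply, Pi.one_apply]; linarith
  rw [← mul_assoc]
  by_cases h : K.par t = some t'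
  · have ht' := K.par_par _ _ h
    have hfree : Free ((1 - K.x u) * K.x t') t :=
      (free_x hut (by rw [hu]; simp)).one_sub.mul (free_x htt'.symm (by rw [ht']; simp))
    have e : (1 - K.x u) * K.x t * K.x t' = (1 - K.x u) * K.x t' * K.x t := by ring
    have e2 : (1 - K.x u) * K.x t' * K.x t' = (1 - K.x u) * K.x t' := by
      rw [mul_assoc, x_mul_self]
    rw [e, mean_mul_leaf h hfree, mean_mul_leaf h (free_x hut (by rw [hu]; simp)).one_sub, e2,
      mean_off_mul, mean_sub, mean_one, mean_x, mean_x, mul_comm (K.x t')]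
    have := mean_pair_base_ge hut' hu ht'
    linarith
  · exact mean_mul_x_le_half (fun ω => mul_nonneg (hoff ω) (x_nonneg t ω))
      ((free_x hut' (by rw [hu]; simp)).one_sub.mul (free_x htt' h))

/-- With u off, s is off with probability 2/3, so by `mean_off_half` the left side is at most P(u
off, t on)/6. This equals the right side, by conditioning s on its parent. -/
theorem cost_leaf {s u t t' : V} (hs : K.par s = some u) (hst : s ≠ t) (hst' : s ≠ t')
    (hut : u ≠ t) (hut' : u ≠ t') (htt' : t ≠ t') :
    1 / 2 * mean ((1 - K.x s) * ((1 - K.x u) * (K.x t * K.x t'))) ≤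
      1 / 5 - mean (K.x s * K.x t) := by
  have hu := K.par_par s u hs
  have hus : u ≠ s := by rintro rfl; rw [hs] at hu; cases hu
  have hp : ∀ r, K.par r ≠ some s := fun r hr => by
    have := K.par_par r s hr
    rw [hs] at this; cases this
  have hft := free_x hst.symm (hp t)
  have hft' := free_x hst'.symm (hp t')
  have hfu := free_x hus (hp u)
  have h0 : (1 - K.x u) * (K.x t * K.x t') * K.x u = 0 := by
    have := x_mul_self (K := K) u
    calc (1 - K.x u) * (K.x t * K.x t') * K.x u
        = (K.x u - K.x u * K.x u) * (K.x t * K.x t') := by ring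
      _ = 0 := by rw [this]; ring
  have hz : mean (0 : Coins V → ℝ) = 0 := by simp [mean]
  rw [mean_off_mul, mean_mul_leaf hs (hfu.one_sub.mul (hft.mul hft')), h0, hz, mul_comm (K.x s),
    mean_mul_leaf hs hft, mean_x]
  have h1 := mean_off_half hu hut hut' htt'
  have h2 := mean_off_mul (K := K) (K.x t) u
  rw [mean_x] at h2
  linarith

/-- Both s and u are off with probability 3/5 · 2/3 = 2/5, independently of t and t'. The left side
is at most 1/2 · 2/5 · 1/5 = 1/25, which is the slack 1/5 - 4/25. -/
theorem cost_root {s u t t' : V} (hs : K.par s = none) (hc : ¬ K.core s) (hu : K.par u = some s)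
    (huniq : ∀ r, K.par r = some s → r = u) (hst : s ≠ t) (hst' : s ≠ t')
    (hut : u ≠ t) (hut' : u ≠ t') (htt' : t ≠ t') :
    1 / 2 * mean ((1 - K.x s) * ((1 - K.x u) * (K.x t * K.x t'))) ≤
      1 / 5 - mean (K.x s * K.x t) := by
  have hus : u ≠ s := by rintro rfl; rw [hs] at hu; cases hu
  have hp : ∀ r, K.par r ≠ some u := fun r hr => by
    have := K.par_par r u hr
    rw [hu] at this; cases this
  have hfs : Free (K.x t * K.x t') s :=
    (free_x hst.symm fun h => hut.symm (huniq t h)).mul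
      (free_x hst'.symm fun h => hut'.symm (huniq t' h))
  have hfu : Free ((1 - K.x s) * (K.x t * K.x t')) u :=
    (free_x hus.symm (hp s)).one_sub.mul ((free_x hut.symm (hp t)).mul (free_x hut'.symm (hp t')))
  have e : (1 - K.x s) * ((1 - K.x u) * (K.x t * K.x t')) =
      (1 - K.x u) * ((1 - K.x s) * (K.x t * K.x t')) := by ring
  have h0 : (1 - K.x s) * (K.x t * K.x t') * K.x s = 0 := by
    have := x_mul_self (K := K) s
    calc (1 - K.x s) * (K.x t * K.x t') * K.x s
        = (K.x s - K.x s * K.x s) * (K.x t * K.x t') := by ring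
      _ = 0 := by rw [this]; ring
  have hz : mean (0 : Coins V → ℝ) = 0 := by simp [mean]
  rw [e, mean_off_mul, mean_mul_leaf hu hfu, h0, hz, mean_off_mul, mean_mul_root hs hc hfs,
    mul_comm (K.x s), mean_root_mul hst.symm (fun h => hut.symm (huniq t h)) hs hc]
  have := mean_pair_le (K := K) htt'
  linarith

/-- Here s is independent of the others, so the left side is at most 2/3 · 3/5 · 1/10 = 1/25, again
the slack 1/5 - 4/25. -/
theorem cost_free {s t t' r : V} (hs : K.par s = none) (hc : ¬ K.core s)
    (hchild : ∀ a, K.par a ≠ some s) (hst : s ≠ t) (hst' : s ≠ t') (hsr : s ≠ r)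
    (htt' : t ≠ t') (htr : t ≠ r) (htr' : t' ≠ r) :
    2 / 3 * mean ((1 - K.x s) * (K.x t * K.x t' * K.x r)) ≤ 1 / 5 - mean (K.x s * K.x t) := by
  have hf : Free (K.x t * K.x t' * K.x r) s :=
    ((free_x hst.symm (hchild t)).mul (free_x hst'.symm (hchild t'))).mul
      (free_x hsr.symm (hchild r))
  rw [mean_off_mul, mean_mul_root hs hc hf, mul_comm (K.x s), mean_root_mul hst.symm (hchild t) hs hc]
  have := mean_triple_le (K := K) htt' htr htr'
  linarith

end Kinds

/-! ### Orientations -/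

/-- The union of two perfect matchings is bipartite. Algebraically, I inverts π = I K and therefore
permutes the cycles of π; no cycle is mapped to itself, so one colour can be given to one cycle of
each pair. -/
theorem exists_swap_colouring {T : Type*} (I K : Equiv.Perm T) (hI : I * I = 1) (hK : K * K = 1)
    (hI' : ∀ p, I p ≠ p) (hK' : ∀ p, K p ≠ p) :
    ∃ o : T → Prop, (∀ p, o (I p) ↔ ¬ o p) ∧ ∀ p, o (K p) ↔ ¬ o p := by
  set π := I * K with hπ
  have hIinv : I⁻¹ = I := inv_eq_of_mul_eq_one_left hI
  have hKinv : K⁻¹ = K := inv_eq_of_mul_eq_one_left hK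
  have hconj : ∀ k : ℤ, I * π ^ k = π ^ (-k) * I := by
    intro k
    have h1 : I * π * I⁻¹ = π⁻¹ := by
      rw [hπ, mul_inv_rev, hIinv, hKinv, ← mul_assoc, hI, one_mul]
    have h2 : I * π ^ k * I⁻¹ = π ^ (-k) := by
      rw [← conj_zpow, h1, inv_zpow, zpow_neg]
    rw [← h2]; group
  -- Were I p equal to π ^ k p, the point halfway along the cycle would be fixed by I (k even) or by
  -- K (k odd).
  have hne : ∀ p (k : ℤ), (π ^ k) p ≠ I p := by
    intro p k hk
    rcases Int.even_or_odd' k with ⟨j, rfl | rfl⟩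
    · apply hI' ((π ^ j) p)
      have := congrArg (π ^ (-j)) hk
      rw [← Equiv.Perm.mul_apply, ← Equiv.Perm.mul_apply, ← zpow_add, ← hconj,
        Equiv.Perm.mul_apply] at this
      rw [← this]; congr 2; ring
    · apply hK' ((π ^ j) p)
      have := congrArg (π ^ (-j)) hk
      rw [← Equiv.Perm.mul_apply, ← Equiv.Perm.mul_apply, ← zpow_add, ← hconj,
        Equiv.Perm.mul_apply] at this
      have h2 : -j + (2 * j + 1) = 1 + j := by ring
      rw [h2, zpow_add, zpow_one, hπ, Equiv.Perm.mul_apply, Equiv.Perm.mul_apply] at this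
      exact I.injective this
  have hlift : ∀ a b, π.SameCycle a b → π.SameCycle (I a) (I b) := by
    rintro a b ⟨k, rfl⟩
    exact ⟨-k, by rw [← Equiv.Perm.mul_apply, ← hconj, Equiv.Perm.mul_apply]⟩
  let Q := Quotient (Equiv.Perm.SameCycle.setoid π)
  let q : T → Q := Quotient.mk _
  have hq : ∀ a b, q a = q b ↔ π.SameCycle a b := fun a b => Quotient.eq
  let J : Q → Q := Quotient.map I hlift
  have hJ : ∀ a, J (q a) = q (I a) := fun a => rfl
  have hJJ : ∀ x, J (J x) = x := by
    intro x
    induction x using Quotient.inductionOn with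
    | h a =>
      change q (I (I a)) = q a
      rw [← Equiv.Perm.mul_apply, hI, Equiv.Perm.one_apply]
  have hJne : ∀ x, J x ≠ x := by
    intro x
    induction x using Quotient.inductionOn with
    | h a =>
      intro h
      obtain ⟨k, hk⟩ := (hq _ _).mp (h : q (I a) = q a).symm
      exact hne a k hk
  -- An arbitrary well-order selects one element of each pair of cycles.
  let o : Q → Prop := fun x => WellOrderingRel x (J x)
  have ho : ∀ x, o (J x) ↔ ¬ o x := by
    intro x
    simp only [o, hJJ]
    constructor
    · exact fun h h' => asymm h h'
    · intro h
      rcases trichotomous_of WellOrderingRel x (J x) with h1 | h1 | h1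
      · exact absurd h1 h
      · exact absurd h1.symm (hJne x)
      · exact h1
  refine ⟨fun p => o (q p), fun p => ho (q p), fun p => ?_⟩
  have : q (K p) = J (q p) := by
    rw [hJ, ← hJJ (q (K p)), hJ, hJ, hq]
    refine hlift _ _ ?_ |>.symm
    exact ⟨1, by rw [zpow_one, hπ, Equiv.Perm.mul_apply]⟩
  simp only [this, ho]

/-- Given a fixed-point-free involution `σ` on `T` and a map `g : T → S`, the elements of `T` can
be coloured with two colours such that `σ` swaps the colours and each fibre of `g` with at least
two elements gets both colours. -/
theorem exists_balanced_colouring {T S : Type*} (σ : T → T) (hσ : ∀ p, σ (σ p) = p)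
    (hne : ∀ p, σ p ≠ p) (g : T → S) :
    ∃ o : T → Prop, (∀ p, o (σ p) ↔ ¬ o p) ∧
      ∀ p p', g p = g p' → p ≠ p' → ∃ q q', g q = g p ∧ g q' = g p ∧ o q ∧ ¬ o q' := by
  classical
  rcases isEmpty_or_nonempty T with hT | ⟨⟨t₀⟩⟩
  · exact ⟨fun _ => True, fun p => isEmptyElim p, fun p => isEmptyElim p⟩
  have hpick : ∀ s, ∃ ab : T × T, (∃ p, g p = s) → g ab.1 = s ∧ g ab.2 = s ∧
      ((∃ p p', g p = s ∧ g p' = s ∧ p ≠ p') → ab.1 ≠ ab.2) := by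
    intro s
    by_cases h : ∃ p p', g p = s ∧ g p' = s ∧ p ≠ p'
    · obtain ⟨p, p', hp, hp', hpp⟩ := h
      exact ⟨(p, p'), fun _ => ⟨hp, hp', fun _ => hpp⟩⟩
    · by_cases h' : ∃ p, g p = s
      · obtain ⟨p, hp⟩ := h'
        exact ⟨(p, p), fun _ => ⟨hp, hp, fun h2 => absurd h2 h⟩⟩
      · exact ⟨(t₀, t₀), fun h2 => absurd h2 h'⟩
  choose ab hab using hpick
  let κ : T → T := fun p => Equiv.swap (ab (g p)).1 (ab (g p)).2 p
  have hκg : ∀ p, g (κ p) = g p := by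
    intro p
    have h := hab (g p) ⟨p, rfl⟩
    simp only [κ, Equiv.swap_apply_def]
    split_ifs
    · exact h.2.1
    · exact h.1
    · rfl
  have hκκ : ∀ p, κ (κ p) = p := by
    intro p
    change Equiv.swap (ab (g (κ p))).1 (ab (g (κ p))).2 (κ p) = p
    rw [hκg]
    exact Equiv.swap_apply_self _ _ _
  let I : T × Bool → T × Bool := fun p => (σ p.1, p.2)
  -- The second matching pairs two chosen elements in each large fibre. Doubling `T` gives every
  -- element fixed by κ a partner, namely its other copy.
  let K : T × Bool → T × Bool := fun p => if κ p.1 = p.1 then (p.1, !p.2) else (κ p.1, p.2)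
  have hII : ∀ p, I (I p) = p := fun p => by simp [I, hσ]
  have hKK : ∀ p, K (K p) = p := by
    rintro ⟨p, b⟩
    by_cases h : κ p = p
    · simp [K, h]
    · have h' : p ≠ κ p := fun h' => h h'.symm
      simp [K, h, hκκ, h']
  obtain ⟨o, h1, h2⟩ := exists_swap_colouring (Function.Involutive.toPerm I hII)
    (Function.Involutive.toPerm K hKK) (Equiv.ext hII) (Equiv.ext hKK)
    (fun p h => hne p.1 (congrArg Prod.fst h)) (by
      rintro ⟨p, b⟩ h
      change K (p, b) = (p, b) at h
      by_cases hp : κ p = p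
      · simp [K, hp] at h
      · simp [K, hp] at h)
  refine ⟨fun p => o (p, false), fun p => h1 (p, false), fun p p' hpp hne' => ?_⟩
  obtain ⟨e1, e2, e3⟩ := hab (g p) ⟨p, rfl⟩
  have e3 := e3 ⟨p, p', rfl, hpp.symm, hne'⟩
  have hk : κ (ab (g p)).1 = (ab (g p)).2 := by
    simp only [κ, e1]
    exact Equiv.swap_apply_left _ _
  have h3 := h2 ((ab (g p)).1, false)
  have h4 : K ((ab (g p)).1, false) = ((ab (g p)).2, false) := by
    simp only [K, hk, if_neg e3.symm]
  change o (K _) ↔ _ at h3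
  rw [h4] at h3
  by_cases hc : o ((ab (g p)).1, false)
  · exact ⟨_, _, e1, e2, hc, fun h => h3.mp h hc⟩
  · exact ⟨_, _, e2, e1, h3.mpr hc, hc⟩

/-! ### Graphs in which branch vertices are joined by short paths -/

/-- The neighbour structure of a graph whose branch vertices are independent and joined by
paths with one or two inner vertices. The type `T` consists of the inner vertices of the latter. -/
structure Skeleton {V : Type u} (G : SimpleGraph V) where
  T : Type u
  emb : T → V
  mate : T → T
  foot : T → V
  two : ∀ p, Two G (emb p) (foot p) (emb (mate p))
  mate_mate : ∀ p, mate (mate p) = p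
  big : ∀ p, Big G (foot p)
  foot_ne : ∀ p, foot p ≠ foot (mate p)
  emb_inj : Function.Injective emb
  cover : ∀ v, Big G v ∨ (∃ s t, Two G v s t ∧ Big G s ∧ Big G t) ∨ ∃ p, emb p = v
  indep : ∀ u v, Big G u → Big G v → ¬ G.Adj u v
  twin : ∀ m m' s t, Two G m s t → Two G m' s t → Big G s → Big G t → m = m'

namespace Skeleton

variable {V : Type*} {G : SimpleGraph V} (S : Skeleton G)

def core (s : V) : Prop := ∃ p p', S.foot p = s ∧ S.foot p' = s ∧ p ≠ p'

theorem mate_ne (p : S.T) : S.mate p ≠ p := fun h => by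
  have := S.foot_ne p
  rw [h] at this
  exact this rfl

-- A vertex with exactly one long path hangs on the other end if that end is core. If neither end is
-- core, the orientation decides which end hangs on the other. In every case the two ends are thus
-- core and core, or parent and leaf.
open Classical in
noncomputable def par (o : S.T → Prop) (s : V) : Option V :=
  if h : ∃ p, S.foot p = s ∧ (∀ p', S.foot p' = s → p' = p) ∧
      (S.core (S.foot (S.mate p)) ∨ ¬ o p) then
    some (S.foot (S.mate h.choose)) else none

theorem par_eq_some {o : S.T → Prop} {s u : V} : S.par o s = some u ↔
    ∃ p, S.foot p = s ∧ (∀ p', S.foot p' = s → p' = p) ∧ u = S.foot (S.mate p) ∧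
      (S.core u ∨ ¬ o p) := by
  classical
  constructor
  · intro h
    unfold par at h
    split_ifs at h with h1
    obtain ⟨h2, h3, h4⟩ := h1.choose_spec
    have h5 := Option.some.inj h
    rw [h5] at h4
    exact ⟨h1.choose, h2, h3, h5.symm, h4⟩
  · rintro ⟨p, h1, h2, rfl, h3⟩
    have h : ∃ p, S.foot p = s ∧ (∀ p', S.foot p' = s → p' = p) ∧
      (S.core (S.foot (S.mate p)) ∨ ¬ o p) := ⟨p, h1, h2, h3⟩
    unfold par
    rw [dif_pos h, h2 h.choose h.choose_spec.1]

theorem not_core_of_unique {s : V} {p : S.T} (h : ∀ p', S.foot p' = s → p' = p) :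
    ¬ S.core s := by
  rintro ⟨a, b, ha, hb, hab⟩
  exact hab ((h a ha).trans (h b hb).symm)

noncomputable def kinds (o : S.T → Prop) (ho : ∀ p, o (S.mate p) ↔ ¬ o p) : Kinds V where
  core := S.core
  par := S.par o
  par_par s u h := by
    obtain ⟨p, h1, h2, rfl, h3⟩ := S.par_eq_some.mp h
    by_contra hne
    obtain ⟨v, hv⟩ := Option.ne_none_iff_exists'.mp hne
    obtain ⟨q, h4, h5, -, h6⟩ := S.par_eq_some.mp hv
    obtain rfl := h5 _ rfl
    -- A parent is itself a leaf in neither case: a core parent has two long paths, and two ends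
    -- that are not core cannot both lose the orientation.
    rcases h3 with h3 | h3
    · exact S.not_core_of_unique h5 h3
    · rcases h6 with h6 | h6
      · have : v = s := by
          obtain ⟨q, h4', h5', h7, -⟩ := S.par_eq_some.mp hv
          rw [h7, ← h5' _ rfl, S.mate_mate, h1]
        rw [this] at h6
        exact S.not_core_of_unique h2 h6
      · rw [ho] at h6
        exact h6 h3
  not_core s u h := by
    obtain ⟨p, h1, h2, -⟩ := S.par_eq_some.mp h
    exact S.not_core_of_unique h2

variable [Fintype V] [DecidableEq V] {S} {o : S.T → Prop} {ho : ∀ p, o (S.mate p) ↔ ¬ o p}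

omit [Fintype V] [DecidableEq V] in
theorem par_of_core {s : V} (h : S.core s) : (S.kinds o ho).par s = none := by
  by_contra hne
  obtain ⟨u, hu⟩ := Option.ne_none_iff_exists'.mp hne
  exact (S.kinds o ho).not_core _ _ hu h

omit [Fintype V] [DecidableEq V] in
theorem unique_of_not_core {s : V} (h : ¬ S.core s) {p : S.T} (hp : S.foot p = s) (p' : S.T)
    (hp' : S.foot p' = s) : p' = p := by
  by_contra hne
  exact h ⟨p', p, hp', hp, hne⟩

omit [Fintype V] [DecidableEq V] in
theorem mate_root_or_leaf {p : S.T} (h : ¬ S.core (S.foot p)) :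
    (S.kinds o ho).par (S.foot p) = some (S.foot (S.mate p)) ∨
    ((S.kinds o ho).par (S.foot p) = none ∧
      (S.kinds o ho).par (S.foot (S.mate p)) = some (S.foot p) ∧
      ∀ r, (S.kinds o ho).par r = some (S.foot p) → r = S.foot (S.mate p)) := by
  have hu := fun p' hp' => unique_of_not_core h (p := p) rfl p' hp'
  by_cases h1 : S.core (S.foot (S.mate p)) ∨ ¬ o p
  · exact Or.inl (S.par_eq_some.mpr ⟨p, rfl, hu, rfl, h1⟩)
  · push Not at h1
    have h2 : (S.kinds o ho).par (S.foot (S.mate p)) = some (S.foot p) := by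
      refine S.par_eq_some.mpr ⟨S.mate p, rfl, fun p' hp' => unique_of_not_core h1.1 rfl p' hp',
        by rw [S.mate_mate], Or.inr ?_⟩
      rw [ho]; exact fun h => h h1.2
    refine Or.inr ⟨(S.kinds o ho).par_par _ _ h2, h2, fun r hr => ?_⟩
    obtain ⟨q, hq, -, hq', -⟩ := S.par_eq_some.mp hr
    have := hu _ hq'.symm
    rw [← hq, ← this, S.mate_mate]

/-- Two core vertices and a leaf with its parent both have joint probability 1/5; `par` is designed
so that no other pair bounds a long path. -/
theorem mean_mate (p : S.T) :
    mean ((S.kinds o ho).x (S.foot p) * (S.kinds o ho).x (S.foot (S.mate p))) = 1 / 5 := by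
  by_cases h : S.core (S.foot p)
  · by_cases h' : S.core (S.foot (S.mate p))
    · exact Kinds.mean_core_mul (S.foot_ne p) (par_of_core h) (par_of_core h') h h'
    · rw [mul_comm]
      refine Kinds.mean_leaf_mul (S.par_eq_some.mpr ⟨S.mate p, rfl,
        fun p' hp' => unique_of_not_core h' rfl p' hp', by rw [S.mate_mate], Or.inl h⟩)
  · rcases mate_root_or_leaf (o := o) (ho := ho) h with h1 | ⟨-, h1, -⟩
    · exact Kinds.mean_leaf_mul h1
    · rw [mul_comm]; exact Kinds.mean_leaf_mul h1

/-- The uniform law of the additional coins. -/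
noncomputable def coin (_ : Bool × Fin 6) : ℝ := 1 / 12

theorem isLaw_coin : IsLaw coin := ⟨fun _ => by norm_num [coin], by simp [coin]⟩

theorem pr_coin_and (P : Prop) (Q : Bool × Fin 6 → Prop) :
    pr coin (fun c => P ∧ Q c) = ind P * pr coin Q := by
  rw [pr, pr, Finset.mul_sum]
  exact Finset.sum_congr rfl fun c _ => by rw [ind_and]; ring

/-- The orientation of the paths with two inner vertices. -/
def toward (o : S.T → Prop) (p : S.T) (b : Bool) : Prop := o p ↔ b = true

omit [Fintype V] [DecidableEq V] in
theorem pr_toward (p : S.T) : pr coin (fun c => toward o p c.1) = 1 / 2 := by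
  rw [pr, Fintype.sum_prod_type]
  by_cases h : o p <;> simp [toward, h, coin, ind] <;> norm_num

/-- `F ω c m` means that m is added for the sake of s. The three alternatives name the neighbour
dominating s when it is off: on a long path, on a short path with both ends off, or a repair vertex.
The budget is half of the slack, since the other end of the short path may also call for m. Six coin
faces allow uniform choices among two or three neighbours. -/
theorem exists_repair (hbal : ∀ p p', S.foot p = S.foot p' → p ≠ p' →
      ∃ q q', S.foot q = S.foot p ∧ S.foot q' = S.foot p ∧ o q ∧ ¬ o q')
    {s : V} (hs : Big G s) :
    ∃ F : Coins V → Bool × Fin 6 → V → Prop,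
      (∀ ω c, ¬ (S.kinds o ho).On ω s →
        (∃ p, S.foot p = s ∧ ((S.kinds o ho).On ω (S.foot (S.mate p)) ∨ toward o p c.1)) ∨
        (∃ m t, Two G m s t ∧ Big G t ∧ ¬ (S.kinds o ho).On ω t) ∨
        ∃ m t, Two G m s t ∧ Big G t ∧ F ω c m) ∧
      ∀ m t, Two G m s t → Big G t → mean (fun ω => pr coin fun c => F ω c m) ≤
        1 / 2 * (1 / 5 - mean ((S.kinds o ho).x s * (S.kinds o ho).x t)) := by
  set K := S.kinds o ho with hK
  have htriv : ∀ m t, Two G m s t → Big G t →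
      mean (fun ω : Coins V => pr coin fun _ => False) ≤ 1 / 2 * (1 / 5 - mean (K.x s * K.x t)) := by
    intro m t hm _
    have h0 : mean (fun ω : Coins V => pr coin fun _ => False) = 0 := by
      simp [mean, pr, ind]
    have := Kinds.mean_pair_le (K := K) hm.1
    rw [h0]; linarith
  have hone : ∀ a t, Two G a s t → Big G t → ∀ b t', Two G b s t' → Big G t' → a ≠ b → t ≠ t' := by
    rintro a t ha ht b t' hb - hab rfl
    exact hab (S.twin a b s t ha hb hs ht)
  have hnbr : ∀ a, G.Adj s a → (∃ t, Two G a s t ∧ Big G t) ∨ ∃ p, S.emb p = a ∧ S.foot p = s := by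
    intro a ha
    rcases S.cover a with h | ⟨s', t, h, hs', ht⟩ | ⟨p, rfl⟩
    · exact absurd ha (S.indep s a hs h)
    · rcases (h.2 s).mp ha.symm with rfl | rfl
      · exact Or.inl ⟨t, h, ht⟩
      · exact Or.inl ⟨s', h.symm, hs'⟩
    · rcases ((S.two p).2 s).mp ha.symm with rfl | rfl
      · exact Or.inr ⟨p, rfl, rfl⟩
      · exact absurd hs (S.two (S.mate p)).not_big
  by_cases hcore : S.core s
  · refine ⟨fun _ _ _ => False, fun ω c _ => Or.inl ?_, htriv⟩
    obtain ⟨p, p', rfl, hp', hne⟩ := hcore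
    obtain ⟨q, q', hq, hq', h1, h2⟩ := hbal p p' hp'.symm hne
    by_cases hc : c.1 = true
    · exact ⟨q, hq, Or.inr (by simp [toward, h1, hc])⟩
    · exact ⟨q', hq', Or.inr (by simp [toward, h2, hc])⟩
  obtain ⟨a₁, a₂, a₃, h12, h13, h23, ha₁, ha₂, ha₃⟩ := id hs
  by_cases hp : ∃ p, S.foot p = s
  · obtain ⟨p, rfl⟩ := hp
    set s := S.foot p with hsdef
    set u := S.foot (S.mate p) with hu
    have huniq := fun p' hp' => unique_of_not_core hcore (p := p) rfl p' hp'
    -- If a short path runs parallel to the long one, no repair is needed: p is chosen when u is on,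
    -- and m when u is off.
    by_cases hmu : ∃ m, Two G m s u
    · obtain ⟨m, hm⟩ := hmu
      refine ⟨fun _ _ _ => False, fun ω c _ => ?_, htriv⟩
      by_cases hon : K.On ω u
      · exact Or.inl ⟨p, rfl, Or.inl hon⟩
      · exact Or.inr (Or.inl ⟨m, u, hm, S.big _, hon⟩)
    have hne : ∀ m t, Two G m s t → u ≠ t := by
      rintro m t hm rfl; exact hmu ⟨m, hm⟩
    have h' : ∀ a, G.Adj s a → a ≠ S.emb p → ∃ t, Two G a s t ∧ Big G t := by
      intro a ha hap
      refine (hnbr a ha).resolve_right ?_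
      rintro ⟨q, rfl, hq⟩
      exact hap (by rw [huniq q hq])
    obtain ⟨m₁, m₂, t₁, t₂, hm, hm₁, ht₁, hm₂, ht₂⟩ : ∃ m₁ m₂ t₁ t₂, m₁ ≠ m₂ ∧ Two G m₁ s t₁ ∧
        Big G t₁ ∧ Two G m₂ s t₂ ∧ Big G t₂ := by
      by_cases e1 : a₁ = S.emb p
      · obtain ⟨t, ht⟩ := h' a₂ ha₂ (e1 ▸ h12.symm)
        obtain ⟨t', ht'⟩ := h' a₃ ha₃ (e1 ▸ h13.symm)
        exact ⟨a₂, a₃, t, t', h23, ht.1, ht.2, ht'.1, ht'.2⟩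
      · obtain ⟨t, ht⟩ := h' a₁ ha₁ e1
        by_cases e2 : a₂ = S.emb p
        · obtain ⟨t', ht'⟩ := h' a₃ ha₃ (e2 ▸ h23.symm)
          exact ⟨a₁, a₃, t, t', h13, ht.1, ht.2, ht'.1, ht'.2⟩
        · obtain ⟨t', ht'⟩ := h' a₂ ha₂ e2
          exact ⟨a₁, a₂, t, t', h12, ht.1, ht.2, ht'.1, ht'.2⟩
    have htt := hone _ _ hm₁ ht₁ _ _ hm₂ ht₂ hm
    have hcost : ∀ t t', s ≠ t → s ≠ t' → u ≠ t → u ≠ t' → t ≠ t' →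
        1 / 2 * mean ((1 - K.x s) * ((1 - K.x u) * (K.x t * K.x t'))) ≤
          1 / 5 - mean (K.x s * K.x t) := by
      intro t t' e1 e2 e3 e4 e5
      rcases mate_root_or_leaf (o := o) (ho := ho) hcore with h1 | ⟨h1, h2, h3⟩
      · exact Kinds.cost_leaf h1 e1 e2 e3 e4 e5
      · exact Kinds.cost_root h1 hcore h2 h3 e1 e2 e3 e4 e5
    -- The bad states also need the long path to point away from s, which has probability 1/2, and
    -- the repair vertex is m₁ or m₂ with equal odds. Each is therefore added with a quarter of the
    -- probability of the state.
    refine ⟨fun ω c m => (¬ K.On ω s ∧ ¬ K.On ω u ∧ K.On ω t₁ ∧ K.On ω t₂) ∧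
      (¬ toward o p c.1 ∧ m = if c.2 < 3 then m₁ else m₂), fun ω c hoff => ?_, ?_⟩
    · by_cases h1 : K.On ω u ∨ toward o p c.1
      · exact Or.inl ⟨p, rfl, h1⟩
      push Not at h1
      by_cases h2 : K.On ω t₁
      · by_cases h3 : K.On ω t₂
        · by_cases hc : c.2 < 3
          · exact Or.inr (Or.inr ⟨m₁, t₁, hm₁, ht₁, ⟨hoff, h1.1, h2, h3⟩, h1.2, by rw [if_pos hc]⟩)
          · exact Or.inr (Or.inr ⟨m₂, t₂, hm₂, ht₂, ⟨hoff, h1.1, h2, h3⟩, h1.2, by rw [if_neg hc]⟩)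
        · exact Or.inr (Or.inl ⟨m₂, t₂, hm₂, ht₂, h3⟩)
      · exact Or.inr (Or.inl ⟨m₁, t₁, hm₁, ht₁, h2⟩)
    · intro m t hmt ht
      have e : (fun ω => pr coin fun c => (¬ K.On ω s ∧ ¬ K.On ω u ∧ K.On ω t₁ ∧ K.On ω t₂) ∧
          (¬ toward o p c.1 ∧ m = if c.2 < 3 then m₁ else m₂)) =
          fun ω => ((1 - K.x s) * ((1 - K.x u) * (K.x t₁ * K.x t₂))) ω *
            pr coin fun c => ¬ toward o p c.1 ∧ m = if c.2 < 3 then m₁ else m₂ := by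
        funext ω
        rw [pr_coin_and, ind_and, ind_and, ind_and, ind_not, ind_not]
        rfl
      have hsel : ∀ m', m' = m₁ ∨ m' = m₂ →
          (pr coin fun c => ¬ toward o p c.1 ∧ m' = if c.2 < 3 then m₁ else m₂) = 1 / 4 := by
        intro m' hm'
        rw [pr, Fintype.sum_prod_type]
        rcases hm' with rfl | rfl <;> by_cases h : o p <;>
          simp [toward, h, coin, ind, Fin.sum_univ_six, hm, hm.symm, Fin.lt_def] <;> norm_num
      rw [e]
      have hmean : ∀ (f : Coins V → ℝ) (r : ℝ), mean (fun ω => f ω * r) = mean f * r := by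
        intro f r; simp only [mean, ← Finset.sum_mul]; ring
      rw [hmean]
      by_cases e1 : m = m₁
      · obtain rfl : t = t₁ := by
          subst e1
          rcases (hm₁.2 t).mp hmt.adj_right with h | h
          · exact absurd h.symm hmt.1
          · exact h
        rw [hsel m (Or.inl e1)]
        have := hcost t t₂ hmt.1 hm₂.1 (hne _ _ hmt) (hne _ _ hm₂) htt
        linarith
      by_cases e2 : m = m₂
      · obtain rfl : t = t₂ := by
          subst e2
          rcases (hm₂.2 t).mp hmt.adj_right with h | h
          · exact absurd h.symm hmt.1
          · exact h
        rw [hsel m (Or.inr e2)]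
        have := hcost t t₁ hmt.1 hm₁.1 (hne _ _ hmt) (hne _ _ hm₁) htt.symm
        rw [mul_comm (K.x t) (K.x t₁)] at this
        linarith
      · have h0 : (pr coin fun c => ¬ toward o p c.1 ∧ m = if c.2 < 3 then m₁ else m₂) = 0 := by
          refine pr_eq_zero fun c hc => ?_
          have := hc.2
          split_ifs at this
          · exact e1 this
          · exact e2 this
        have := Kinds.mean_pair_le (K := K) hmt.1
        rw [h0]; linarith
  · push Not at hp
    have h' : ∀ a, G.Adj s a → ∃ t, Two G a s t ∧ Big G t := fun a ha =>
      (hnbr a ha).resolve_right fun ⟨q, _, hq⟩ => hp q hq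
    obtain ⟨t₁, hm₁, ht₁⟩ := h' a₁ ha₁
    obtain ⟨t₂, hm₂, ht₂⟩ := h' a₂ ha₂
    obtain ⟨t₃, hm₃, ht₃⟩ := h' a₃ ha₃
    have e12 := hone _ _ hm₁ ht₁ _ _ hm₂ ht₂ h12
    have e13 := hone _ _ hm₁ ht₁ _ _ hm₃ ht₃ h13
    have e23 := hone _ _ hm₂ ht₂ _ _ hm₃ ht₃ h23
    have hpar : K.par s = none := by
      by_contra hne
      obtain ⟨v, hv⟩ := Option.ne_none_iff_exists'.mp hne
      obtain ⟨q, hq, -⟩ := S.par_eq_some.mp hv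
      exact hp q hq
    have hchild : ∀ a, K.par a ≠ some s := by
      intro a ha
      obtain ⟨q, -, -, hq, -⟩ := S.par_eq_some.mp ha
      exact hp _ hq.symm
    -- No long path ends at s, so s is at risk only if all three opposite ends are on. One of the
    -- three neighbours is then added at random.
    refine ⟨fun ω c m => (¬ K.On ω s ∧ K.On ω t₁ ∧ K.On ω t₂ ∧ K.On ω t₃) ∧
      m = if c.2 < 2 then a₁ else if c.2 < 4 then a₂ else a₃, fun ω c hoff => Or.inr ?_, ?_⟩
    · by_cases h1 : K.On ω t₁
      · by_cases h2 : K.On ω t₂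
        · by_cases h3 : K.On ω t₃
          · right
            by_cases hc : c.2 < 2
            · exact ⟨a₁, t₁, hm₁, ht₁, ⟨hoff, h1, h2, h3⟩, by rw [if_pos hc]⟩
            · by_cases hc' : c.2 < 4
              · exact ⟨a₂, t₂, hm₂, ht₂, ⟨hoff, h1, h2, h3⟩, by rw [if_neg hc, if_pos hc']⟩
              · exact ⟨a₃, t₃, hm₃, ht₃, ⟨hoff, h1, h2, h3⟩, by rw [if_neg hc, if_neg hc']⟩
          · exact Or.inl ⟨a₃, t₃, hm₃, ht₃, h3⟩
        · exact Or.inl ⟨a₂, t₂, hm₂, ht₂, h2⟩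
      · exact Or.inl ⟨a₁, t₁, hm₁, ht₁, h1⟩
    · intro m t hmt ht
      have e : (fun ω => pr coin fun c => (¬ K.On ω s ∧ K.On ω t₁ ∧ K.On ω t₂ ∧ K.On ω t₃) ∧
          m = if c.2 < 2 then a₁ else if c.2 < 4 then a₂ else a₃) =
          fun ω => ((1 - K.x s) * (K.x t₁ * K.x t₂ * K.x t₃)) ω *
            pr coin fun c => m = if c.2 < 2 then a₁ else if c.2 < 4 then a₂ else a₃ := by
        funext ω
        rw [pr_coin_and, ind_and, ind_and, ind_and, ind_not]
        simp only [Pi.mul_apply, Pi.sub_apply, Pi.one_apply, Kinds.x, mul_assoc]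
      have hsel : ∀ m', m' = a₁ ∨ m' = a₂ ∨ m' = a₃ →
          (pr coin fun c => m' = if c.2 < 2 then a₁ else if c.2 < 4 then a₂ else a₃) = 1 / 3 := by
        intro m' hm'
        rw [pr, Fintype.sum_prod_type]
        rcases hm' with rfl | rfl | rfl <;>
          simp [coin, ind, Fin.sum_univ_six, h12, h13, h23, h12.symm, h13.symm, h23.symm,
            Fin.lt_def] <;> norm_num
      rw [e]
      have hmean : ∀ (f : Coins V → ℝ) (r : ℝ), mean (fun ω => f ω * r) = mean f * r := by
        intro f r; simp only [mean, ← Finset.sum_mul]; ring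
      rw [hmean]
      have hother : ∀ a t', Two G a s t' → m = a → t = t' := by
        rintro a t' ha rfl
        rcases (ha.2 t).mp hmt.adj_right with h | h
        · exact absurd h.symm hmt.1
        · exact h
      by_cases e1 : m = a₁
      · obtain rfl := hother _ _ hm₁ e1
        rw [hsel m (Or.inl e1)]
        have := Kinds.cost_free hpar hcore hchild hmt.1 hm₂.1 hm₃.1 e12 e13 e23
        linarith
      by_cases e2 : m = a₂
      · obtain rfl := hother _ _ hm₂ e2
        rw [hsel m (Or.inr (Or.inl e2))]
        have := Kinds.cost_free hpar hcore hchild hmt.1 hm₁.1 hm₃.1 e12.symm e23 e13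
        rw [mul_comm (K.x t) (K.x t₁)] at this
        linarith
      by_cases e3 : m = a₃
      · obtain rfl := hother _ _ hm₃ e3
        rw [hsel m (Or.inr (Or.inr e3))]
        have := Kinds.cost_free hpar hcore hchild hmt.1 hm₁.1 hm₂.1 e13.symm e23.symm e12
        have e4 : K.x t * K.x t₁ * K.x t₂ = K.x t₁ * K.x t₂ * K.x t := by ring
        rw [e4] at this
        linarith
      · have h0 : (pr coin fun c => m = if c.2 < 2 then a₁ else if c.2 < 4 then a₂ else a₃) = 0 := by
          refine pr_eq_zero fun c hc => ?_
          split_ifs at hc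
          · exact e1 hc
          · exact e2 hc
          · exact e3 hc
        have := Kinds.mean_pair_le (K := K) hmt.1
        rw [h0]; linarith

theorem colourable (S : Skeleton G) : Colourable G fun _ => 1 := by
  obtain ⟨o, ho, hbal⟩ := exists_balanced_colouring S.mate S.mate_mate S.mate_ne S.foot
  set K := S.kinds o ho with hK
  have hrep := fun s (hs : Big G s) => exists_repair (ho := ho) hbal hs
  choose! F hF hcost using hrep
  set w : Coins V → ℝ := fun _ => 1 / Fintype.card (Coins V) with hw
  have hwlaw : IsLaw w := by
    constructor
    · intro _; exact div_nonneg zero_le_one card_coins_pos.le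
    · simp only [hw, Finset.sum_const, Finset.card_univ, nsmul_eq_mul]
      exact mul_one_div_cancel card_coins_pos.ne'
  have hlaw := isLaw_kernel hwlaw (κ := fun _ => coin) fun _ => isLaw_coin
  have hpr : ∀ E : Coins V × (Bool × Fin 6) → Prop,
      pr (fun p : Coins V × (Bool × Fin 6) => w p.1 * coin p.2) E =
        mean fun ω => pr coin fun c => E (ω, c) := by
    intro E
    rw [pr_kernel w fun _ => coin, mean, Finset.sum_div]
    exact Finset.sum_congr rfl fun ω _ => by rw [hw]; ring
  -- The three clauses treat branch vertices, inner vertices of long paths, and inner vertices of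
  -- short paths together with the repairs requested by either end.
  let D : Coins V × (Bool × Fin 6) → Set V := fun i => {v |
    (Big G v ∧ K.On i.1 v) ∨
    (∃ p, S.emb p = v ∧ ¬ K.On i.1 (S.foot p) ∧
      (K.On i.1 (S.foot (S.mate p)) ∨ toward o p i.2.1)) ∨
    ∃ s t, Two G v s t ∧ Big G s ∧ Big G t ∧
      ((¬ K.On i.1 s ∧ ¬ K.On i.1 t) ∨ F s i.1 i.2 v ∨ F t i.1 i.2 v)}
  refine colourable_of_law hlaw D (fun v => (pr_eq_one hlaw fun i _ => ?_).ge) fun v => ?_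
  · rcases S.cover v with hv | ⟨s, t, hv, hs, ht⟩ | ⟨p, rfl⟩
    · by_cases hon : K.On i.1 v
      · exact ⟨v, Or.inl ⟨hv, hon⟩, Or.inl rfl⟩
      rcases hF v hv i.1 i.2 hon with ⟨p, rfl, hp⟩ | ⟨m, t, hm, ht, hoff⟩ | ⟨m, t, hm, ht, hf⟩
      · exact ⟨S.emb p, Or.inr (Or.inl ⟨p, rfl, hon, hp⟩), Or.inr (S.two p).adj_left.symm⟩
      · exact ⟨m, Or.inr (Or.inr ⟨v, t, hm, hv, ht, Or.inl ⟨hon, hoff⟩⟩), Or.inr hm.adj_left.symm⟩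
      · exact ⟨m, Or.inr (Or.inr ⟨v, t, hm, hv, ht, Or.inr (Or.inl hf)⟩),
          Or.inr hm.adj_left.symm⟩
    · by_cases h1 : K.On i.1 s
      · exact ⟨s, Or.inl ⟨hs, h1⟩, Or.inr hv.adj_left⟩
      by_cases h2 : K.On i.1 t
      · exact ⟨t, Or.inl ⟨ht, h2⟩, Or.inr hv.adj_right⟩
      · exact ⟨v, Or.inr (Or.inr ⟨s, t, hv, hs, ht, Or.inl ⟨h1, h2⟩⟩), Or.inl rfl⟩
    · by_cases h1 : K.On i.1 (S.foot p)
      · exact ⟨_, Or.inl ⟨S.big p, h1⟩, Or.inr (S.two p).adj_left⟩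
      by_cases h2 : K.On i.1 (S.foot (S.mate p)) ∨ toward o p i.2.1
      · exact ⟨_, Or.inr (Or.inl ⟨p, rfl, h1, h2⟩), Or.inl rfl⟩
      push Not at h2
      refine ⟨_, Or.inr (Or.inl ⟨S.mate p, rfl, h2.1, Or.inr ?_⟩), Or.inr (S.two p).adj_right⟩
      have h3 := h2.2
      simp only [toward, ho] at h3 ⊢
      tauto
  · rw [hpr]
    rcases S.cover v with hv | ⟨s, t, hv, hs, ht⟩ | ⟨p, rfl⟩
    · have e : ∀ i, v ∈ D i ↔ K.On i.1 v := by
        intro i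
        constructor
        · rintro (h | ⟨p, rfl, -⟩ | ⟨s, t, h, -⟩)
          · exact h.2
          · exact absurd hv (S.two p).not_big
          · exact absurd hv h.not_big
        · exact fun h => Or.inl ⟨hv, h⟩
      simp only [e]
      refine le_of_eq ?_
      rw [← Kinds.mean_x (K := K) v]
      congr 1
      funext ω
      have := isLaw_coin.sum_eq
      rw [pr, ← Finset.sum_mul, this, one_mul]
      rfl
    · have e : ∀ i, v ∈ D i → ((¬ K.On i.1 s ∧ ¬ K.On i.1 t) ∨ F s i.1 i.2 v) ∨ F t i.1 i.2 v := by
        rintro i (h | ⟨p, rfl, -⟩ | ⟨s', t', h, -, -, h'⟩)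
        · exact absurd h.1 hv.not_big
        · exfalso
          rcases (hv.2 _).mp (S.two p).adj_right with h | h
          · exact (S.two (S.mate p)).not_big (h ▸ hs)
          · exact (S.two (S.mate p)).not_big (h ▸ ht)
        · have hst : (s' = s ∧ t' = t) ∨ (s' = t ∧ t' = s) := by
            have h1 := (hv.2 s').mp h.adj_left
            have h2 := (hv.2 t').mp h.adj_right
            have h3 := h.1
            grind
          rcases hst with ⟨rfl, rfl⟩ | ⟨rfl, rfl⟩ <;> tauto
      -- Both ends off has probability 1/5 + P(s, t on), and the two repairs cost at most (1/5 -
      -- P(s, t on))/2 each: 2/5 in total.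
      have h1 : ∀ ω, (pr coin fun c => v ∈ D (ω, c)) ≤
          ((1 - K.x s) * (1 - K.x t)) ω + pr coin (fun c => F s ω c v) +
            pr coin fun c => F t ω c v := by
        intro ω
        refine (pr_mono isLaw_coin fun c _ => e (ω, c)).trans ((pr_or_le isLaw_coin _ _).trans ?_)
        refine add_le_add_left ((pr_or_le isLaw_coin _ _).trans (add_le_add_left ?_ _)) _
        refine le_of_eq ?_
        have := isLaw_coin.sum_eq
        rw [pr]
        dsimp only
        rw [← Finset.sum_mul, this, one_mul, ind_and, ind_not, ind_not]
        rfl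
      refine (mean_mono h1).trans ?_
      have h2 : mean (fun ω => ((1 - K.x s) * (1 - K.x t)) ω + pr coin (fun c => F s ω c v) +
            pr coin fun c => F t ω c v) = mean ((1 - K.x s) * (1 - K.x t)) +
            mean (fun ω => pr coin (fun c => F s ω c v)) +
            mean (fun ω => pr coin fun c => F t ω c v) := by
        rw [← mean_add, ← mean_add]; rfl
      have h3 := hcost s hs v t hv ht
      have h4 := hcost t ht v s hv.symm hs
      have h5 := Kinds.mean_off_off (K := K) s t
      rw [mul_comm ((S.kinds o ho).x t)] at h4
      change _ ≤ 1 / 2 * (1 / 5 - mean (K.x s * K.x t)) at h3 h4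
      rw [h2]
      linarith
    · have e : ∀ i, S.emb p ∈ D i ↔ ¬ K.On i.1 (S.foot p) ∧
          (K.On i.1 (S.foot (S.mate p)) ∨ toward o p i.2.1) := by
        intro i
        constructor
        · rintro (h | ⟨q, hq, h⟩ | ⟨s, t, h, hs, ht, -⟩)
          · exact absurd h.1 (S.two p).not_big
          · rwa [← S.emb_inj hq]
          · exfalso
            rcases (h.2 _).mp (S.two p).adj_right with h | h
            · exact (S.two (S.mate p)).not_big (h ▸ hs)
            · exact (S.two (S.mate p)).not_big (h ▸ ht)
        · exact fun h => Or.inr (Or.inl ⟨p, rfl, h⟩)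
      simp only [e]
      set s := S.foot p
      set u := S.foot (S.mate p) with hu
      -- With P(s, u on) = 1/5 the right side averages to 1/5 + 1/2 · 2/5 = 2/5.
      have h1 : ∀ ω, (pr coin fun c => ¬ K.On ω s ∧ (K.On ω u ∨ toward o p c.1)) ≤
          ((1 - K.x s) * K.x u) ω + (1 / 2) * ((1 - K.x s) * (1 - K.x u)) ω := by
        intro ω
        rw [pr_coin_and, ind_not]
        simp only [Pi.mul_apply, Pi.sub_apply, Pi.one_apply, Kinds.x]
        have h2 := pr_toward (o := o) p
        have h3 := isLaw_coin.sum_eq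
        by_cases hon : K.On ω u
        · have : (pr coin fun c => K.On ω u ∨ toward o p c.1) ≤ 1 := pr_le_one isLaw_coin _
          rw [ind_true hon]
          have h4 := ind_le_one (K.On ω s)
          nlinarith
        · rw [ind_false hon]
          simp only [hon, false_or, h2]
          linarith
      refine (mean_mono h1).trans ?_
      have h2 : mean (fun ω => ((1 - K.x s) * K.x u) ω + (1 / 2) * ((1 - K.x s) * (1 - K.x u)) ω) =
          mean ((1 - K.x s) * K.x u) + 1 / 2 * mean ((1 - K.x s) * (1 - K.x u)) := by
        simp only [mean, Finset.sum_add_distrib, ← Finset.mul_sum]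
        ring
      have h3 := Kinds.mean_off_mul (K := K) (K.x u) s
      have h5 := Kinds.mean_off_off (K := K) s u
      have h6 := mean_mate (o := o) (ho := ho) p
      rw [mul_comm (K.x u) (K.x s)] at h3
      change mean (K.x s * K.x u) = _ at h6
      rw [Kinds.mean_x] at h3
      rw [h2]
      linarith

end Skeleton

/-! ### Explicit finite graphs -/

/-- The bijection `φ` identifies the edges of `G` with the pairs in the list `E`. -/
def Matches {V : Type*} (G : SimpleGraph V) {n : ℕ} (E : List (Fin n × Fin n)) : Prop :=
  ∃ φ : Fin n ≃ V, ∀ i j, G.Adj (φ i) (φ j) ↔ (i, j) ∈ E ∨ (j, i) ∈ E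

theorem matches_of_iso {V W : Type*} {G : SimpleGraph V} {M : SimpleGraph W} {n : ℕ}
    {E : List (Fin n × Fin n)} (e : G ≃g M) (ψ : Fin n ≃ W)
    (h : ∀ i j, M.Adj (ψ i) (ψ j) ↔ (i, j) ∈ E ∨ (j, i) ∈ E) : Matches G E :=
  ⟨ψ.trans e.toEquiv.symm, fun i j => by
    rw [← h i j, ← e.map_rel_iff]
    exact iff_of_eq (congrArg₂ M.Adj (e.apply_symm_apply _) (e.apply_symm_apply _))⟩

theorem Matches.iso {V W : Type*} {G : SimpleGraph V} {M : SimpleGraph W} {n : ℕ}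
    {E : List (Fin n × Fin n)} (hG : Matches G E) (ψ : Fin n ≃ W)
    (h : ∀ i j, M.Adj (ψ i) (ψ j) ↔ (i, j) ∈ E ∨ (j, i) ∈ E) : Nonempty (G ≃g M) := by
  obtain ⟨φ, hφ⟩ := hG
  refine ⟨⟨φ.symm.trans ψ, ?_⟩⟩
  intro a b
  obtain ⟨i, rfl⟩ := φ.surjective a
  obtain ⟨j, rfl⟩ := φ.surjective b
  simp [h, hφ]

def edgesC4 : List (Fin 4 × Fin 4) := [(0, 1), (1, 2), (2, 3), (3, 0)]

def edgesK23 : List (Fin 5 × Fin 5) := [(0, 2), (0, 3), (0, 4), (1, 2), (1, 3), (1, 4)]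

def edgesBT : List (Fin 7 × Fin 7) :=
  [(0, 1), (1, 2), (2, 3), (3, 0), (0, 4), (4, 5), (5, 6), (6, 0)]

def edgesC7 : List (Fin 7 × Fin 7) :=
  [(0, 1), (1, 2), (2, 3), (3, 4), (4, 5), (5, 6), (6, 0)]

/-- The 7-cycle with the chords from `k` to `k + 3` for `k ∈ S`. -/
def edgesHam (S : List (Fin 7)) : List (Fin 7 × Fin 7) :=
  edgesC7 ++ S.map fun k => (k, k + 3)

/-- The chord sets of the five exceptional graphs with a Hamiltonian 7-cycle, each chord recorded by
the k for which it joins k to k + 3 modulo 7. -/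
def hamTypes : List (List (Fin 7)) := [[], [2], [0, 4], [5, 6], [5, 6, 2]]

theorem twoFourCycles_adj (i j : Fin 7) :
    twoFourCycles.Adj i j ↔ (i, j) ∈ edgesBT ∨ (j, i) ∈ edgesBT := by
  simp only [twoFourCycles, SimpleGraph.fromEdgeSet_adj, Set.mem_insert_iff,
    Set.mem_singleton_iff, Sym2.eq_iff]
  revert i j
  decide

theorem sevenCycleWith_adj {S : List (Fin 7)} {c : Set (Sym2 (Fin 7))}
    (h : ∀ i j : Fin 7, s(i, j) ∈ c ∧ i ≠ j ↔ (i ∈ S ∧ j = i + 3) ∨ (j ∈ S ∧ i = j + 3))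
    (i j : Fin 7) :
    (sevenCycleWith c).Adj i j ↔ (i, j) ∈ edgesHam S ∨ (j, i) ∈ edgesHam S := by
  have h7 : ∀ i j : Fin 7, (SimpleGraph.cycleGraph 7).Adj i j ↔
      (i, j) ∈ edgesC7 ∨ (j, i) ∈ edgesC7 := by
    simp only [SimpleGraph.cycleGraph_adj]
    decide
  have h8 : ∀ i j : Fin 7, (i, j) ∈ S.map (fun k => (k, k + 3)) ↔ i ∈ S ∧ j = i + 3 := by
    intro i j
    simp only [List.mem_map, Prod.mk.injEq]
    constructor
    · rintro ⟨k, hk, rfl, rfl⟩; exact ⟨hk, rfl⟩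
    · rintro ⟨hk, rfl⟩; exact ⟨i, hk, rfl, rfl⟩
  simp only [sevenCycleWith, SimpleGraph.sup_adj, SimpleGraph.fromEdgeSet_adj, h7, h, edgesHam,
    List.mem_append, h8]
  tauto

def Exc {V : Type*} (G : SimpleGraph V) : Prop :=
  Matches G edgesC4 ∨ Matches G edgesK23 ∨ Matches G edgesBT ∨
    ∃ S ∈ hamTypes, Matches G (edgesHam S)

theorem isExceptional_iff {V : Type*} {G : SimpleGraph V} : G.IsExceptional ↔ Exc G := by
  have key : ∀ {n : ℕ} {W : Type} {M : SimpleGraph W} {E : List (Fin n × Fin n)}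
      (ψ : Fin n ≃ W) (_ : ∀ i j, M.Adj (ψ i) (ψ j) ↔ (i, j) ∈ E ∨ (j, i) ∈ E),
      Nonempty (G ≃g M) ↔ Matches G E :=
    fun ψ h => ⟨fun ⟨e⟩ => matches_of_iso e ψ h, fun hG => hG.iso ψ h⟩
  have hham : (∃ S ∈ hamTypes, Matches G (edgesHam S)) ↔
      Matches G (edgesHam []) ∨ Matches G (edgesHam [2]) ∨ Matches G (edgesHam [0, 4]) ∨
      Matches G (edgesHam [5, 6]) ∨ Matches G (edgesHam [5, 6, 2]) := by
    simp [hamTypes]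
  unfold SimpleGraph.IsExceptional Exc
  rw [hham, key (Equiv.refl (Fin 4)) (E := edgesC4), key (finSumFinEquiv (m := 2) (n := 3)).symm (E := edgesK23),
    key (Equiv.refl (Fin 7)) (E := edgesHam []), key (Equiv.refl (Fin 7)) (E := edgesBT),
    key (Equiv.refl (Fin 7)) (E := edgesHam [2]), key (Equiv.refl (Fin 7)) (E := edgesHam [0, 4]),
    key (Equiv.refl (Fin 7)) (E := edgesHam [5, 6]),
    key (Equiv.refl (Fin 7)) (E := edgesHam [5, 6, 2])]
  · tauto
  · refine sevenCycleWith_adj ?_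
    simp only [Set.mem_insert_iff, Set.mem_singleton_iff, Sym2.eq_iff]
    decide
  · refine sevenCycleWith_adj ?_
    simp only [Set.mem_insert_iff, Set.mem_singleton_iff, Sym2.eq_iff]
    decide
  · refine sevenCycleWith_adj ?_
    simp only [Set.mem_insert_iff, Set.mem_singleton_iff, Sym2.eq_iff]
    decide
  · refine sevenCycleWith_adj ?_
    simp only [Set.mem_singleton_iff, Sym2.eq_iff]
    decide
  · exact twoFourCycles_adj
  · simp only [SimpleGraph.cycleGraph_adj]
    decide
  · simp only [completeBipartiteGraph]
    decide
  · simp only [SimpleGraph.cycleGraph_adj]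
    decide

/-! ### Certificates -/

def certDom {n : ℕ} (E : List (Fin n × Fin n)) (D : ℕ) (v : Fin n) : Bool :=
  D.testBit v || E.any fun e => (e.1 == v && D.testBit e.2) || (e.2 == v && D.testBit e.1)

/-- In the list `L` of bit masks of vertex sets, every vertex belongs to at most two fifths of
the sets, and `v` is dominated by at least `c v` fifths of them. -/
def IsCert {n : ℕ} (E : List (Fin n × Fin n)) (L : List ℕ) (c : Fin n → ℕ) : Prop :=
  0 < L.length ∧ ∀ v, c v * L.length ≤ 5 * L.countP (certDom E · v) ∧
    5 * L.countP (·.testBit v) ≤ 2 * L.length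

instance {n : ℕ} (E : List (Fin n × Fin n)) (L : List ℕ) (c : Fin n → ℕ) :
    Decidable (IsCert E L c) := inferInstanceAs (Decidable (_ ∧ _))

def Spans {V : Type*} (G : SimpleGraph V) {n : ℕ} (f : Fin n → V) (E : List (Fin n × Fin n)) :
    Prop := ∀ e ∈ E, G.Adj (f e.1) (f e.2)

theorem sum_get_countP {α : Type*} (L : List α) (p : α → Bool) :
    ∑ i : Fin L.length, ind (p (L.get i) = true) = L.countP p := by
  induction L with
  | nil => simp
  | cons a l ih =>
    simp only [List.length_cons]
    rw [Fin.sum_univ_succ, List.countP_cons]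
    simp only [List.get_eq_getElem] at ih
    simp only [List.get_eq_getElem, Fin.val_zero, List.getElem_cons_zero, Fin.val_succ,
      List.getElem_cons_succ, ih]
    by_cases h : p a <;> simp [h, ind]
    ring

theorem pr_uniform {α : Type*} (L : List α) (p : α → Bool) :
    pr (fun _ : Fin L.length => (1 : ℝ) / L.length) (fun i => p (L.get i) = true) =
      L.countP p / L.length := by
  rw [pr, ← Finset.mul_sum, sum_get_countP]
  ring

theorem Spans.colourable {V : Type*} [Fintype V] {G : SimpleGraph V} {n : ℕ} {f : Fin n → V}
    {E : List (Fin n × Fin n)} (hE : Spans G f E) (hf : Function.Injective f)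
    (hs : ∀ x, ∃ i, f i = x) {L : List ℕ} {c : Fin n → ℕ} (h : IsCert E L c)
    {d : V → ℝ} (hd : ∀ i, d (f i) ≤ c i / 5) : Colourable G d := by
  obtain ⟨h0, h⟩ := h
  have h0' : (0 : ℝ) < L.length := by exact_mod_cast h0
  have hw : IsLaw fun _ : Fin L.length => (1 : ℝ) / L.length :=
    ⟨fun _ => by positivity, by simp [h0'.ne']⟩
  refine colourable_of_law hw (fun i => f '' {v | (L.get i).testBit v = true}) ?_ ?_
  · intro x
    obtain ⟨v, rfl⟩ := hs x
    have h1 : (c v : ℝ) * L.length ≤ 5 * (L.countP (certDom E · v) : ℕ) := by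
      exact_mod_cast (h v).1
    have h2 : (c v : ℝ) / 5 ≤ (L.countP (certDom E · v) : ℕ) / L.length := by
      rw [div_le_div_iff₀ (by norm_num) h0']
      linarith
    refine ((hd v).trans h2).trans ?_
    rw [← pr_uniform]
    refine pr_mono hw fun i _ hi => ?_
    simp only [certDom, Bool.or_eq_true, List.any_eq_true, Bool.and_eq_true, beq_iff_eq] at hi
    rcases hi with hi | ⟨e, he, ⟨rfl, hi⟩ | ⟨rfl, hi⟩⟩
    · exact ⟨f v, ⟨v, hi, rfl⟩, Or.inl rfl⟩
    · exact ⟨f e.2, ⟨e.2, hi, rfl⟩, Or.inr (hE e he)⟩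
    · exact ⟨f e.1, ⟨e.1, hi, rfl⟩, Or.inr (hE e he).symm⟩
  · intro x
    obtain ⟨v, rfl⟩ := hs x
    have h1 : (5 : ℝ) * (L.countP (·.testBit v) : ℕ) ≤ 2 * L.length := by
      exact_mod_cast (h v).2
    have h2 : ((L.countP (·.testBit v) : ℕ) : ℝ) / L.length ≤ 2 / 5 := by
      rw [div_le_div_iff₀ h0' (by norm_num)]
      linarith
    refine le_trans ?_ h2
    rw [← pr_uniform]
    refine pr_mono hw fun i _ hi => ?_
    obtain ⟨y, hy, e⟩ := hi
    rw [hf e] at hy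
    exact hy

theorem Spans.colourable_one {V : Type*} [Fintype V] {G : SimpleGraph V} {n : ℕ} {f : Fin n → V}
    {E : List (Fin n × Fin n)} (hE : Spans G f E) (hf : Function.Injective f)
    (hs : ∀ x, ∃ i, f i = x) {L : List ℕ} (h : IsCert E L fun _ => 5) :
    Colourable G fun _ => 1 :=
  hE.colourable hf hs h fun _ => by norm_num

theorem Spans.weak {V : Type*} [Fintype V] {G : SimpleGraph V} {n : ℕ} {f : Fin n → V}
    {E : List (Fin n × Fin n)} (hE : Spans G f E) (hf : Function.Injective f)
    (hs : ∀ x, ∃ i, f i = x) {k : ℕ} {L : Fin n → List ℕ}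
    (h : ∀ i, IsCert E (L i) fun j => if j = i then k else 5) (v : V) :
    Weak G v (1 - k / 5) := by
  classical
  obtain ⟨i, rfl⟩ := hs v
  refine hE.colourable hf hs (h i) fun j => ?_
  by_cases hj : j = i
  · simp [hj]
  · simpa [hj, hf.eq_iff] using demand_le_one G (f j)

section spans

variable {V : Type*} {G H : SimpleGraph V} {n : ℕ} {f : Fin n → V} {E : List (Fin n × Fin n)}

theorem Spans.mono (h : Spans H f E) (hGH : H ≤ G) : Spans G f E := fun e he => hGH (h e he)

theorem Spans.cons (h : Spans G f E) {i j : Fin n} (hij : G.Adj (f i) (f j)) :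
    Spans G f ((i, j) :: E) := by
  intro e he
  rcases List.mem_cons.mp he with rfl | he
  · exact hij
  · exact h e he

theorem Spans.comp {m : ℕ} {E' : List (Fin m × Fin m)} (h : Spans G f E) (g : Fin m → Fin n)
    (hg : ∀ e ∈ E', (g e.1, g e.2) ∈ E ∨ (g e.2, g e.1) ∈ E) : Spans G (f ∘ g) E' :=
  fun e he => (hg e he).elim (fun h1 => h _ h1) fun h1 => (h _ h1).symm

theorem spans_of_adj {φ : Fin n ≃ V} (h : ∀ i j, G.Adj (φ i) (φ j) ↔ (i, j) ∈ E ∨ (j, i) ∈ E) :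
    Spans G φ E := fun e he => (h e.1 e.2).mpr (Or.inl he)

theorem spans_hamilton {S : List (Fin 7)} {f : Fin 7 → V} (h : Spans G f (edgesHam S)) :
    Spans G f edgesC7 := fun e he => h e (List.mem_append_left _ he)

end spans

/-- Steps of length 2 turn the residues modulo 7 into a 7-cycle. Its independent sets fall into five
classes under rotation. -/
theorem chord_pattern : ∀ t0 t1 t2 t3 t4 t5 t6 : Bool,
    (∀ k : Fin 7, ¬ (![t0, t1, t2, t3, t4, t5, t6] k = true ∧
      ![t0, t1, t2, t3, t4, t5, t6] (k + 2) = true)) →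
    ∃ S ∈ hamTypes, ∃ k : Fin 7, ∀ i : Fin 7,
      ![t0, t1, t2, t3, t4, t5, t6] (i + k) = decide (i ∈ S) := by
  decide +kernel

set_option synthInstance.maxHeartbeats 400000 in
set_option synthInstance.maxSize 4000 in
theorem edgesHam_differences : ∀ S ∈ hamTypes, ∀ i : Fin 7,
    (i, i) ∉ edgesHam S ∧ (i, i + 1) ∈ edgesHam S ∧
    ((i, i + 2) ∉ edgesHam S ∧ (i + 2, i) ∉ edgesHam S) ∧
    ((i, i + 3) ∈ edgesHam S ∨ (i + 3, i) ∈ edgesHam S ↔ i ∈ S) := by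
  decide +kernel

/-- A graph with a Hamiltonian 7-cycle is colourable or exceptional. -/
theorem colourable_or_matches_of_hamilton {V : Type*} [Fintype V] {G : SimpleGraph V}
    {f : Fin 7 → V} (hE : Spans G f edgesC7) (hf : Function.Injective f)
    (hs : ∀ x, ∃ i, f i = x) :
    Colourable G (fun _ => 1) ∨ ∃ S ∈ hamTypes, Matches G (edgesHam S) := by
  classical
  by_contra! hcon
  obtain ⟨hG, hM⟩ := hcon
  have hrot : ∀ k : Fin 7, Spans G (f ∘ (· + k)) edgesC7 := fun k =>
    hE.comp (· + k) (by revert k; decide)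
  have hinj : ∀ k : Fin 7, Function.Injective (f ∘ (· + k)) := fun k =>
    hf.comp (add_left_injective k)
  have hsur : ∀ k : Fin 7, ∀ x, ∃ i, (f ∘ (· + k)) i = x := fun k x => by
    obtain ⟨i, rfl⟩ := hs x
    exact ⟨i - k, by simp⟩
  -- A chord between vertices at distance two, or two chords from k to k + 3 and from k + 2 to k +
  -- 5, already make the graph colourable. The surviving chords form one of the patterns above.
  have h2 : ∀ k, ¬ G.Adj (f k) (f (2 + k)) := fun k hk =>
    hG (((hrot k).cons (i := 0) (j := 2) (by simpa using hk)).colourable_one (hinj k) (hsur k)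
      (L := [17, 17, 36, 36, 74]) (by decide))
  have h3 : ∀ k, ¬ (G.Adj (f k) (f (3 + k)) ∧ G.Adj (f (2 + k)) (f (5 + k))) := fun k hk =>
    hG ((((hrot k).cons (i := 0) (j := 3) (by simpa using hk.1)).cons (i := 2) (j := 5)
      hk.2).colourable_one (hinj k) (hsur k) (L := [21, 33, 50, 74, 76]) (by decide))
  let t : Fin 7 → Bool := fun k => decide (G.Adj (f k) (f (k + 3)))
  have ht : ![t 0, t 1, t 2, t 3, t 4, t 5, t 6] = t := by
    funext k; fin_cases k <;> rfl
  obtain ⟨S, hS, k, hk⟩ := chord_pattern (t 0) (t 1) (t 2) (t 3) (t 4) (t 5) (t 6) (by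
    rw [ht]
    intro k hk
    simp only [t, decide_eq_true_eq] at hk
    refine h3 k ⟨by rw [add_comm]; exact hk.1, ?_⟩
    have h5 : ∀ k : Fin 7, 5 + k = k + 2 + 3 := by decide
    rw [h5, add_comm 2 k]
    exact hk.2)
  rw [ht] at hk
  refine hM S hS ⟨Equiv.ofBijective _ (show Function.Bijective (f ∘ (· + k)) from
    ⟨hinj k, hsur k⟩), ?_⟩
  have hT : ∀ i, G.Adj (f (i + k)) (f (i + 3 + k)) ↔ i ∈ S := fun i => by
    have := hk i
    rw [Bool.eq_iff_iff, decide_eq_true_eq, decide_eq_true_eq] at this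
    rw [← this, add_right_comm]
  have hcyc : ∀ i, G.Adj (f (i + k)) (f (i + 1 + k)) := fun i => by
    have h0 := hrot k (i, i + 1) (by revert i; decide)
    exact h0
  have key : ∀ i d : Fin 7, d ≤ 3 → (G.Adj (f (i + k)) (f (i + d + k)) ↔
      (i, i + d) ∈ edgesHam S ∨ (i + d, i) ∈ edgesHam S) := by
    intro i d hd
    obtain ⟨c0, c1, c2, c3⟩ := edgesHam_differences S hS i
    have hd' : d = 0 ∨ d = 1 ∨ d = 2 ∨ d = 3 := by revert d; decide
    rcases hd' with rfl | rfl | rfl | rfl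
    · simp [c0]
    · simp [c1, hcyc i]
    · have h0 := h2 (i + k)
      rw [add_left_comm, ← add_assoc] at h0
      simp [c2, h0]
    · rw [hT, c3]
  intro i j
  simp only [Equiv.ofBijective_apply, Function.comp]
  have hij : (∃ d : Fin 7, d ≤ 3 ∧ j = i + d) ∨ ∃ d : Fin 7, d ≤ 3 ∧ i = j + d := by
    revert i j; decide
  rcases hij with ⟨d, hd, rfl⟩ | ⟨d, hd, rfl⟩
  · exact key i d hd
  · rw [G.adj_comm, or_comm]
    exact key j d hd

def hamOrders : List (Fin 7 → Fin 7) :=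
  [![0, 3, 2, 1, 4, 5, 6], ![0, 3, 2, 1, 6, 5, 4], ![0, 1, 2, 3, 4, 5, 6], ![0, 1, 2, 3, 6, 5, 4]]

-- An extra edge either gives a certificate or creates a Hamiltonian 7-cycle, and the latter case is
-- covered by the analysis of the 7-cycle.
set_option synthInstance.maxHeartbeats 400000 in
set_option synthInstance.maxSize 4000 in
theorem two_squares_add_edge : ∀ i j : Fin 7, i ≠ j → (i, j) ∉ edgesBT → (j, i) ∉ edgesBT →
    (∃ L ∈ [[17, 36, 42, 65, 84], [3, 9, 36, 42, 84], [21, 40, 40, 67, 82],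
      [3, 3, 40, 40, 84], [17, 17, 42, 42, 68], [5, 25, 33, 42, 42, 42, 67, 84, 84, 84],
      [20, 20, 42, 42, 65], [9, 9, 34, 34, 84], [20, 20, 41, 42, 67]],
      IsCert ((i, j) :: edgesBT) L fun _ => 5) ∨
    ∃ g ∈ hamOrders, (∀ a b : Fin 7, g a = g b → a = b) ∧ (∀ b : Fin 7, ∃ a, g a = b) ∧
      ∀ e ∈ edgesC7,
        (g e.1, g e.2) ∈ (i, j) :: edgesBT ∨ (g e.2, g e.1) ∈ (i, j) :: edgesBT := by
  decide +kernel

/-! ### Weak laws and spanning supergraphs of exceptional graphs -/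

section exceptional

variable {V : Type*} [Fintype V] {G H : SimpleGraph V}

theorem Matches.weak {n : ℕ} {E : List (Fin n × Fin n)} (h : Matches G E) {k : ℕ}
    {L : Fin n → List ℕ} (hL : ∀ i, IsCert E (L i) fun j => if j = i then k else 5) (v : V) :
    Weak G v (1 - k / 5) := by
  obtain ⟨φ, hφ⟩ := h
  exact (spans_of_adj hφ).weak φ.injective φ.surjective hL v

theorem weak_of_matches_C4 (h : Matches G edgesC4) (v : V) : Weak G v (2 / 5) := by
  have := h.weak (k := 3) (L := ![[3, 4, 4, 9, 10], [3, 5, 6, 8, 8], [1, 1, 6, 10, 12],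
    [2, 2, 5, 9, 12]]) (by decide) v
  norm_num at this
  exact this

/-- The square is set apart because its certificates miss the special vertex with probability 2/5.
That is too much for attaching a pendant square and harmless in the other reductions. -/
theorem Exc.matches_C4_or_weak (h : Exc G) :
    Matches G edgesC4 ∨ ∀ v, Weak G v (1 / 5) := by
  rcases h with h | h | h | ⟨S, -, φ, hφ⟩
  · exact Or.inl h
  · refine Or.inr fun v => ?_
    have := h.weak (k := 4) (L := ![[2, 6, 9, 17, 28], [1, 6, 10, 17, 28], [6, 6, 9, 17, 24],
      [6, 9, 10, 17, 20], [6, 10, 12, 17, 17]]) (by decide) v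
    norm_num at this
    exact this
  · refine Or.inr fun v => ?_
    have := h.weak (k := 4) (L := ![[25, 36, 42, 67, 84], [25, 38, 40, 67, 84],
      [25, 38, 42, 65, 84], [25, 34, 44, 67, 84], [25, 42, 52, 67, 68], [9, 35, 42, 84, 84],
      [20, 42, 52, 67, 73]]) (by decide +kernel) v
    norm_num at this
    exact this
  · refine Or.inr fun v => ?_
    have := (spans_hamilton (spans_of_adj hφ)).weak φ.injective φ.surjective (k := 4)
      (L := ![[21, 36, 50, 73, 74], [21, 38, 50, 72, 73], [17, 38, 50, 73, 76],
      [21, 34, 50, 73, 76], [25, 38, 50, 68, 73], [9, 37, 50, 76, 82], [18, 37, 50, 73, 76]])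
      (by decide +kernel) v
    norm_num at this
    exact this

theorem Weak.mono_eps {v : V} {ε δ : ℝ} (h : Weak G v ε) (hε : ε ≤ δ) : Weak G v δ :=
  h.mono hε le_rfl fun _ _ hu => hu

theorem Exc.weak (h : Exc G) (v : V) : Weak G v (2 / 5) := by
  rcases h.matches_C4_or_weak with h | h
  · exact weak_of_matches_C4 h v
  · exact (h v).mono_eps (by norm_num)

omit [Fintype V] in
theorem Spans.colourable_or {n : ℕ} {f : Fin n → V} {E : List (Fin n × Fin n)} (h : Spans G f E)
    (hf : Function.Injective f) (hs : ∀ x, ∃ i, f i = x) {P : Prop}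
    (hP : ∀ i j, i ≠ j → (i, j) ∉ E → (j, i) ∉ E → Spans G f ((i, j) :: E) → P) :
    P ∨ Matches G E := by
  by_cases hM : ∃ i j, G.Adj (f i) (f j) ∧ (i, j) ∉ E ∧ (j, i) ∉ E
  · obtain ⟨i, j, hij, h1, h2⟩ := hM
    exact Or.inl (hP i j (fun e => hij.ne (congrArg f e)) h1 h2 (h.cons hij))
  push Not at hM
  refine Or.inr ⟨Equiv.ofBijective f (show Function.Bijective f from ⟨hf, hs⟩), fun i j => ?_⟩
  simp only [Equiv.ofBijective_apply]
  constructor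
  · intro hij
    by_contra hcon
    rw [not_or] at hcon
    exact hcon.2 (hM i j hij hcon.1)
  · rintro (hij | hij)
    · exact h _ hij
    · exact (h _ hij).symm

theorem Spans.colourable_or_of_cert {n : ℕ} {f : Fin n → V} {E : List (Fin n × Fin n)}
    (h : Spans G f E) (hf : Function.Injective f) (hs : ∀ x, ∃ i, f i = x)
    {T : List (List ℕ)}
    (hT : ∀ i j, i ≠ j → (i, j) ∉ E → (j, i) ∉ E → ∃ L ∈ T, IsCert ((i, j) :: E) L fun _ => 5) :
    Colourable G (fun _ => 1) ∨ Matches G E :=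
  h.colourable_or hf hs fun i j h1 h2 h3 h4 => by
    obtain ⟨L, -, hL⟩ := hT i j h1 h2 h3
    exact h4.colourable_one hf hs hL

theorem colourable_or_exc_of_C7 {f : Fin 7 → V} (h : Spans G f edgesC7)
    (hf : Function.Injective f) (hs : ∀ x, ∃ i, f i = x) :
    Colourable G (fun _ => 1) ∨ Exc G :=
  (colourable_or_matches_of_hamilton h hf hs).imp_right fun h => Or.inr (Or.inr (Or.inr h))

theorem colourable_or_exc_of_C4 {f : Fin 4 → V} (h : Spans G f edgesC4)
    (hf : Function.Injective f) (hs : ∀ x, ∃ i, f i = x) :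
    Colourable G (fun _ => 1) ∨ Exc G :=
  (h.colourable_or_of_cert hf hs (T := [[1, 1, 4, 4, 10], [2, 2, 5, 5, 8]])
    (by decide)).imp_right Or.inl

theorem colourable_or_exc_of_K23 {f : Fin 5 → V} (h : Spans G f edgesK23)
    (hf : Function.Injective f) (hs : ∀ x, ∃ i, f i = x) :
    Colourable G (fun _ => 1) ∨ Exc G :=
  (h.colourable_or_of_cert hf hs
    (T := [[1, 1, 2, 2, 28], [3, 9, 10, 20, 20], [6, 10, 12, 17, 17]]) (by decide)).imp_right
    fun h => Or.inr (Or.inl h)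

theorem colourable_or_exc_of_BT {f : Fin 7 → V} (h : Spans G f edgesBT)
    (hf : Function.Injective f) (hs : ∀ x, ∃ i, f i = x) :
    Colourable G (fun _ => 1) ∨ Exc G := by
  refine (h.colourable_or hf hs (P := Colourable G (fun _ => 1) ∨ Exc G) ?_).elim id
    fun h => Or.inr (Or.inr (Or.inr (Or.inl h)))
  intro i j hij h1 h2 hsp
  rcases two_squares_add_edge i j hij h1 h2 with ⟨L, -, hL⟩ | ⟨g, -, hg1, hg2, hg3⟩
  · exact Or.inl (hsp.colourable_one hf hs hL)
  · refine colourable_or_exc_of_C7 (hsp.comp g hg3) (hf.comp fun a b => hg1 a b) fun x => ?_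
    obtain ⟨b, rfl⟩ := hs x
    obtain ⟨a, rfl⟩ := hg2 b
    exact ⟨a, rfl⟩

/-- Adding edges to an exceptional graph gives a colourable or again an exceptional graph. So in
reductions it is enough to find an exceptional spanning subgraph. -/
theorem Exc.mono (h : Exc H) (hHG : H ≤ G) : Colourable G (fun _ => 1) ∨ Exc G := by
  rcases h with ⟨φ, hφ⟩ | ⟨φ, hφ⟩ | ⟨φ, hφ⟩ | ⟨S, -, φ, hφ⟩
  · exact colourable_or_exc_of_C4 ((spans_of_adj hφ).mono hHG) φ.injective φ.surjective
  · exact colourable_or_exc_of_K23 ((spans_of_adj hφ).mono hHG) φ.injective φ.surjective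
  · exact colourable_or_exc_of_BT ((spans_of_adj hφ).mono hHG) φ.injective φ.surjective
  · exact colourable_or_exc_of_C7 ((spans_hamilton (spans_of_adj hφ)).mono hHG) φ.injective
      φ.surjective

end exceptional

/-! ### Smallest counterexamples -/

theorem connected_of_retraction {V V' : Type*} {G : SimpleGraph V} {G' : SimpleGraph V'}
    (hG : G.Connected) (r : V → V') (hr : Function.Surjective r)
    (h : ∀ x y, G.Adj x y → G'.Reachable (r x) (r y)) : G'.Connected := by
  have key : ∀ {x y} (_ : G.Walk x y), G'.Reachable (r x) (r y) := by
    intro x y p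
    induction p with
    | nil => exact SimpleGraph.Reachable.refl _
    | cons hadj _ ih => exact (h _ _ hadj).trans ih
  have : Nonempty V' := hG.nonempty.map r
  refine ⟨fun a b => ?_⟩
  obtain ⟨x, rfl⟩ := hr a
  obtain ⟨y, rfl⟩ := hr b
  obtain ⟨p⟩ := hG.preconnected x y
  exact key p

theorem connected_subtype {V : Type*} {G : SimpleGraph V} (hG : G.Connected) {P : V → Prop}
    {G' : SimpleGraph {x // P x}} (r : V → V) (hr : ∀ x, P (r x)) (hfix : ∀ x, P x → r x = x)
    (h : ∀ x y, G.Adj x y → r x = r y ∨ G'.Adj ⟨r x, hr x⟩ ⟨r y, hr y⟩) : G'.Connected := by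
  refine connected_of_retraction hG (fun x => ⟨r x, hr x⟩) (fun x => ⟨x, ?_⟩) fun x y hxy => ?_
  · exact Subtype.ext (hfix x x.2)
  · rcases h x y hxy with he | he
    · simp only [he]; exact SimpleGraph.Reachable.refl _
    · exact he.reachable

theorem IsLeaf.of_comap {V : Type*} {G : SimpleGraph V} {P : V → Prop} {x : {x // P x}}
    (h : IsLeaf (G.comap Subtype.val) x) (hx : ∀ w, G.Adj x w → P w) : IsLeaf G x := by
  obtain ⟨y, hy⟩ := h
  refine ⟨y, fun w => ⟨fun hw => ?_, ?_⟩⟩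
  · exact congrArg Subtype.val ((hy ⟨w, hx w hw⟩).mp hw)
  · rintro rfl
    exact (hy y).mpr rfl

/-- Minimality is twofold: `smaller` concerns the number of vertices, `subgraph` the deletion of
edges on the same vertex set. -/
structure Counterexample {V : Type u} [Fintype V] (G : SimpleGraph V) : Prop where
  conn : G.Connected
  two_le : 2 ≤ Fintype.card V
  not_good : ¬ Good G
  not_exc : ¬ Exc G
  smaller : ∀ (V' : Type u) [Fintype V'] (G' : SimpleGraph V'),
    Fintype.card V' < Fintype.card V → G'.Connected → 2 ≤ Fintype.card V' → Good G' ∨ Exc G'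
  subgraph : ∀ G' < G, G'.Connected → Good G' ∨ Exc G'

namespace Counterexample

variable {V : Type u} [Fintype V] {G : SimpleGraph V}

theorem not_colourable (h : Counterexample G) : ¬ Colourable G fun _ => 1 :=
  fun hc => h.not_good (good_of_colourable_one hc)

theorem false_of_or (h : Counterexample G) (hc : Colourable G (fun _ => 1) ∨ Exc G) : False :=
  hc.elim h.not_colourable h.not_exc

theorem good_or_exc (h : Counterexample G) {P : V → Prop} [Fintype {x // P x}] {G' : SimpleGraph {x // P x}}
    (hG' : G'.Connected) {x y z : V} (hx : ¬ P x) (hy : P y) (hz : P z) (hyz : y ≠ z) :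
    Good G' ∨ Exc G' :=
  h.smaller _ G' (Fintype.card_subtype_lt hx) hG' (Fintype.one_lt_card_iff.mpr
    ⟨⟨y, hy⟩, ⟨z, hz⟩, fun e => hyz (congrArg Subtype.val e)⟩)

theorem weak_of_good_or_exc {V : Type*} [Fintype V] {G : SimpleGraph V} (h : Good G ∨ Exc G)
    (v : V) : Weak G v (2 / 5) :=
  h.elim (fun h => h.weak v (by norm_num)) fun h => h.weak v

theorem not_isLeaf (h : Counterexample G) (u : V) : ¬ IsLeaf G u := by
  classical
  rintro ⟨v, hv⟩
  have huv : G.Adj u v := (hv v).mpr rfl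
  by_cases hw : ∃ w, w ≠ u ∧ w ≠ v
  · obtain ⟨w, hwu, hwv⟩ := hw
    have hconn : (G.comap (Subtype.val : {x // x ≠ u} → V)).Connected := by
      refine connected_subtype h.conn (fun x => if x = u then v else x) ?_ ?_ ?_
      · intro x
        split_ifs with hx
        · exact huv.ne'
        · exact hx
      · intro x hx
        rw [if_neg hx]
      · intro x y hxy
        simp only [SimpleGraph.comap_adj]
        split_ifs with hx hy hy
        · exact Or.inl rfl
        · subst hx; exact Or.inl ((hv y).mp hxy).symm
        · subst hy; exact Or.inl ((hv x).mp hxy.symm)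
        · exact Or.inr hxy
    have hg := h.good_or_exc hconn (x := u) (by simp) huv.ne' hwu hwv.symm
    refine h.not_good (good_of_leaf (u := u) (v := ⟨v, huv.ne'⟩) Subtype.val_injective
      (fun _ _ => Iff.rfl) (fun x => ?_) (fun y => y.2) hv (weak_of_good_or_exc hg _))
    by_cases hx : x = u
    · exact Or.inl hx
    · exact Or.inr ⟨⟨x, hx⟩, rfl⟩
  · push Not at hw
    have hvl : IsLeaf G v := ⟨u, fun w => ⟨fun h1 => by
      by_contra hne
      exact h1.ne (hw w hne).symm, by rintro rfl; exact huv.symm⟩⟩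
    -- The single edge: each end alone with probability 2/5 and the empty set with probability 1/5
    -- meet the demand 4/5.
    have hspan : Spans G ![u, v] [(0, 1)] := by
      simpa [Spans] using huv
    refine h.not_good (hspan.colourable ?_ ?_ (L := [1, 1, 2, 2, 0]) (c := fun _ => 4)
      (by decide) ?_)
    · intro i j
      fin_cases i <;> fin_cases j <;> simp [huv.ne, huv.ne']
    · intro x
      by_cases hx : x = u
      · exact ⟨0, hx.symm⟩
      · exact ⟨1, (hw x hx).symm⟩
    · intro i
      fin_cases i
      · simp [demand_of_leaf (⟨v, hv⟩ : IsLeaf G u)]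
      · simp [demand_of_leaf hvl]

theorem exists_two_adj (h : Counterexample G) (x : V) :
    ∃ y z, y ≠ z ∧ G.Adj x y ∧ G.Adj x z := by
  have : Nontrivial V := Fintype.one_lt_card_iff_nontrivial.mp h.two_le
  obtain ⟨a, ha⟩ := h.conn.preconnected.exists_adj_of_nontrivial x
  by_contra! hcon
  exact h.not_isLeaf x ⟨a, fun w => ⟨fun hw => by
    by_contra hne
    exact hcon w a hne hw ha, by rintro rfl; exact ha⟩⟩

theorem two_or_big (h : Counterexample G) (x : V) : (∃ y z, Two G x y z) ∨ Big G x := by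
  obtain ⟨y, -, -, hy, -⟩ := h.exists_two_adj x
  exact (leaf_or_two_or_big hy).resolve_left (h.not_isLeaf x)

/-- Deleting the edge leaves all degrees at least two. If the rest is connected, minimality and
`Exc.mono` apply. Otherwise the edge is a bridge, and both sides have weak laws that
`colourable_of_bridge` couples. -/
theorem not_adj_of_big (h : Counterexample G) {u v : V} (hu : Big G u) (hv : Big G v) :
    ¬ G.Adj u v := by
  classical
  intro huv
  set H := G.deleteEdges {s(u, v)} with hHdef
  have hH : ∀ x y, H.Adj x y ↔ G.Adj x y ∧ ¬ (x = u ∧ y = v) ∧ ¬ (x = v ∧ y = u) := by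
    intro x y
    simp [hHdef, SimpleGraph.deleteEdges_adj]
  have hle : H ≤ G := fun x y hxy => ((hH x y).mp hxy).1
  have hlt : H < G := lt_of_le_of_ne hle fun he => by
    have := (hH u v).mp (he ▸ huv)
    exact this.2.1 ⟨rfl, rfl⟩
  have htwo : ∀ x, ∃ y z, y ≠ z ∧ H.Adj x y ∧ H.Adj x z := by
    intro x
    by_cases hxu : x = u
    · obtain ⟨y, z, hyz, h1, h2, h3, h4⟩ := (hxu ▸ hu : Big G x).exists_ne v
      refine ⟨y, z, hyz, ?_, ?_⟩ <;> rw [hH] <;> subst hxu <;> simp_all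
    by_cases hxv : x = v
    · obtain ⟨y, z, hyz, h1, h2, h3, h4⟩ := (hxv ▸ hv : Big G x).exists_ne u
      exact ⟨y, z, hyz, by rw [hH]; simp_all, by rw [hH]; simp_all⟩
    · obtain ⟨y, z, hyz, h1, h2⟩ := h.exists_two_adj x
      exact ⟨y, z, hyz, by rw [hH]; simp_all, by rw [hH]; simp_all⟩
  have hnl : ∀ x, ¬ IsLeaf H x := fun x => by
    obtain ⟨y, z, hyz, h1, h2⟩ := htwo x
    exact not_isLeaf_of_adj hyz h1 h2
  by_cases hr : H.Reachable u v
  · have hconn : H.Connected := by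
      refine connected_of_retraction h.conn id Function.surjective_id fun x y hxy => ?_
      by_cases h1 : x = u ∧ y = v
      · rw [h1.1, h1.2]; exact hr
      by_cases h2 : x = v ∧ y = u
      · rw [h2.1, h2.2]; exact hr.symm
      · exact ((hH x y).mpr ⟨hxy, h1, h2⟩).reachable
    rcases h.subgraph H hlt hconn with hg | he
    · exact h.not_colourable ((hg.colourable_one hnl).mono (fun _ => le_rfl) hle)
    · exact h.false_of_or (he.mono hle)
  have hcover : ∀ {a b} (_ : G.Walk a b), H.Reachable u a ∨ H.Reachable v a →
      H.Reachable u b ∨ H.Reachable v b := by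
    intro a b p
    induction p with
    | nil => exact id
    | @cons x y _ hxy _ ih =>
      intro hx
      apply ih
      by_cases h1 : x = u ∧ y = v
      · rw [h1.2]; exact Or.inr (SimpleGraph.Reachable.refl _)
      by_cases h2 : x = v ∧ y = u
      · rw [h2.2]; exact Or.inl (SimpleGraph.Reachable.refl _)
      · have := ((hH x y).mpr ⟨hxy, h1, h2⟩).reachable
        exact hx.imp (fun h => h.trans this) fun h => h.trans this
  have hpart : ∀ (a b : V), ¬ H.Reachable a b →
      let G₁ : SimpleGraph {x // H.Reachable a x} := H.comap Subtype.val
      Weak G₁ ⟨a, SimpleGraph.Reachable.refl _⟩ (2 / 5) ∧ ∀ x, ¬ IsLeaf G₁ x := by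
    intro a b hab G₁
    have hstep : ∀ {x y} (p : H.Walk x y) (hx : H.Reachable a x),
        G₁.Reachable ⟨x, hx⟩ ⟨y, hx.trans p.reachable⟩ := by
      intro x y p
      induction p with
      | nil => exact fun _ => SimpleGraph.Reachable.refl _
      | @cons x y _ hxy _ ih =>
        intro hx
        have h1 : G₁.Adj ⟨x, hx⟩ ⟨y, hx.trans hxy.reachable⟩ := hxy
        exact h1.reachable.trans (ih _)
    have hconn : G₁.Connected := by
      have : Nonempty {x // H.Reachable a x} := ⟨⟨a, SimpleGraph.Reachable.refl _⟩⟩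
      have h0 : ∀ x, G₁.Reachable ⟨a, SimpleGraph.Reachable.refl _⟩ x := by
        rintro ⟨x, ⟨p⟩⟩
        exact hstep p (SimpleGraph.Reachable.refl _)
      exact ⟨fun x y => (h0 x).symm.trans (h0 y)⟩
    obtain ⟨y, z, hyz, hy, hz⟩ := htwo a
    refine ⟨weak_of_good_or_exc (h.good_or_exc hconn hab hy.reachable hz.reachable hyz) _, ?_⟩
    intro x hx
    exact hnl x (hx.of_comap fun w hw => x.2.trans hw.reachable)
  obtain ⟨hw₁, hl₁⟩ := hpart u v hr
  obtain ⟨hw₂, hl₂⟩ := hpart v u fun h => hr h.symm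
  refine h.not_colourable (colourable_of_bridge Subtype.val_injective Subtype.val_injective
    (fun x y hxy => hle hxy) (fun x y hxy => hle hxy) (fun x => ?_) (fun x y hxy => ?_) huv
    hw₁ hw₂ hl₁ hl₂)
  · obtain ⟨p⟩ := h.conn.preconnected u x
    exact (hcover p (Or.inl (SimpleGraph.Reachable.refl _))).imp (fun h => ⟨⟨x, h⟩, rfl⟩)
      fun h => ⟨⟨x, h⟩, rfl⟩
  · exact hr (x.2.trans (hxy ▸ y.2.symm))

end Counterexample

/-! ### Exclusion of pendant triangles, squares and pentagons -/

theorem Two.ne_left {V : Type*} {G : SimpleGraph V} {v a b : V} (h : Two G v a b) : v ≠ a :=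
  h.adj_left.ne

theorem Two.ne_right {V : Type*} {G : SimpleGraph V} {v a b : V} (h : Two G v a b) : v ≠ b :=
  h.adj_right.ne

theorem Two.eq_or {V : Type*} {G : SimpleGraph V} {v a b w : V} (h : Two G v a b)
    (hw : G.Adj v w) : w = a ∨ w = b := (h.2 w).mp hw

namespace Counterexample

variable {V : Type u} [Fintype V] {G : SimpleGraph V}

/-- If the vertices in `R` are attached to the others at `v` only, then `R` can be removed. -/
theorem remove_attached (h : Counterexample G) {R : V → Prop}
    [Fintype {x // ¬ R x}] {v a w : V} (hv : ¬ R v) (ha : R a)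
    (hR : ∀ x y, R x → G.Adj x y → R y ∨ y = v) (hw : ¬ R w) (hwv : w ≠ v) :
    (Good (G.comap (Subtype.val : {x // ¬ R x} → V)) ∨
      Exc (G.comap (Subtype.val : {x // ¬ R x} → V))) ∧
    ∀ x : {x // ¬ R x}, x ≠ ⟨v, hv⟩ → ¬ IsLeaf (G.comap (Subtype.val : {x // ¬ R x} → V)) x := by
  classical
  constructor
  · refine h.good_or_exc ?_ (x := a) (not_not.mpr ha) hv hw hwv.symm
    refine connected_subtype h.conn (fun x => if R x then v else x) ?_ ?_ ?_
    · intro x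
      split_ifs with hx
      · exact hv
      · exact hx
    · intro x hx
      rw [if_neg hx]
    · intro x y hxy
      simp only [SimpleGraph.comap_adj]
      split_ifs with hx hy hy
      · exact Or.inl rfl
      · exact Or.inl ((hR x y hx hxy).resolve_left hy).symm
      · exact Or.inl ((hR y x hy hxy.symm).resolve_left hx)
      · exact Or.inr hxy
  · intro x hx hl
    refine h.not_isLeaf x (hl.of_comap fun y hy hRy => ?_)
    rcases hR y x hRy hy.symm with h1 | h1
    · exact x.2 h1
    · exact hx (Subtype.ext h1)

theorem not_triangle_loop (h : Counterexample G) {v a b : V} (ha : Two G a v b)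
    (hb : Two G b v a) : False := by
  classical
  have hva := ha.ne_left
  have hvb := hb.ne_left
  have hab := ha.ne_right
  by_cases hw : ∃ w, ¬ (w = a ∨ w = b) ∧ w ≠ v
  · obtain ⟨w, hw, hwv⟩ := hw
    obtain ⟨hg, hl⟩ := h.remove_attached (R := fun x => x = a ∨ x = b) (v := v) (a := a)
      (by grind) (Or.inl rfl) (by
        rintro x y (rfl | rfl) hxy
        · have := ha.eq_or hxy; tauto
        · have := hb.eq_or hxy; tauto) hw hwv
    refine h.not_colourable (colourable_of_triangle_loop (a := a) (b := b)
      Subtype.val_injective (fun _ _ hxy => hxy)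
      (weak_of_good_or_exc hg _) hl hab (fun x => ?_) (fun y hy => y.2 (Or.inl hy))
      (fun y hy => y.2 (Or.inr hy)) ha.adj_left.symm ha.adj_right hb.adj_left)
    by_cases hx : x = a ∨ x = b
    · tauto
    · exact Or.inr (Or.inr ⟨⟨x, hx⟩, rfl⟩)
  · push Not at hw
    have hspan : Spans G ![v, a, b] [(0, 1), (1, 2), (2, 0)] := by
      simp [Spans, ha.adj_left.symm, ha.adj_right, hb.adj_left]
    refine h.not_colourable (hspan.colourable_one ?_ ?_ (L := [1, 1, 2, 2, 4]) (by decide))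
    · intro i j
      fin_cases i <;> fin_cases j <;> simp [hva, hvb, hab, hva.symm, hvb.symm, hab.symm]
    · intro x
      by_cases hx : x = a ∨ x = b
      · rcases hx with rfl | rfl
        · exact ⟨1, rfl⟩
        · exact ⟨2, rfl⟩
      · exact ⟨0, (hw x (by tauto)).symm⟩

/-- A weak law with parameter 1/5 is available unless the rest is itself a square. In that case two
squares share v and span the whole graph, which is then colourable or exceptional. -/
theorem not_square_loop (h : Counterexample G) {v a b c : V} (ha : Two G a v b)
    (hb : Two G b a c) (hc : Two G c b v) : False := by
  classical
  have hva := ha.ne_left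
  have hvb := ha.1
  have hvc := hc.ne_right
  have hab := ha.ne_right
  have hac := hb.1
  have hbc := hb.ne_right
  by_cases hw : ∃ w, ¬ (w = a ∨ w = b ∨ w = c) ∧ w ≠ v
  · obtain ⟨w, hw, hwv⟩ := hw
    have hv : ¬ (v = a ∨ v = b ∨ v = c) := by grind
    obtain ⟨hg, hl⟩ := h.remove_attached (R := fun x => x = a ∨ x = b ∨ x = c) (v := v) (a := a)
      hv (Or.inl rfl) (by
        rintro x y (rfl | rfl | rfl) hxy
        · have := ha.eq_or hxy; tauto
        · have := hb.eq_or hxy; tauto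
        · have := hc.eq_or hxy; tauto) hw hwv
    have hcov : ∀ x, x = a ∨ x = b ∨ x = c ∨ ∃ y : {x // ¬ (x = a ∨ x = b ∨ x = c)},
        y.1 = x := by
      intro x
      by_cases hx : x = a ∨ x = b ∨ x = c
      · tauto
      · exact Or.inr (Or.inr (Or.inr ⟨⟨x, hx⟩, rfl⟩))
    have hweak : Weak (G.comap (Subtype.val : {x // ¬ (x = a ∨ x = b ∨ x = c)} → V))
        ⟨v, hv⟩ (1 / 5) → False := fun hweak =>
      h.not_colourable (colourable_of_square_loop (a := a) (b := b) (c := c)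
        Subtype.val_injective (fun _ _ hxy => hxy) hweak hl hab hac hbc hcov
        (fun y hy => y.2 (Or.inl hy)) (fun y hy => y.2 (Or.inr (Or.inl hy)))
        (fun y hy => y.2 (Or.inr (Or.inr hy))) ha.adj_left.symm ha.adj_right hb.adj_right
        hc.adj_right)
    rcases hg with hg | he
    · exact hweak (hg.weak _ le_rfl)
    rcases he.matches_C4_or_weak with ⟨φ, hφ⟩ | he
    · obtain ⟨i, hi⟩ := φ.surjective ⟨v, hv⟩
      have hi' : (φ i).1 = v := congrArg Subtype.val hi
      have hcyc : ∀ j : Fin 4, G.Adj (φ j) (φ (j + 1)) := fun j =>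
        (hφ j (j + 1)).mpr (by revert j; decide)
      have hspan : Spans G ![(φ i).1, φ (i + 1), φ (i + 2), φ (i + 3), a, b, c] edgesBT := by
        have e0 := hcyc i
        have e1 := hcyc (i + 1)
        have e2 := hcyc (i + 2)
        have e3 := hcyc (i + 3)
        rw [add_assoc] at e1 e2 e3
        have e3' : G.Adj (φ (i + 3)) (φ i) := by simpa using e3
        simp only [Spans, edgesBT, List.forall_mem_cons]
        refine ⟨e0, e1, e2, e3', ?_, ?_, ?_, ?_, by simp⟩
        · show G.Adj (φ i) a
          rw [hi']; exact ha.adj_left.symm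
        · exact ha.adj_right
        · exact hb.adj_right
        · show G.Adj c (φ i)
          rw [hi']; exact hc.adj_right
      have hne : ∀ j, (φ j).1 ≠ a ∧ (φ j).1 ≠ b ∧ (φ j).1 ≠ c := fun j => by
        have := (φ j).2
        tauto
      refine h.false_of_or (colourable_or_exc_of_BT hspan ?_ ?_)
      · have hφi : ∀ j k, (φ (i + j)).1 = (φ (i + k)).1 ↔ j = k := fun j k => by
          rw [Subtype.val_inj, φ.apply_eq_iff_eq, add_left_cancel_iff]
        have hφ0 : ∀ k, (φ i).1 = (φ (i + k)).1 ↔ 0 = k := fun k => by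
          rw [← hφi 0 k, add_zero]
        have hφ1 : ∀ k, (φ (i + k)).1 = (φ i).1 ↔ k = 0 := fun k => by
          rw [← hφi k 0, add_zero]
        intro j k
        have hne' : ∀ j, a ≠ (φ j).1 ∧ b ≠ (φ j).1 ∧ c ≠ (φ j).1 := fun j =>
          ⟨(hne j).1.symm, (hne j).2.1.symm, (hne j).2.2.symm⟩
        fin_cases j <;> fin_cases k <;>
          simp [hφi, hφ0, hφ1, hne, hne', hab, hac, hbc, hab.symm, hac.symm, hbc.symm]
      · intro x
        rcases hcov x with rfl | rfl | rfl | ⟨y, rfl⟩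
        · exact ⟨4, rfl⟩
        · exact ⟨5, rfl⟩
        · exact ⟨6, rfl⟩
        · obtain ⟨j, rfl⟩ := φ.surjective y
          have hj : j = i ∨ j = i + 1 ∨ j = i + 2 ∨ j = i + 3 := by
            have : ∀ i j : Fin 4, j = i ∨ j = i + 1 ∨ j = i + 2 ∨ j = i + 3 := by decide
            exact this i j
          rcases hj with rfl | rfl | rfl | rfl
          · exact ⟨0, rfl⟩
          · exact ⟨1, rfl⟩
          · exact ⟨2, rfl⟩
          · exact ⟨3, rfl⟩
    · exact hweak (he _)
  · push Not at hw
    have hspan : Spans G ![v, a, b, c] edgesC4 := by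
      simp [Spans, edgesC4, ha.adj_left.symm, ha.adj_right, hb.adj_right, hc.adj_right]
    refine h.false_of_or (colourable_or_exc_of_C4 hspan ?_ ?_)
    · intro i j
      fin_cases i <;> fin_cases j <;> simp [hva, hvb, hvc, hab, hac, hbc, hva.symm, hvb.symm,
        hvc.symm, hab.symm, hac.symm, hbc.symm]
    · intro x
      by_cases hx : x = a ∨ x = b ∨ x = c
      · rcases hx with rfl | rfl | rfl
        · exact ⟨1, rfl⟩
        · exact ⟨2, rfl⟩
        · exact ⟨3, rfl⟩
      · exact ⟨0, (hw x (by tauto)).symm⟩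

theorem not_pentagon_loop (h : Counterexample G) {v a b c d : V} (ha : Two G a v b)
    (hb : Two G b a c) (hc : Two G c b d) (hd : Two G d c v) : False := by
  classical
  have hva := ha.ne_left
  have hvb := ha.1
  have hvc := hd.1
  have hvd := hd.ne_right
  have hab := ha.ne_right
  have hac := hb.1
  have hbc := hb.ne_right
  have hbd := hc.1
  have hcd := hc.ne_right
  have had : a ≠ d := by
    rintro rfl
    have := ha.eq_or hd.adj_left
    grind
  by_cases hw : ∃ w, ¬ (w = a ∨ w = b ∨ w = c ∨ w = d) ∧ w ≠ v
  · obtain ⟨w, hw, hwv⟩ := hw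
    obtain ⟨hg, hl⟩ := h.remove_attached (R := fun x => x = a ∨ x = b ∨ x = c ∨ x = d) (v := v)
      (a := a) (by grind) (Or.inl rfl) (by
        rintro x y (rfl | rfl | rfl | rfl) hxy
        · have := ha.eq_or hxy; tauto
        · have := hb.eq_or hxy; tauto
        · have := hc.eq_or hxy; tauto
        · have := hd.eq_or hxy; tauto) hw hwv
    refine h.not_colourable (colourable_of_pentagon_loop (a := a) (b := b) (c := c) (d := d)
      Subtype.val_injective (fun _ _ hxy => hxy)
      (weak_of_good_or_exc hg _) hl hab hac had hbc hbd hcd (fun x => ?_)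
      (fun y hy => y.2 (Or.inl hy)) (fun y hy => y.2 (Or.inr (Or.inl hy)))
      (fun y hy => y.2 (Or.inr (Or.inr (Or.inl hy))))
      (fun y hy => y.2 (Or.inr (Or.inr (Or.inr hy)))) ha.adj_left.symm ha.adj_right hb.adj_right
      hc.adj_right hd.adj_right)
    by_cases hx : x = a ∨ x = b ∨ x = c ∨ x = d
    · tauto
    · exact Or.inr (Or.inr (Or.inr (Or.inr ⟨⟨x, hx⟩, rfl⟩)))
  · push Not at hw
    have hspan : Spans G ![v, a, b, c, d] [(0, 1), (1, 2), (2, 3), (3, 4), (4, 0)] := by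
      simp [Spans, ha.adj_left.symm, ha.adj_right, hb.adj_right, hc.adj_right, hd.adj_right]
    refine h.not_colourable (hspan.colourable_one ?_ ?_ (L := [5, 9, 10, 18, 20]) (by decide))
    · intro i j
      fin_cases i <;> fin_cases j <;> simp [hva, hvb, hvc, hvd, hab, hac, had, hbc, hbd, hcd,
        hva.symm, hvb.symm, hvc.symm, hvd.symm, hab.symm, hac.symm, had.symm, hbc.symm, hbd.symm,
        hcd.symm]
    · intro x
      by_cases hx : x = a ∨ x = b ∨ x = c ∨ x = d
      · rcases hx with rfl | rfl | rfl | rfl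
        · exact ⟨1, rfl⟩
        · exact ⟨2, rfl⟩
        · exact ⟨3, rfl⟩
        · exact ⟨4, rfl⟩
      · exact ⟨0, (hw x (by tauto)).symm⟩

end Counterexample

/-! ### Replacing a path with three inner vertices by an edge -/

def AdjE {n : ℕ} (E : List (Fin n × Fin n)) (i j : Fin n) : Prop := (i, j) ∈ E ∨ (j, i) ∈ E

instance {n : ℕ} (E : List (Fin n × Fin n)) (i j : Fin n) : Decidable (AdjE E i j) :=
  inferInstanceAs (Decidable (_ ∨ _))

def TwoE {n : ℕ} (E : List (Fin n × Fin n)) (i j k : Fin n) : Prop :=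
  j ≠ k ∧ ∀ l, AdjE E i l ↔ l = j ∨ l = k

instance {n : ℕ} (E : List (Fin n × Fin n)) (i j k : Fin n) : Decidable (TwoE E i j k) :=
  inferInstanceAs (Decidable (_ ∧ _))

def BigE {n : ℕ} (E : List (Fin n × Fin n)) (i : Fin n) : Prop :=
  ∃ j k l, j ≠ k ∧ j ≠ l ∧ k ≠ l ∧ AdjE E i j ∧ AdjE E i k ∧ AdjE E i l

instance {n : ℕ} (E : List (Fin n × Fin n)) (i : Fin n) : Decidable (BigE E i) :=
  inferInstanceAs (Decidable (Exists _))

section lift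

variable {V : Type*} {G : SimpleGraph V} {n : ℕ} {E : List (Fin n × Fin n)} {φ : Fin n ≃ V}

theorem TwoE.two {i j k : Fin n} (h : TwoE E i j k)
    (hφ : ∀ i j, G.Adj (φ i) (φ j) ↔ (i, j) ∈ E ∨ (j, i) ∈ E) : Two G (φ i) (φ j) (φ k) := by
  refine ⟨fun e => h.1 (φ.injective e), fun w => ?_⟩
  obtain ⟨l, rfl⟩ := φ.surjective w
  rw [hφ, φ.apply_eq_iff_eq, φ.apply_eq_iff_eq]
  exact h.2 l

theorem BigE.big {i : Fin n} (h : BigE E i)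
    (hφ : ∀ i j, G.Adj (φ i) (φ j) ↔ (i, j) ∈ E ∨ (j, i) ∈ E) : Big G (φ i) := by
  obtain ⟨j, k, l, hjk, hjl, hkl, hj, hk, hl⟩ := h
  exact ⟨φ j, φ k, φ l, φ.injective.ne hjk, φ.injective.ne hjl, φ.injective.ne hkl,
    (hφ _ _).mpr hj, (hφ _ _).mpr hk, (hφ _ _).mpr hl⟩

end lift

/-- Replace the edge `ij` by a path with three inner vertices. -/
def subdivide {n : ℕ} (E : List (Fin n × Fin n)) (i j : Fin n) :
    List (Fin (n + 3) × Fin (n + 3)) :=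
  (E.filter fun e => e ≠ (i, j) ∧ e ≠ (j, i)).map
    (fun e => (Fin.castAdd 3 e.1, Fin.castAdd 3 e.2)) ++
  [(Fin.castAdd 3 i, Fin.natAdd n 0), (Fin.natAdd n 0, Fin.natAdd n 1),
    (Fin.natAdd n 1, Fin.natAdd n 2), (Fin.natAdd n 2, Fin.castAdd 3 j)]

theorem subdivide_C4 : ∀ i j, AdjE edgesC4 i j → ∃ g ∈ [![Fin.castAdd 3 i, 4, 5, 6,
    Fin.castAdd 3 j, Fin.castAdd 3 (2 * j - i), Fin.castAdd 3 (3 * j - 2 * i)]],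
    (∀ a b : Fin 7, g a = g b → a = b) ∧ (∀ b : Fin 7, ∃ a, g a = b) ∧
    ∀ e ∈ edgesC7, (g e.1, g e.2) ∈ subdivide edgesC4 i j ∨
      (g e.2, g e.1) ∈ subdivide edgesC4 i j := by
  decide +kernel

theorem subdivide_K23 : ∀ i j, AdjE edgesK23 i j → ∃ L ∈ [[60, 82, 98, 133, 137], [49, 74, 120, 133, 134], [37, 82, 116, 137, 138], [50, 92, 98,
    133, 137], [41, 70, 108, 145, 146], [60, 81, 97, 134, 138], [50, 73, 120, 133, 134], [38,
    81, 116, 137, 138], [49, 92, 97, 134, 138], [42, 69, 108, 145, 146]],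
    IsCert (subdivide edgesK23 i j) L fun _ => 5 := by
  decide +kernel

/-- Subdividing an edge of one square leaves the other square pendant. -/
theorem subdivide_BT : ∀ i j, AdjE edgesBT i j → ∃ k l m p, TwoE edgesBT l k m ∧
    TwoE edgesBT m l p ∧ TwoE edgesBT p m k ∧ (l ≠ i ∧ l ≠ j) ∧ (m ≠ i ∧ m ≠ j) ∧
    p ≠ i ∧ p ≠ j := by
  decide +kernel

set_option synthInstance.maxHeartbeats 400000 in
set_option synthInstance.maxSize 4000 in
theorem subdivide_hamilton : ∀ S ∈ hamTypes, ∀ i j, AdjE (edgesHam S) i j →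
    (∃ L ∈ [[202, 356, 420, 531, 537], [169, 340, 456, 531, 550], [228, 281, 456, 531, 550], [210,
      298, 401, 549, 588], [170, 338, 401, 549, 588], [166, 340, 418, 537, 585], [212, 294, 418,
      537, 585], [170, 356, 452, 531, 537], [228, 298, 452, 531, 537], [212, 338, 393, 550,
      553], [178, 293, 402, 585, 588], [165, 306, 402, 585, 588], [228, 330, 420, 531, 537],
      [178, 330, 401, 549, 588]],
      IsCert (subdivide (edgesHam S) i j) L fun _ => 5) ∨
    ∃ k l, BigE (edgesHam S) k ∧ BigE (edgesHam S) l ∧ AdjE (edgesHam S) k l ∧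
      ¬ (k = i ∧ l = j) ∧ ¬ (k = j ∧ l = i) := by
  decide +kernel

namespace Counterexample

variable {V : Type u} [Fintype V] {G : SimpleGraph V}

/-- The path is contracted to an edge between x and d. A colouring of the result extends by
`colourable_of_subdivision`. If the result is exceptional, the original graph has a Hamiltonian
7-cycle, a certificate, a pendant square or two adjacent branch vertices. -/
theorem not_path (h : Counterexample G) {x a b c d : V} (ha : Two G a x b)
    (hb : Two G b a c) (hc : Two G c b d) (hxd : x ≠ d) (hnadj : ¬ G.Adj x d) : False := by
  classical
  have hab := ha.ne_right
  have hac := hb.1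
  have hbc := hb.ne_right
  have hxc : x ≠ c := by
    rintro rfl
    exact h.not_triangle_loop ha hb.symm
  have hda : d ≠ a := by
    rintro rfl
    exact h.not_triangle_loop hb hc.symm
  have hx : ¬ (x = a ∨ x = b ∨ x = c) := by
    have := ha.ne_left; have := ha.1; grind
  have hd : ¬ (d = a ∨ d = b ∨ d = c) := by
    have := hc.ne_right; have := hc.1; grind
  set P : V → Prop := fun y => ¬ (y = a ∨ y = b ∨ y = c) with hP
  set x' : {y // P y} := ⟨x, hx⟩ with hx'
  set d' : {y // P y} := ⟨d, hd⟩ with hd'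
  have hxd' : x' ≠ d' := fun e => hxd (congrArg Subtype.val e)
  set G' : SimpleGraph {y // P y} := G.comap Subtype.val ⊔ SimpleGraph.edge x' d' with hGdef
  have hG' : ∀ y z, G'.Adj y z ↔ G.Adj y z ∨ (y = x' ∧ z = d') ∨ (y = d' ∧ z = x') := by
    intro y z
    rw [hGdef, SimpleGraph.sup_adj, SimpleGraph.comap_adj, SimpleGraph.edge_adj]
    grind
  have hna : ∀ y : {y // P y}, G.Adj y a → y = x' := fun y hy => by
    have := ha.eq_or hy.symm
    have := y.2
    exact Subtype.ext (by grind)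
  have hnb : ∀ y : {y // P y}, ¬ G.Adj y b := fun y hy => by
    have := hb.eq_or hy.symm
    have := y.2
    grind
  have hnc : ∀ y : {y // P y}, G.Adj y c → y = d' := fun y hy => by
    have := hc.eq_or hy.symm
    have := y.2
    exact Subtype.ext (by grind)
  have hcov : ∀ y, y = a ∨ y = b ∨ y = c ∨ ∃ z : {y // P y}, z.1 = y := by
    intro y
    by_cases hy : y = a ∨ y = b ∨ y = c
    · tauto
    · exact Or.inr (Or.inr (Or.inr ⟨⟨y, hy⟩, rfl⟩))
  have hxdG : G'.Adj x' d' := (hG' _ _).mpr (Or.inr (Or.inl ⟨rfl, rfl⟩))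
  have hconn : G'.Connected := by
    refine connected_of_retraction h.conn
      (fun y => if hy : P y then ⟨y, hy⟩ else if y = c then d' else x')
      (fun y => ⟨y, by simp [y.2]⟩) ?_
    have ha0 : ¬ P a := by simp [hP]
    have hb0 : ¬ P b := by simp [hP]
    have hc0 : ¬ P c := by simp [hP]
    have hx0 : P x := hx
    have hd0 : P d := hd
    have hx1 : P x'.1 := hx
    have hd1 : P d'.1 := hd
    intro y z hyz
    rcases hcov y with rfl | rfl | rfl | ⟨y, rfl⟩
    · rcases ha.eq_or hyz with rfl | rfl
      · simp only [ha0, hac, hx0, dite_true, dite_false, if_false]; exact SimpleGraph.Reachable.refl _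
      · simp [ha0, hb0, hac, hbc]
    · rcases hb.eq_or hyz with rfl | rfl
      · simp [ha0, hb0, hac, hbc]
      · simpa [hb0, hc0, hbc] using hxdG.reachable
    · rcases hc.eq_or hyz with rfl | rfl
      · simpa [hb0, hc0, hbc] using hxdG.symm.reachable
      · simp only [hc0, hd0, dite_true, dite_false, if_true]; exact SimpleGraph.Reachable.refl _
    · rcases hcov z with rfl | rfl | rfl | ⟨z, rfl⟩
      · rw [hna y hyz]
        simp only [ha0, hac, hx1, dite_true, dite_false, if_false]; exact SimpleGraph.Reachable.refl _
      · exact absurd hyz (hnb y)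
      · rw [hnc y hyz]
        simp only [hc0, hd1, dite_true, dite_false, if_true]; exact SimpleGraph.Reachable.refl _
      · simpa [y.2, z.2] using ((hG' y z).mpr (Or.inl hyz)).reachable
  rcases h.good_or_exc hconn (x := a) (by simp [hP]) hx hd hxd with hg | he
  -- Both x and d lose one neighbour on the path and gain each other. Since they were not adjacent
  -- before, no degree drops.
  · have hnl : ∀ y, ¬ IsLeaf G' y := by
      rintro y ⟨u, hu⟩
      obtain ⟨p, q, hpq, hp, hq⟩ := h.exists_two_adj y
      have key : ∀ p, G.Adj y p → (p = a ∧ y = x' ∧ u = d') ∨ (p = c ∧ y = d' ∧ u = x') ∨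
          p = u.1 := by
        intro p hp
        rcases hcov p with rfl | rfl | rfl | ⟨p, rfl⟩
        · have := hna y hp
          subst this
          exact Or.inl ⟨rfl, rfl, ((hu _).mp hxdG).symm⟩
        · exact absurd hp (hnb y)
        · have := hnc y hp
          subst this
          exact Or.inr (Or.inl ⟨rfl, rfl, ((hu _).mp hxdG.symm).symm⟩)
        · exact Or.inr (Or.inr (congrArg Subtype.val ((hu p).mp ((hG' y p).mpr (Or.inl hp)))))
      rcases key p hp with ⟨rfl, rfl, rfl⟩ | ⟨rfl, rfl, rfl⟩ | rfl
      · rcases key q hq with ⟨rfl, -, -⟩ | ⟨-, e, -⟩ | rfl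
        · exact hpq rfl
        · exact hxd' e
        · exact hnadj hq
      · rcases key q hq with ⟨-, e, -⟩ | ⟨rfl, -, -⟩ | rfl
        · exact hxd' e.symm
        · exact hpq rfl
        · exact hnadj hq.symm
      · rcases key q hq with ⟨rfl, rfl, rfl⟩ | ⟨rfl, rfl, rfl⟩ | rfl
        · exact hnadj hp
        · exact hnadj hp.symm
        · exact hpq rfl
    exact h.not_colourable (colourable_of_subdivision (e := Subtype.val) (x := x') (d := d')
      Subtype.val_injective (fun y z => (hG' y z).mp) (hg.colourable_one hnl) hab hac hbc hcov
      (fun y hy => y.2 (Or.inl hy)) (fun y hy => y.2 (Or.inr (Or.inl hy)))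
      (fun y hy => y.2 (Or.inr (Or.inr hy))) ha.adj_left.symm ha.adj_right hb.adj_right
      hc.adj_right)
  have hspan : ∀ {n : ℕ} {E : List (Fin n × Fin n)} {φ : Fin n ≃ {y // P y}}
      (_ : ∀ i j, G'.Adj (φ i) (φ j) ↔ (i, j) ∈ E ∨ (j, i) ∈ E), ∃ i j, φ i = x' ∧ φ j = d' ∧
      AdjE E i j ∧ ∃ f : Fin (n + 3) → V, Function.Injective f ∧ (∀ y, ∃ k, f k = y) ∧
        Spans G f (subdivide E i j) := by
    intro n E φ hφ
    obtain ⟨i, hi⟩ := φ.surjective x'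
    obtain ⟨j, hj⟩ := φ.surjective d'
    refine ⟨i, j, hi, hj, (hφ i j).mp (hi ▸ hj ▸ hxdG),
      Fin.append (fun k => (φ k).1) ![a, b, c], ?_, ?_, ?_⟩
    · refine Fin.append_injective_iff.mpr ⟨Subtype.val_injective.comp φ.injective, ?_, ?_⟩
      · intro k l
        fin_cases k <;> fin_cases l <;> simp [hab, hac, hbc, hab.symm, hac.symm, hbc.symm]
      · intro k l
        have := (φ k).2
        fin_cases l <;> simp <;> grind
    · intro y
      rcases hcov y with rfl | rfl | rfl | ⟨y, rfl⟩
      · exact ⟨Fin.natAdd n 0, by simp⟩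
      · exact ⟨Fin.natAdd n 1, by simp⟩
      · exact ⟨Fin.natAdd n 2, by simp⟩
      · obtain ⟨k, rfl⟩ := φ.surjective y
        exact ⟨Fin.castAdd 3 k, by simp⟩
    · intro e he
      rw [subdivide, List.mem_append, List.mem_map] at he
      rcases he with ⟨e, he, rfl⟩ | he
      · rw [List.mem_filter, decide_eq_true_eq] at he
        obtain ⟨he, h1, h2⟩ := he
        simp only [Fin.append_left]
        rcases (hG' _ _).mp ((hφ e.1 e.2).mpr (Or.inl he)) with h3 | h3 | h3
        · exact h3
        · rw [← hi, ← hj, φ.apply_eq_iff_eq, φ.apply_eq_iff_eq] at h3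
          exact absurd (Prod.ext h3.1 h3.2) h1
        · rw [← hi, ← hj, φ.apply_eq_iff_eq, φ.apply_eq_iff_eq] at h3
          exact absurd (Prod.ext h3.1 h3.2) h2
      · simp only [List.mem_cons, List.not_mem_nil, or_false] at he
        rcases he with rfl | rfl | rfl | rfl
        · simp only [Fin.append_left, Fin.append_right, hi]
          exact ha.adj_left.symm
        · simp only [Fin.append_right]
          exact ha.adj_right
        · simp only [Fin.append_right]
          exact hb.adj_right
        · simp only [Fin.append_left, Fin.append_right, hj]
          exact hc.adj_right
  have htwo : ∀ {y p q}, Two G' y p q → y ≠ x' → y ≠ d' → Two G y.1 p.1 q.1 := by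
    intro y p q hy hyx hyd
    refine ⟨fun e => hy.1 (Subtype.ext e), fun w => ?_⟩
    rcases hcov w with rfl | rfl | rfl | ⟨w, rfl⟩
    · refine iff_of_false (fun e => hyx (hna y e)) ?_
      rintro (e | e)
      · exact p.2 (Or.inl e.symm)
      · exact q.2 (Or.inl e.symm)
    · refine iff_of_false (hnb y) ?_
      rintro (e | e)
      · exact p.2 (Or.inr (Or.inl e.symm))
      · exact q.2 (Or.inr (Or.inl e.symm))
    · refine iff_of_false (fun e => hyd (hnc y e)) ?_
      rintro (e | e)
      · exact p.2 (Or.inr (Or.inr e.symm))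
      · exact q.2 (Or.inr (Or.inr e.symm))
    · have := hy.2 w
      rw [hG'] at this
      rw [Subtype.val_inj, Subtype.val_inj, ← this]
      simp [hyx, hyd]
  have hbig : ∀ {y}, Big G' y → Big G y.1 := by
    rintro y ⟨p, q, r, hpq, hpr, hqr, hp, hq, hr⟩
    -- Undoing the contraction at y: the neighbour across the new edge is replaced by the first
    -- vertex of the removed path.
    let g : {y // P y} → V := fun z => if y = x' ∧ z = d' then a else
      if y = d' ∧ z = x' then c else z
    have hginj : ∀ p q, p ≠ q → g p ≠ g q := by
      intro p q hpq
      have h1 := p.2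
      have h2 := q.2
      have h3 : p.1 ≠ q.1 := fun e => hpq (Subtype.ext e)
      simp only [g]
      split_ifs <;> grind
    have hgadj : ∀ p, G'.Adj y p → G.Adj y (g p) := by
      intro p hp
      simp only [g]
      split_ifs with h1 h2
      · rw [h1.1]; exact ha.adj_left.symm
      · rw [h2.1]; exact hc.adj_right.symm
      · rcases (hG' _ _).mp hp with h3 | h3 | h3
        · exact h3
        · exact absurd h3 h1
        · exact absurd h3 h2
    exact ⟨g p, g q, g r, hginj _ _ hpq, hginj _ _ hpr, hginj _ _ hqr, hgadj _ hp, hgadj _ hq,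
      hgadj _ hr⟩
  rcases he with ⟨φ, hφ⟩ | ⟨φ, hφ⟩ | ⟨φ, hφ⟩ | ⟨S, hS, φ, hφ⟩
  · obtain ⟨i, j, hi, hj, hij, f, hf, hs, hsp⟩ := hspan hφ
    obtain ⟨g, -, hg1, hg2, hg3⟩ := subdivide_C4 i j hij
    refine h.false_of_or (colourable_or_exc_of_C7 (hsp.comp g hg3)
      (hf.comp fun a b => hg1 a b) fun x => ?_)
    obtain ⟨b, rfl⟩ := hs x
    obtain ⟨a, rfl⟩ := hg2 b
    exact ⟨a, rfl⟩
  · obtain ⟨i, j, hi, hj, hij, f, hf, hs, hsp⟩ := hspan hφ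
    obtain ⟨L, -, hL⟩ := subdivide_K23 i j hij
    exact h.not_colourable (hsp.colourable_one hf hs hL)
  · obtain ⟨i, j, hi, hj, hij, -⟩ := hspan hφ
    obtain ⟨k, l, m, p, hl, hm, hp, hl', hm', hp'⟩ := subdivide_BT i j hij
    have key : ∀ {l}, l ≠ i ∧ l ≠ j → φ l ≠ x' ∧ φ l ≠ d' := fun hl => by
      rw [← hi, ← hj]
      exact ⟨φ.injective.ne hl.1, φ.injective.ne hl.2⟩
    exact h.not_square_loop (htwo (hl.two hφ) (key hl').1 (key hl').2)
      (htwo (hm.two hφ) (key hm').1 (key hm').2) (htwo (hp.two hφ) (key hp').1 (key hp').2)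
  · obtain ⟨i, j, hi, hj, hij, f, hf, hs, hsp⟩ := hspan hφ
    rcases subdivide_hamilton S hS i j hij with ⟨L, -, hL⟩ | ⟨k, l, hk, hl, hkl, h1, h2⟩
    · exact h.not_colourable (hsp.colourable_one hf hs hL)
    · refine h.not_adj_of_big (hbig (hk.big hφ)) (hbig (hl.big hφ)) ?_
      rcases (hG' _ _).mp ((hφ k l).mpr hkl) with h3 | h3 | h3
      · exact h3
      · rw [← hi, ← hj, φ.apply_eq_iff_eq, φ.apply_eq_iff_eq] at h3
        exact absurd h3 h1
      · rw [← hi, ← hj, φ.apply_eq_iff_eq, φ.apply_eq_iff_eq] at h3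
        exact absurd h3 h2

/-- There are no three consecutive vertices of degree two. -/
theorem not_three_consecutive (h : Counterexample G) {x a b c d : V} (ha : Two G a x b)
    (hb : Two G b a c) (hc : Two G c b d) : False := by
  by_cases hxd : x = d
  · subst hxd
    exact h.not_square_loop ha hb hc
  by_cases hadj : G.Adj x d
  · rcases h.two_or_big x with ⟨y, z, hx⟩ | hx
    · have hx' : Two G x d a := by
        have h1 := hx.eq_or hadj
        have h2 := hx.eq_or ha.adj_left.symm
        have had : d ≠ a := by
          rintro rfl
          exact h.not_triangle_loop hb hc.symm
        rcases h1 with rfl | rfl <;> rcases h2 with rfl | rfl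
        · exact absurd rfl had
        · exact hx
        · exact hx.symm
        · exact absurd rfl had
      exact h.not_pentagon_loop hc.symm hb.symm ha.symm hx'.symm
    rcases h.two_or_big d with ⟨y, z, hd⟩ | hd
    · have hd' : Two G d x c := by
        have h1 := hd.eq_or hadj.symm
        have h2 := hd.eq_or hc.adj_right.symm
        have hxc : x ≠ c := by
          rintro rfl
          exact h.not_triangle_loop ha hb.symm
        rcases h1 with rfl | rfl <;> rcases h2 with rfl | rfl
        · exact absurd rfl hxc
        · exact hd
        · exact hd.symm
        · exact absurd rfl hxc
      exact h.not_pentagon_loop ha hb hc hd'.symm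
    · exact h.not_adj_of_big hx hd hadj
  · exact h.not_path ha hb hc hxd hadj

end Counterexample

/-! ### Twins and the skeleton of a counterexample -/

/-- Add a vertex with the same neighbours as `i`. -/
def addTwin {n : ℕ} (E : List (Fin n × Fin n)) (i : Fin n) : List (Fin (n + 1) × Fin (n + 1)) :=
  E.map (fun e => (e.1.castSucc, e.2.castSucc)) ++
    ((List.finRange n).filter fun j => AdjE E i j).map fun j => (j.castSucc, Fin.last n)

theorem addTwin_C4 : ∀ i, ∃ g ∈ [![(i + 1).castSucc, (i + 3).castSucc, i.castSucc,
    (i + 2).castSucc, 4]], (∀ a b : Fin 5, g a = g b → a = b) ∧ (∀ b : Fin 5, ∃ a, g a = b) ∧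
    ∀ e ∈ edgesK23, (g e.1, g e.2) ∈ addTwin edgesC4 i ∨ (g e.2, g e.1) ∈ addTwin edgesC4 i := by
  decide +kernel

theorem addTwin_K23 : ∀ i, BigE edgesK23 i ∨
    IsCert (addTwin edgesK23 i) [6, 10, 17, 33, 60] fun _ => 5 := by
  decide +kernel

theorem addTwin_BT : ∀ i, BigE edgesBT i ∨ ∃ x a b c d, TwoE edgesBT a x b ∧
    TwoE edgesBT b a c ∧ TwoE edgesBT c b d ∧
    ¬ AdjE edgesBT i a ∧ ¬ AdjE edgesBT i b ∧ ¬ AdjE edgesBT i c := by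
  decide +kernel

-- In every case a configuration that has already been excluded survives when the twin is put back.
set_option synthInstance.maxHeartbeats 400000 in
set_option synthInstance.maxSize 4000 in
theorem addTwin_hamilton : ∀ S ∈ hamTypes, ∀ i, (∃ k l, BigE (edgesHam S) k ∧
    BigE (edgesHam S) l ∧ AdjE (edgesHam S) k l) ∨ ∃ x a b c d, TwoE (edgesHam S) a x b ∧
    TwoE (edgesHam S) b a c ∧ TwoE (edgesHam S) c b d ∧
    ¬ AdjE (edgesHam S) i a ∧ ¬ AdjE (edgesHam S) i b ∧ ¬ AdjE (edgesHam S) i c := by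
  decide +kernel

namespace Counterexample

variable {V : Type u} [Fintype V] {G : SimpleGraph V}

/-- Delete m' and colour the rest, then let m' copy m. No leaf arises, as s and t have at least
three neighbours. If the rest is exceptional, restoring the twin turns the square into K_{2,3},
turns K_{2,3} into a graph with a certificate, or leaves an excluded configuration intact. -/
theorem eq_of_two (h : Counterexample G) {m m' s t : V} (hm : Two G m s t) (hm' : Two G m' s t)
    (hs : Big G s) (ht : Big G t) : m = m' := by
  classical
  by_contra hne
  have hmm : ∀ w, G.Adj m' w ↔ G.Adj m w := fun w => by rw [hm.2, hm'.2]
  have hnadj : ¬ G.Adj m m' := fun e => by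
    have := (hmm m').mpr e
    exact this.ne rfl
  set G' : SimpleGraph {y // y ≠ m'} := G.comap Subtype.val with hG'
  have hconn : G'.Connected := by
    refine connected_subtype h.conn (fun y => if y = m' then m else y) ?_ ?_ ?_
    · intro x
      split_ifs with hx
      · exact hne
      · exact hx
    · intro x hx
      rw [if_neg hx]
    · intro x y hxy
      simp only [hG', SimpleGraph.comap_adj]
      split_ifs with hx hy hy
      · exact Or.inl rfl
      · subst hx; exact Or.inr ((hmm y).mp hxy)
      · subst hy; exact Or.inr ((hmm x).mp hxy.symm).symm
      · exact Or.inr hxy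
  have hsm : s ≠ m' := hm'.adj_left.ne'
  rcases h.good_or_exc hconn (x := m') (by simp) hne hsm hm.ne_left with hg | he
  · have hnl : ∀ y, ¬ IsLeaf G' y := by
      intro y
      have : ∃ p q, p ≠ q ∧ p ≠ m' ∧ q ≠ m' ∧ G.Adj y p ∧ G.Adj y q := by
        by_cases hy : Big G y
        · exact hy.exists_ne m'
        have hym : ¬ G.Adj y m' := fun e => by
          rcases hm'.eq_or e.symm with e | e
          · exact hy (e ▸ hs)
          · exact hy (e ▸ ht)
        obtain ⟨p, q, hpq, hp, hq⟩ := h.exists_two_adj y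
        exact ⟨p, q, hpq, fun e => hym (e ▸ hp), fun e => hym (e ▸ hq), hp, hq⟩
      obtain ⟨p, q, hpq, hp, hq, hyp, hyq⟩ := this
      exact not_isLeaf_of_adj (a := ⟨p, hp⟩) (b := ⟨q, hq⟩)
        (fun e => hpq (congrArg Subtype.val e)) hyp hyq
    refine h.not_colourable ((hg.colourable_one hnl).pullback
      (fun y => if hy : y = m' then ⟨m, hne⟩ else ⟨y, hy⟩) (fun _ => le_rfl) ?_)
    rintro v ⟨w, hw⟩ hvw
    by_cases hv : v = m'
    · subst hv
      simp only [dite_true] at hvw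
      rcases hvw with e | e
      · exact ⟨v, by simpa using e.symm, Or.inl rfl⟩
      · exact ⟨w, by simp [hw], Or.inr ((hmm w).mpr e)⟩
    · simp only [hv, dite_false] at hvw
      refine ⟨w, by simp [hw], ?_⟩
      rcases hvw with e | e
      · exact Or.inl (congrArg Subtype.val e)
      · exact Or.inr e
  have hbig : ∀ {y}, Big G' y → Big G y.1 := by
    rintro y ⟨p, q, r, hpq, hpr, hqr, hp, hq, hr⟩
    exact ⟨p, q, r, fun e => hpq (Subtype.ext e), fun e => hpr (Subtype.ext e),
      fun e => hqr (Subtype.ext e), hp, hq, hr⟩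
  have htwo : ∀ {y p q}, Two G' y p q → ¬ G.Adj m y → Two G y.1 p.1 q.1 := by
    intro y p q hy hmy
    refine ⟨fun e => hy.1 (Subtype.ext e), fun w => ?_⟩
    by_cases hw : w = m'
    · refine iff_of_false (fun e => hmy ((hmm y).mp (hw ▸ e).symm)) ?_
      rintro (e | e)
      · exact p.2 (e ▸ hw)
      · exact q.2 (e ▸ hw)
    · have := hy.2 ⟨w, hw⟩
      rw [← Subtype.val_inj, ← Subtype.val_inj] at this
      exact this
  have hspan : ∀ {n : ℕ} {E : List (Fin n × Fin n)} {φ : Fin n ≃ {y // y ≠ m'}}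
      (_ : ∀ i j, G'.Adj (φ i) (φ j) ↔ (i, j) ∈ E ∨ (j, i) ∈ E), ∃ i, (φ i).1 = m ∧
      ∃ f : Fin (n + 1) → V, Function.Injective f ∧ (∀ y, ∃ k, f k = y) ∧
        Spans G f (addTwin E i) := by
    intro n E φ hφ
    obtain ⟨i, hi⟩ := φ.surjective ⟨m, hne⟩
    have hi' : (φ i).1 = m := congrArg Subtype.val hi
    refine ⟨i, hi', Fin.snoc (fun k => (φ k).1) m', ?_, ?_, ?_⟩
    · refine Fin.snoc_injective_iff.mpr ⟨Subtype.val_injective.comp φ.injective, ?_⟩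
      rintro ⟨k, hk⟩
      exact (φ k).2 hk
    · intro y
      by_cases hy : y = m'
      · exact ⟨Fin.last n, by simp [hy]⟩
      · obtain ⟨k, hk⟩ := φ.surjective ⟨y, hy⟩
        exact ⟨k.castSucc, by simp [hk]⟩
    · intro e he
      rw [addTwin, List.mem_append, List.mem_map, List.mem_map] at he
      rcases he with ⟨e, he, rfl⟩ | ⟨j, hj, rfl⟩
      · simp only [Fin.snoc_castSucc]
        exact (hφ e.1 e.2).mpr (Or.inl he)
      · rw [List.mem_filter, decide_eq_true_eq] at hj
        simp only [Fin.snoc_castSucc, Fin.snoc_last]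
        refine ((hmm _).mpr ?_).symm
        rw [← hi']
        exact (hφ i j).mpr hj.2
  have hnot : ∀ {n : ℕ} {E : List (Fin n × Fin n)} {φ : Fin n ≃ {y // y ≠ m'}}
      (_ : ∀ i j, G'.Adj (φ i) (φ j) ↔ (i, j) ∈ E ∨ (j, i) ∈ E) {i j}, (φ i).1 = m →
      ¬ AdjE E i j → ¬ G.Adj m (φ j) := by
    intro n E φ hφ i j hi hij hadj
    rw [← hi] at hadj
    exact hij ((hφ i j).mp hadj)
  rcases he with ⟨φ, hφ⟩ | ⟨φ, hφ⟩ | ⟨φ, hφ⟩ | ⟨S, hS, φ, hφ⟩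
  · obtain ⟨i, hi, f, hf, hs, hsp⟩ := hspan hφ
    obtain ⟨g, -, hg1, hg2, hg3⟩ := addTwin_C4 i
    refine h.false_of_or (colourable_or_exc_of_K23 (hsp.comp g hg3)
      (hf.comp fun a b => hg1 a b) fun x => ?_)
    obtain ⟨b, rfl⟩ := hs x
    obtain ⟨a, rfl⟩ := hg2 b
    exact ⟨a, rfl⟩
  · obtain ⟨i, hi, f, hf, hs, hsp⟩ := hspan hφ
    rcases addTwin_K23 i with hb | hL
    · exact (hi ▸ hm).not_big (hbig (hb.big hφ))
    · exact h.not_colourable (hsp.colourable_one hf hs hL)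
  · obtain ⟨i, hi, -⟩ := hspan hφ
    rcases addTwin_BT i with hb | ⟨x, a, b, c, d, ha, hb, hc, h1, h2, h3⟩
    · exact (hi ▸ hm).not_big (hbig (hb.big hφ))
    · exact h.not_three_consecutive (htwo (ha.two hφ) (hnot hφ hi h1))
        (htwo (hb.two hφ) (hnot hφ hi h2)) (htwo (hc.two hφ) (hnot hφ hi h3))
  · obtain ⟨i, hi, -⟩ := hspan hφ
    rcases addTwin_hamilton S hS i with ⟨k, l, hk, hl, hkl⟩ |
      ⟨x, a, b, c, d, ha, hb, hc, h1, h2, h3⟩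
    · exact h.not_adj_of_big (hbig (hk.big hφ)) (hbig (hl.big hφ)) ((hφ k l).mpr hkl)
    · exact h.not_three_consecutive (htwo (ha.two hφ) (hnot hφ hi h1))
        (htwo (hb.two hφ) (hnot hφ hi h2)) (htwo (hc.two hφ) (hnot hφ hi h3))

theorem two_of_adj (h : Counterexample G) {v w : V} (hvw : G.Adj v w) (hv : ¬ Big G v) :
    ∃ z, Two G v w z := by
  obtain ⟨y, z, hyz⟩ := (h.two_or_big v).resolve_right hv
  rcases hyz.eq_or hvw with rfl | rfl
  · exact ⟨z, hyz⟩
  · exact ⟨y, hyz.symm⟩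

theorem exists_mate (h : Counterexample G) {p s q : V} (hp : Two G p s q)
    (hq : ¬ Big G q) : ∃ t, Two G q t p ∧ Big G t := by
  obtain ⟨t, ht⟩ := h.two_of_adj hp.adj_right.symm hq
  refine ⟨t, ht.symm, ?_⟩
  by_contra hbig
  obtain ⟨r, hr⟩ := h.two_of_adj ht.adj_right.symm hbig
  exact h.not_three_consecutive hp ht hr

/-- A vertex of degree two has a branch neighbour, for otherwise three such vertices would be
consecutive. The inner vertices of long paths are those with just one branch neighbour. The two ends
of a long path differ, since otherwise there would be a pendant triangle. -/
theorem skeleton (h : Counterexample G) : Nonempty (Skeleton G) := by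
  let T := {p : V // ∃ s q, Two G p s q ∧ Big G s ∧ ¬ Big G q}
  choose foot mate' htwo hbig hnot using fun p : T => p.2
  have hmate : ∀ p : T, ∃ q : T, q.1 = mate' p := fun p => by
    obtain ⟨t, ht, htb⟩ := h.exists_mate (htwo p) (hnot p)
    exact ⟨⟨mate' p, t, p, ht, htb, (htwo p).not_big⟩, rfl⟩
  choose mate hmate using hmate
  have htwo' : ∀ p : T, Two G p.1 (foot p) (mate p).1 := fun p => by
    rw [hmate]; exact htwo p
  have hmm : ∀ p, mate (mate p) = p := fun p => by
    rcases (htwo' (mate p)).eq_or (htwo' p).adj_right.symm with e | e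
    · exact absurd (e ▸ hbig (mate p)) (htwo' p).not_big
    · exact Subtype.ext e.symm
  refine ⟨⟨T, Subtype.val, mate, foot, htwo', hmm, hbig, fun p e => ?_, Subtype.val_injective,
    fun v => ?_, fun u v hu hv => h.not_adj_of_big hu hv,
    fun m m' s t hm hm' hs ht => h.eq_of_two hm hm' hs ht⟩⟩
  · have h2 := htwo' (mate p)
    rw [hmm, ← e] at h2
    exact h.not_triangle_loop (htwo' p) h2
  · rcases h.two_or_big v with ⟨s, t, hv⟩ | hv
    · right
      by_cases hs : Big G s <;> by_cases ht : Big G t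
      · exact Or.inl ⟨s, t, hv, hs, ht⟩
      · exact Or.inr ⟨⟨v, s, t, hv, hs, ht⟩, rfl⟩
      · exact Or.inr ⟨⟨v, t, s, hv.symm, ht, hs⟩, rfl⟩
      · obtain ⟨x, hx⟩ := h.two_of_adj hv.adj_left.symm hs
        obtain ⟨y, hy⟩ := h.two_of_adj hv.adj_right.symm ht
        exact (h.not_three_consecutive hx.symm hv hy).elim
    · exact Or.inl hv

theorem false (h : Counterexample G) : False := by
  classical
  obtain ⟨S⟩ := h.skeleton
  exact h.not_colourable S.colourable

end Counterexample

/-! ### Induction on the number of vertices, then on subgraphs -/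

theorem good_or_exc (n : ℕ) : ∀ (V : Type u) [Fintype V] (G : SimpleGraph V),
    Fintype.card V = n → G.Connected → 2 ≤ Fintype.card V → Good G ∨ Exc G := by
  induction n using Nat.strong_induction_on with
  | _ n ih =>
    intro V _ G hn
    induction G using WellFoundedLT.induction with
    | _ G ihG =>
      intro hconn hcard
      by_contra hcon
      rw [not_or] at hcon
      exact Counterexample.false (G := G) ⟨hconn, hcard, hcon.1, hcon.2,
        fun V' _ G' hlt h1 h2 => ih _ (hn ▸ hlt) V' G' rfl h1 h2,
        fun G' hlt h1 => ihG G' hlt h1 hcard⟩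

/-! ### Translation to colourings and the fractional domatic number -/

theorem randomSubsetProb_eq_pr {V : Type*} [Fintype V] (μ : Finset V → ℝ) (E : Finset V → Prop) :
    randomSubsetProb μ E = pr μ E := by
  classical
  rw [randomSubsetProb, pr, Finset.sum_filter]
  refine Finset.sum_congr rfl fun D _ => ?_
  by_cases h : E D <;> simp [ind, h]

theorem leafDemand_eq_demand {V : Type*} [Fintype V] (G : SimpleGraph V) [DecidableRel G.Adj]
    (v : V) : G.leafDemand v = demand G v := by
  have h : G.degree v = 1 ↔ IsLeaf G v := by
    rw [SimpleGraph.degree_eq_one_iff_existsUnique_adj]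
    constructor
    · rintro ⟨u, hu, hu'⟩
      exact ⟨u, fun w => ⟨hu' w, by rintro rfl; exact hu⟩⟩
    · rintro ⟨u, hu⟩
      exact ⟨u, (hu u).mpr rfl, fun w => (hu w).mp⟩
  rw [SimpleGraph.leafDemand]
  split_ifs with hd
  · rw [demand_of_leaf (h.mp hd)]
  · rw [demand_eq_one fun hl => hd (h.mpr hl)]

theorem Good.exists_colouring {V : Type*} [Fintype V] {G : SimpleGraph V} [DecidableRel G.Adj]
    (h : Good G) : ∃ μ : Finset V → ℝ, G.IsFDominatingColouring G.leafDemand (2 / 5) μ := by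
  classical
  obtain ⟨w, hw, h⟩ := h
  have hsum : ∀ g : Set V → ℝ, ∑ F : Finset V, g F = ∑ D, g D := fun g =>
    Fintype.sum_equiv Fintype.finsetEquivSet _ _ fun _ => rfl
  have hpr : ∀ E : Set V → Prop, pr (fun F : Finset V => w F) (fun F => E F) = pr w E :=
    fun E => hsum fun D => w D * ind (E D)
  refine ⟨fun F => w F, ⟨fun F => hw.nonneg _, (hsum w).trans hw.sum_eq⟩, fun v => ⟨?_, ?_⟩⟩
  · rw [randomSubsetProb_eq_pr, leafDemand_eq_demand]
    refine (h v).1.trans (le_of_eq ?_)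
    rw [← hpr]
    rfl
  · rw [randomSubsetProb_eq_pr, ← (h v).2, ← hpr]
    rfl

/-- With demand 1 the law is supported on dominating sets, so 5/2 times the law is feasible and has
total weight 5/2. -/
theorem five_halves_le_of_colouring {V : Type*} [Fintype V] [Nonempty V] {G : SimpleGraph V}
    {f : V → ℝ} (hf : ∀ v, f v = 1) {μ : Finset V → ℝ}
    (h : G.IsFDominatingColouring f (2 / 5) μ) : 5 / 2 ≤ G.fractionalDomaticNumber := by
  classical
  obtain ⟨hμ, h⟩ := h
  have hw : IsLaw μ := ⟨hμ.1, hμ.2⟩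
  have hdom : ∀ D, D ∉ G.dominatingSets → μ D = 0 := by
    intro D hD
    by_contra hne
    have hpos : 0 < μ D := lt_of_le_of_ne (hμ.1 D) (Ne.symm hne)
    refine hD ?_
    rw [SimpleGraph.dominatingSets, Finset.mem_filter]
    refine ⟨Finset.mem_univ _, fun v => ?_⟩
    have h1 := (h v).1
    rw [hf, randomSubsetProb_eq_pr] at h1
    exact of_one_le_pr hw h1 hpos
  refine le_csSup G.bddAbove_fractionalDomaticValues
    ⟨fun D => 5 / 2 * μ D, ⟨fun D _ => mul_nonneg (by norm_num) (hμ.1 D), fun v => ?_⟩, ?_⟩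
  · rw [← Finset.mul_sum]
    have h2 : ∑ D ∈ G.dominatingSets.filter (fun D => v ∈ D), μ D ≤ 2 / 5 := by
      rw [← (h v).2, randomSubsetProb]
      refine Finset.sum_le_sum_of_subset_of_nonneg (fun D hD => ?_) fun D _ _ => hμ.1 D
      simp only [Finset.mem_filter, Finset.mem_univ, true_and] at hD ⊢
      exact hD.2
    have h3 : 5 / 2 * ∑ D ∈ G.dominatingSets.filter (fun D => v ∈ D), μ D ≤ 1 := by linarith
    convert h3
  · rw [← Finset.mul_sum, Finset.sum_subset (Finset.subset_univ _) fun D _ hD => hdom D hD]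
    have h4 : ∑ D, μ D = 1 := hμ.2
    rw [h4, mul_one]

end FracDom

theorem mainTheorem1 {V : Type*} [Fintype V] (G : SimpleGraph V) [DecidableRel G.Adj]
    (hconn : G.Connected) (hexc : ¬ G.IsExceptional) :
    (2 ≤ G.minDegree → 5 / 2 ≤ G.fractionalDomaticNumber) ∧
    (2 ≤ Fintype.card V →
      ∃ μ : Finset V → ℝ, G.IsFDominatingColouring G.leafDemand (2 / 5) μ) := by
  have hb : 2 ≤ Fintype.card V →
      ∃ μ : Finset V → ℝ, G.IsFDominatingColouring G.leafDemand (2 / 5) μ := fun hcard =>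
    ((FracDom.good_or_exc _ V G rfl hconn hcard).resolve_right fun h =>
      hexc (FracDom.isExceptional_iff.mpr h)).exists_colouring
  refine ⟨fun hdeg => ?_, hb⟩
  have hne : Nonempty V := hconn.nonempty
  have hdeg' : ∀ v, 2 ≤ G.degree v := fun v => hdeg.trans (G.minDegree_le_degree v)
  obtain ⟨v⟩ := hne
  -- Minimum degree two supplies the vertex count needed for (b) and leaves no vertex with demand
  -- 4/5.
  obtain ⟨μ, hμ⟩ := hb ((hdeg' v).trans (G.degree_lt_card_verts v).le)
  have : Nonempty V := ⟨v⟩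
  refine FracDom.five_halves_le_of_colouring (fun u => ?_) hμ
  have := hdeg' u
  rw [SimpleGraph.leafDemand, if_neg (by omega)]
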